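/- Fix integers $p,n\ge 0$ and consider $(p+1)$-tuples of complex $n\times n$ matrices in either of two versions. In the additive version a solution is a tuple of matrices $A_j\in gl(n,\mathbf C)$ with $A_1+\dots+A_{p+1}=0$. In the multiplicative version it is a tuple of matrices $A_j\in GL(n,\mathbf C)$ with $A_1\cdots A_{p+1}=I$. The index of rigidity of a tuple is that of its conjugacy classes: $\kappa=2n^2-\sum_{j=1}^{p+1}d_j$, where $d_j$ is the complex dimension of the $GL(n,\mathbf C)$-conjugacy class of $A_j$. A tuple is reducible if it has a common invariant subspace other than $0$ and $\mathbf C^n$, and irreducible if $n>0$ and it is not reducible. Its centralizer is trivial if only scalar matrices commute with all $A_j$. A solution $A$ is rigid if every solution $A'$ in some neighbourhood of $A$, with $A'_j$ conjugate to $A_j$ for each $j$, is obtained from $A$ by a simultaneous conjugation by an element of $GL(n,\mathbf C)$. A subquotient of $A$ is the tuple of matrices, in some basis, of the maps induced by the $A_j$ on $W/W'$, where $W'\subset W$ are common invariant subspaces. The following holds in both versions. 1. Let $A$ be a reducible solution with trivial centralizer and index of rigidity $2$. Then $A$ is simultaneously conjugate to a block upper-triangular tuple, with $s\ge 2$ diagonal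 blocks whose sizes are the same for all $j$, such that for each $i=1,\dots,s$ the $(p+1)$-tuple of the $i$-th diagonal blocks is irreducible and has index of rigidity $2$. 2. If $A$ is a rigid solution, then every irreducible subquotient of $A$ is a rigid solution (of its own size, in the same version). This holds both when neighbourhoods are taken, in the hypothesis and in the conclusion, in the classical topology, and when they are taken in the Zariski topology. -/

import Mathlib

open scoped Topology

namespace DeligneSimpson

/-- The two versions of the problem: tuples of matrices `A_j` in `gl(n, ℂ)` with sum `0`, and
tuples of matrices `M_j` in `GL(n, ℂ)` with product `1`. -/
inductive Version
  | additive
  | multiplicative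

section

variable {p : ℕ} {ι : Type*} [Fintype ι] [DecidableEq ι]

/-- The relation imposed on a tuple: `A_1 + ⋯ + A_{p+1} = 0` in the additive version,
`M_1 ⋯ M_{p+1} = 1` in the multiplicative one. In the latter case every `M_j` is automatically
invertible, so that the tuple lies in `GL(n, ℂ)`. -/
def IsSolution : Version → (Fin (p + 1) → Matrix ι ι ℂ) → Prop
  | .additive, A => ∑ j, A j = 0
  | .multiplicative, M => (List.ofFn M).prod = 1

/-- The conjugacy class of `Y` under `GL(n, ℂ)`. -/
def conjClass (Y : Matrix ι ι ℂ) : Set (Matrix ι ι ℂ) :=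
  {Z | ∃ g : GL ι ℂ, Z = (g : Matrix ι ι ℂ) * Y * ((g⁻¹ : GL ι ℂ) : Matrix ι ι ℂ)}

/-- The complex dimension of the conjugacy class of `Y`, a complex submanifold of the space of
matrices: the dimension of its tangent space at `Y`. -/
noncomputable def classDim (Y : Matrix ι ι ℂ) : ℕ :=
  Module.finrank ℂ (Submodule.span ℂ (tangentConeAt ℂ (conjClass Y) Y))

/-- The index of rigidity `2 n² - ∑ d_j` of the tuple of conjugacy classes of the matrices `A_j`,
where `d_j` is the dimension of the class of `A_j`. -/
noncomputable def rigidityIndex (A : Fin (p + 1) → Matrix ι ι ℂ) : ℤ :=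
  2 * (Fintype.card ι : ℤ) ^ 2 - ∑ j, (classDim (A j) : ℤ)

/-- The subspace `W` of `ℂⁿ` is invariant under every matrix of the tuple. -/
def IsInvariant (A : Fin (p + 1) → Matrix ι ι ℂ) (W : Submodule ℂ (ι → ℂ)) : Prop :=
  ∀ j, ∀ w ∈ W, (A j).mulVec w ∈ W

/-- There is a common invariant subspace other than `0` and the whole space. -/
def IsReducibleTuple (A : Fin (p + 1) → Matrix ι ι ℂ) : Prop :=
  ∃ W : Submodule ℂ (ι → ℂ), IsInvariant A W ∧ W ≠ ⊥ ∧ W ≠ ⊤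

/-- The space is non-zero and `0` and the whole space are the only common invariant subspaces. -/
def IsIrreducibleTuple (A : Fin (p + 1) → Matrix ι ι ℂ) : Prop :=
  Nonempty ι ∧ ∀ W : Submodule ℂ (ι → ℂ), IsInvariant A W → W = ⊥ ∨ W = ⊤

/-- Only scalar matrices commute with every matrix of the tuple. -/
def HasTrivialCentralizer (A : Fin (p + 1) → Matrix ι ι ℂ) : Prop :=
  ∀ X : Matrix ι ι ℂ, (∀ j, X * A j = A j * X) → ∃ c : ℂ, X = c • (1 : Matrix ι ι ℂ)

/-- The tuple `A'` is obtained from `A` by a simultaneous conjugation. -/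
def IsConjTo (A A' : Fin (p + 1) → Matrix ι ι ℂ) : Prop :=
  ∃ g : GL ι ℂ, ∀ j, A' j = (g : Matrix ι ι ℂ) * A j * ((g⁻¹ : GL ι ℂ) : Matrix ι ι ℂ)

/-- Every solution that lies in `U` and in the conjugacy classes of the matrices `A_j` is
simultaneously conjugate to `A`. -/
def IsRigidOn (v : Version) (A : Fin (p + 1) → Matrix ι ι ℂ)
    (U : Set (Fin (p + 1) → Matrix ι ι ℂ)) : Prop :=
  ∀ A' ∈ U, IsSolution v A' → (∀ j, A' j ∈ conjClass (A j)) → IsConjTo A A'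

/-- Rigid solutions, with neighbourhoods taken in the classical topology. -/
def IsRigid (v : Version) (A : Fin (p + 1) → Matrix ι ι ℂ) : Prop :=
  IsSolution v A ∧ ∃ U ∈ 𝓝 A, IsRigidOn v A U

/-- Rigid solutions, with neighbourhoods taken in the Zariski topology. The sets on which one
polynomial in the matrix entries does not vanish form a basis of this topology. -/
def IsZariskiRigid (v : Version) (A : Fin (p + 1) → Matrix ι ι ℂ) : Prop :=
  IsSolution v A ∧ ∃ f : MvPolynomial (Fin (p + 1) × ι × ι) ℂ,
    MvPolynomial.eval (fun k => A k.1 k.2.1 k.2.2) f ≠ 0 ∧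
    IsRigidOn v A {A' | MvPolynomial.eval (fun k => A' k.1 k.2.1 k.2.2) f ≠ 0}

/-- The tuple `B` is (in some basis) the action of `A` on a subquotient of `ℂⁿ`: on the quotient
of an invariant subspace `W` by the kernel of the equivariant surjection `f`. -/
def IsSubquotient {κ : Type*} [Fintype κ] (B : Fin (p + 1) → Matrix κ κ ℂ)
    (A : Fin (p + 1) → Matrix ι ι ℂ) : Prop :=
  ∃ (W : Submodule ℂ (ι → ℂ)) (hW : IsInvariant A W) (f : W →ₗ[ℂ] (κ → ℂ)),
    Function.Surjective f ∧
    ∀ j, ∀ w : W, f ⟨(A j).mulVec w, hW j w w.2⟩ = (B j).mulVec (f w)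

end

end DeligneSimpson

open DeligneSimpson

/-! For tuples `A`, `B` of sizes `n`, `m` let `chi A B` be `2nm` minus the sum of the ranks of `X ↦
B_j X - X A_j`. The tangent space of a conjugacy class is the image of such a map, so `chi A A` is
the index of rigidity (`rigidityIndex_eq_chi`). For solutions, `chi A B` is the Euler characteristic
of the complex `X ↦ (B_j X - X A_j)_j`, followed by the derivative of the relation. Its H⁰ is Hom(A,
B), its H² embeds in the dual of Hom(B, A), and H¹ measures deformations. Hence `chi A B ≤ dim
Hom(A, B) + dim Hom(B, A)` (`chi_le`).

For an irreducible solution `B` this gives `chi B B ≤ 2`. The index is even, since classes are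
even-dimensional, so `chi B B > 0` forces the value 2. By Katz's argument `B` is then determined by
its conjugacy classes alone (`IsIrreducibleTuple.isConjTo_of_chi_eq_two`), which is rigidity in
either topology. Both parts thus reduce to showing `chi B B > 0` for every irreducible subquotient
`B`.

This is done by `chi_pos_of_isSubquotient` for any notion of rigidity that makes `chi` positive and
passes to the ends of extensions of `Q` by `K` with Hom(K, Q) = 0. Inside `A`, let `K` be an
iterated self-extension of an irreducible subtuple `S` of the largest possible size. Then Hom(K, Q)
= 0, so both ends are rigid. If `chi S S` were not positive, subadditivity would give `chi K K ≤ 0`;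
the other constituents lie in `Q`, where induction applies.

Part 1 uses H¹ = 0 (`IsInfRigid`), which follows from index 2 and trivial centralizer. Part 2 uses
`IsConjRigid`, stability under conjugating the individual `A_j` by matrices near 1. Both pass to the
ends because the obstruction to extending a deformation of `K` and `Q` lies in the dual of Hom(K, Q)
= 0. Positivity of `chi` is an Euler characteristic count for `IsInfRigid`. For `IsConjRigid` it is
a dimension count: if `chi A A ≤ 0`, more than `n²` transversal parameters are subject to `n²`
equations, and the common zeros are not isolated (`exists_seq_common_zeros`). -/

namespace DeligneSimpson

open MvPolynomial Filter Topology

/-! ### Common zeros of few polynomials are not isolated in the classical topology -/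

section IsolatedZeros

lemma pow_card_le_norm_prod {δ : ℝ} (hδ : 0 ≤ δ) (m : Multiset ℂ) (h : ∀ z ∈ m, δ ≤ ‖z‖) :
    δ ^ Multiset.card m ≤ ‖m.prod‖ := by
  induction m using Multiset.induction_on with
  | empty => simp
  | cons a s ih =>
    rw [Multiset.card_cons, Multiset.prod_cons, norm_mul, pow_succ']
    exact mul_le_mul (h a (Multiset.mem_cons_self a s))
      (ih fun z hz => h z (Multiset.mem_cons_of_mem hz)) (by positivity) (norm_nonneg a)

/-- A monic complex polynomial has a root that is small if its constant coefficient is. -/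
lemma exists_root_norm_pow_le {q : Polynomial ℂ} (hq : q.Monic) (hd : 0 < q.natDegree) :
    ∃ z, q.IsRoot z ∧ ‖z‖ ^ q.natDegree ≤ ‖q.coeff 0‖ := by
  classical
  have hs := IsAlgClosed.splits q
  have hcard : Multiset.card q.roots = q.natDegree := hs.natDegree_eq_card_roots.symm
  have hne : q.roots.toFinset.Nonempty := by
    rw [Multiset.toFinset_nonempty, ← Multiset.card_pos]; omega
  -- Up to sign the constant coefficient is the product of the roots, so a root of least modulus
  -- works.
  obtain ⟨z, hz, hmin⟩ := q.roots.toFinset.exists_min_image (fun z => ‖z‖) hne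
  refine ⟨z, (Polynomial.mem_roots'.1 (Multiset.mem_toFinset.1 hz)).2, ?_⟩
  have := pow_card_le_norm_prod (norm_nonneg z) q.roots
    fun w hw => hmin w (Multiset.mem_toFinset.2 hw)
  rw [hs.coeff_zero_eq_prod_roots_of_monic hq]
  simpa [hcard] using this

/-- Cauchy's bound, with the supremum of the coefficients replaced by their sum, which visibly
converges when the coefficients do. -/
lemma norm_root_le {q : Polynomial ℂ} (hq : q.Monic) {z : ℂ} (hz : q.IsRoot z) :
    ‖z‖ ≤ 1 + ∑ k ∈ Finset.range q.natDegree, ‖q.coeff k‖ := by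
  have h := hz.norm_lt_cauchyBound hq.ne_zero
  have h2 : ((q.cauchyBound : NNReal) : ℝ) ≤
      1 + ∑ k ∈ Finset.range q.natDegree, ‖q.coeff k‖ := by
    have : q.cauchyBound ≤ 1 + ∑ k ∈ Finset.range q.natDegree, ‖q.coeff k‖₊ := by
      rw [Polynomial.cauchyBound, hq.leadingCoeff, nnnorm_one, div_one, add_comm]
      gcongr
      refine Finset.sup_le fun k hk => ?_
      exact Finset.single_le_sum (f := fun k => ‖q.coeff k‖₊) (fun _ _ => zero_le) hk
    simpa using NNReal.coe_le_coe.2 this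
  exact (NNReal.coe_le_coe.2 h.le).trans h2

/-- Some maximal ideal has height equal to the Krull dimension `a`, and translations move its point
to any other. -/
lemma height_vanishingIdeal_singleton {a : ℕ} (x : Fin a → ℂ) :
    (vanishingIdeal ℂ {x} : Ideal (MvPolynomial (Fin a) ℂ)).height = a := by
  have hdim : ringKrullDim (MvPolynomial (Fin a) ℂ) = a := by
    rw [MvPolynomial.ringKrullDim_of_isNoetherianRing]; simp
  have : FiniteRingKrullDim (MvPolynomial (Fin a) ℂ) := by
    rw [finiteRingKrullDim_iff_ne_bot_and_top, hdim]
    exact ⟨WithBot.coe_ne_bot (a := (a : ℕ∞)),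
      fun h => ENat.natCast_ne_top a (WithBot.coe_injective h)⟩
  obtain ⟨m, hm, hh⟩ := Ideal.exists_isMaximal_height (R := MvPolynomial (Fin a) ℂ)
  obtain ⟨z, rfl⟩ := isMaximal_iff_eq_vanishingIdeal_singleton.1 hm
  rw [hdim] at hh
  have hh' : (vanishingIdeal ℂ {z} : Ideal (MvPolynomial (Fin a) ℂ)).height = a := by
    exact_mod_cast hh
  rw [← hh']
  let e : MvPolynomial (Fin a) ℂ ≃ₐ[ℂ] MvPolynomial (Fin a) ℂ :=
    AlgEquiv.ofAlgHom (aeval fun i => X i + C (x i - z i)) (aeval fun i => X i - C (x i - z i))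
      (by ext i; simp) (by ext i; simp)
  have hcomap : (vanishingIdeal ℂ {x} : Ideal (MvPolynomial (Fin a) ℂ))
      = (vanishingIdeal ℂ {z}).comap e.toRingEquiv := by
    ext f
    rw [Ideal.mem_comap, mem_vanishingIdeal_singleton_iff, mem_vanishingIdeal_singleton_iff]
    have : aeval x f = aeval z (e f) := by
      have : (aeval x : MvPolynomial (Fin a) ℂ →ₐ[ℂ] ℂ) = (aeval z).comp e.toAlgHom := by
        ext i; simp [e]
      rw [this]; rfl
    rw [this]; rfl
  rw [hcomap]
  exact RingEquiv.height_comap _ _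

/-- Krull's height theorem: a minimal prime over the `F i` has height at most their number, hence
less than the height `a` of the maximal ideal of the origin. -/
lemma exists_prime_lt_vanishingIdeal {a : ℕ} {κ : Type*} [Fintype κ] (h : Fintype.card κ < a)
    (F : κ → MvPolynomial (Fin a) ℂ) (hF : ∀ i, eval 0 (F i) = 0) :
    ∃ P : Ideal (MvPolynomial (Fin a) ℂ), P.IsPrime ∧ (∀ i, F i ∈ P) ∧
      P < vanishingIdeal ℂ {(0 : Fin a → ℂ)} := by
  have hmax : (vanishingIdeal ℂ {(0 : Fin a → ℂ)} : Ideal (MvPolynomial (Fin a) ℂ)).IsMaximal :=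
    isMaximal_iff_eq_vanishingIdeal_singleton.2 ⟨0, rfl⟩
  have hle : Ideal.span (Set.range F) ≤ vanishingIdeal ℂ {(0 : Fin a → ℂ)} := by
    rw [Ideal.span_le]
    rintro _ ⟨i, rfl⟩
    rw [SetLike.mem_coe, mem_vanishingIdeal_singleton_iff]
    exact hF i
  have := hmax.isPrime
  obtain ⟨P, hP, hPle⟩ := Ideal.exists_minimalPrimes_le hle
  refine ⟨P, hP.1.1, fun i => hP.1.2 (Ideal.subset_span ⟨i, rfl⟩), lt_of_le_of_ne hPle ?_⟩
  rintro rfl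
  have h1 := Ideal.height_le_card_of_mem_minimalPrimes_span (Set.finite_range F) hP
  rw [height_vanishingIdeal_singleton] at h1
  have h2 : (Set.range F).ncard ≤ Fintype.card κ := by
    rw [← Set.image_univ, ← Nat.card_eq_fintype_card, ← Set.ncard_univ]
    exact Set.ncard_image_le Set.finite_univ
  have h3 : a ≤ (Set.range F).ncard := by exact_mod_cast h1
  omega

/-- A point lies over given values of the coordinates of a Noether normalization and of one more
function, as soon as these satisfy the minimal equation. -/
lemma exists_point_over {a s : ℕ} {R : Type} [CommRing R] [IsDomain R] [Algebra ℂ R]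
    (π : MvPolynomial (Fin a) ℂ →ₐ[ℂ] R) (hπ : Function.Surjective π)
    [Algebra (MvPolynomial (Fin s) ℂ) R] [Algebra.IsIntegral (MvPolynomial (Fin s) ℂ) R]
    [Module.IsTorsionFree (MvPolynomial (Fin s) ℂ) R] [IsScalarTower ℂ (MvPolynomial (Fin s) ℂ) R]
    (Y : Fin s → MvPolynomial (Fin a) ℂ)
    (hY : ∀ i, π (Y i) = algebraMap (MvPolynomial (Fin s) ℂ) R (X i))
    (t : MvPolynomial (Fin a) ℂ) (y : Fin s → ℂ) (τ : ℂ)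
    (hτ : ((minpoly (MvPolynomial (Fin s) ℂ) (π t)).map (eval y)).IsRoot τ) :
    ∃ x : Fin a → ℂ, (∀ f, π f = 0 → eval x f = 0) ∧ (∀ i, eval x (Y i) = y i) ∧
      eval x t = τ := by
  let φ : Polynomial (MvPolynomial (Fin s) ℂ) →+* R := (Polynomial.aeval (R := (MvPolynomial (Fin s) ℂ)) (π t)).toRingHom
  let ψ : Polynomial (MvPolynomial (Fin s) ℂ) →+* ℂ := Polynomial.eval₂RingHom (eval y) τ
  have hψ : Function.Surjective ψ := fun c => ⟨Polynomial.C (C c), by simp [ψ]⟩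
  have hmax : (RingHom.ker ψ).IsMaximal := RingHom.ker_isMaximal_of_surjective ψ hψ
  let _ : Algebra (Polynomial (MvPolynomial (Fin s) ℂ)) R := φ.toAlgebra
  have hst : IsScalarTower (MvPolynomial (Fin s) ℂ) (Polynomial (MvPolynomial (Fin s) ℂ)) R := IsScalarTower.of_algebraMap_eq fun r => by
    change _ = φ (Polynomial.C r)
    simp [φ]
  have hint : Algebra.IsIntegral (Polynomial (MvPolynomial (Fin s) ℂ)) R := ⟨fun r =>
    (Algebra.IsIntegral.isIntegral (R := (MvPolynomial (Fin s) ℂ)) r).tower_top⟩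
  -- Lying over, for the map sending the variable to `π t`. Its kernel is generated by the minimal
  -- polynomial, because a polynomial ring over a field is integrally closed, and that polynomial
  -- vanishes at `(y, τ)`.
  obtain ⟨Q, hQ, hQc⟩ := Ideal.exists_ideal_over_maximal_of_isIntegral (S := R) (RingHom.ker ψ)
    (by
      intro f hf
      have hf' : Polynomial.aeval (R := (MvPolynomial (Fin s) ℂ)) (π t) f = 0 := hf
      obtain ⟨g, rfl⟩ := minpoly.isIntegrallyClosed_dvd
        (Algebra.IsIntegral.isIntegral (R := (MvPolynomial (Fin s) ℂ)) (π t)) hf'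
      rw [RingHom.mem_ker, map_mul]
      have : ψ (minpoly (MvPolynomial (Fin s) ℂ) (π t)) = 0 := by
        rw [Polynomial.IsRoot, Polynomial.eval_map] at hτ
        exact hτ
      rw [this, zero_mul])
  have hQm : (Q.comap (π : MvPolynomial (Fin a) ℂ →+* R)).IsMaximal :=
    Ideal.comap_isMaximal_of_surjective _ hπ
  obtain ⟨x, hx⟩ := isMaximal_iff_eq_vanishingIdeal_singleton.1 hQm
  have hmem : ∀ f : MvPolynomial (Fin a) ℂ, π f ∈ Q → eval x f = 0 := by
    intro f hf
    have : f ∈ Q.comap (π : MvPolynomial (Fin a) ℂ →+* R) := hf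
    rw [hx, mem_vanishingIdeal_singleton_iff] at this
    exact this
  have hmem' : ∀ g : Polynomial (MvPolynomial (Fin s) ℂ), ψ g = 0 → φ g ∈ Q := by
    intro g hg
    have : g ∈ Q.comap (algebraMap (Polynomial (MvPolynomial (Fin s) ℂ)) R) := by rw [hQc]; exact hg
    exact this
  have hC : ∀ c : ℂ, π (C c) = algebraMap (MvPolynomial (Fin s) ℂ) R (C c) := by
    intro c
    rw [← algebraMap_eq, ← algebraMap_eq, AlgHom.commutes]
    exact IsScalarTower.algebraMap_apply ℂ (MvPolynomial (Fin s) ℂ) R c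
  refine ⟨x, fun f hf => hmem f ?_, fun i => ?_, ?_⟩
  · rw [hf]; exact Q.zero_mem
  · have h1 := hmem (Y i - C (y i)) (by
      have := hmem' (Polynomial.C (X i - C (y i))) (by simp [ψ])
      have h2 : φ (Polynomial.C (X i - C (y i))) = π (Y i - C (y i)) := by
        rw [map_sub π, hY, hC]
        simp [φ]
      rwa [h2] at this)
    rw [map_sub, eval_C, sub_eq_zero] at h1
    exact h1
  · have h1 := hmem (t - C τ) (by
      have := hmem' (Polynomial.X - Polynomial.C (C τ)) (by simp [ψ])
      have h2 : φ (Polynomial.X - Polynomial.C (C τ)) = π (t - C τ) := by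
        rw [map_sub π, hC]
        simp [φ]
      rwa [h2] at this)
    rw [map_sub, eval_C, sub_eq_zero] at h1
    exact h1

/-- The origin is not isolated in an irreducible variety through it of positive dimension. -/
lemma exists_seq_zeros_of_domain {a : ℕ} {R : Type} [CommRing R] [IsDomain R] [Algebra ℂ R]
    (π : MvPolynomial (Fin a) ℂ →ₐ[ℂ] R) (hπ : Function.Surjective π)
    (h0 : ∀ f, π f = 0 → eval 0 f = 0) (h1 : ∃ f, eval 0 f = 0 ∧ π f ≠ 0) :
    ∃ x : ℕ → Fin a → ℂ, Tendsto x atTop (𝓝 0) ∧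
      ∀ n, x n ≠ 0 ∧ ∀ f, π f = 0 → eval (x n) f = 0 := by
  classical
  have : Algebra.FiniteType ℂ R := Algebra.FiniteType.of_surjective π hπ
  -- Noether normalization: the variety is a finite cover of affine `s`-space, and the sequence will
  -- be lifted from the base.
  obtain ⟨s, g, hinj, hg⟩ := exists_integral_inj_algHom_of_fg ℂ R
  let _ : Algebra (MvPolynomial (Fin s) ℂ) R := g.toRingHom.toAlgebra
  have hst : IsScalarTower ℂ (MvPolynomial (Fin s) ℂ) R :=
    IsScalarTower.of_algebraMap_eq fun r => (g.commutes r).symm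
  have hint : Algebra.IsIntegral (MvPolynomial (Fin s) ℂ) R := ⟨hg⟩
  have hinj' : Function.Injective (algebraMap (MvPolynomial (Fin s) ℂ) R) := hinj
  have htf : Module.IsTorsionFree (MvPolynomial (Fin s) ℂ) R :=
    Module.isTorsionFree_iff_algebraMap_injective.2 hinj'
  choose Y hY using fun i => hπ (algebraMap (MvPolynomial (Fin s) ℂ) R (X i))
  let y : (Fin a → ℂ) → Fin s → ℂ := fun x i => eval x (Y i)
  have hycont : Continuous y := continuous_pi fun i => MvPolynomial.continuous_eval (Y i)
  -- minimal equations hold at the points of the variety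
  have hpoly : ∀ (f : MvPolynomial (Fin a) ℂ) (x : Fin a → ℂ), (∀ f, π f = 0 → eval x f = 0) →
      ((minpoly (MvPolynomial (Fin s) ℂ) (π f)).map (eval (y x))).IsRoot (eval x f) := by
    intro f x hx
    let e : R →ₐ[ℂ] ℂ := (Ideal.Quotient.liftₐ (RingHom.ker π) (aeval x) hx).comp
      (Ideal.quotientKerAlgEquivOfSurjective hπ).symm.toAlgHom
    have he : ∀ f, e (π f) = eval x f := fun f => by
      have : (Ideal.quotientKerAlgEquivOfSurjective hπ).symm (π f) = Ideal.Quotient.mk _ f := by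
        rw [AlgEquiv.symm_apply_eq]; rfl
      change (Ideal.Quotient.liftₐ (RingHom.ker π) (aeval x) hx)
        ((Ideal.quotientKerAlgEquivOfSurjective hπ).symm (π f)) = _
      rw [this]; rfl
    have h2 : (e : R →+* ℂ).comp (algebraMap (MvPolynomial (Fin s) ℂ) R) = eval (y x) := by
      apply MvPolynomial.ringHom_ext
      · intro r
        have : algebraMap (MvPolynomial (Fin s) ℂ) R (C r) = algebraMap ℂ R r :=
          (IsScalarTower.algebraMap_apply ℂ (MvPolynomial (Fin s) ℂ) R r).symm
        simp [this]
      · intro i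
        simp only [RingHom.comp_apply, ← hY, RingHom.coe_coe, he, eval_X, y]
    rw [Polynomial.IsRoot, Polynomial.eval_map, ← h2, ← he]
    have := Polynomial.hom_eval₂ (minpoly (MvPolynomial (Fin s) ℂ) (π f))
      (algebraMap (MvPolynomial (Fin s) ℂ) R) (e : R →+* ℂ) (π f)
    rw [← Polynomial.aeval_def, minpoly.aeval, map_zero] at this
    exact this.symm
  have hmonic : ∀ f z, ((minpoly (MvPolynomial (Fin s) ℂ) (π f)).map (eval z)).Monic := fun f z =>
    (minpoly.monic (Algebra.IsIntegral.isIntegral (π f))).map _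
  have hdeg : ∀ f z, ((minpoly (MvPolynomial (Fin s) ℂ) (π f)).map (eval z)).natDegree =
      (minpoly (MvPolynomial (Fin s) ℂ) (π f)).natDegree := fun f z =>
    (minpoly.monic (Algebra.IsIntegral.isIntegral (π f))).natDegree_map _
  -- the dimension is positive
  have hs : 0 < s := by
    rcases Nat.eq_zero_or_pos s with rfl | h
    · exfalso
      -- For `s = 0` the integral extension `R` would be a field, but `π f` is non-zero and cannot
      -- be invertible, as `f` vanishes at the origin.
      have hf : IsField (MvPolynomial (Fin 0) ℂ) :=
        (MvPolynomial.isEmptyAlgEquiv ℂ (Fin 0)).toMulEquiv.isField (Field.toIsField ℂ)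
      have hR := (Algebra.IsIntegral.isField_iff_isField hinj').1 hf
      obtain ⟨f, hf0, hf⟩ := h1
      obtain ⟨b, hb⟩ := hR.mul_inv_cancel hf
      obtain ⟨b, rfl⟩ := hπ b
      have := h0 (f * b - 1) (by rw [map_sub, map_mul, hb, map_one, sub_self])
      rw [map_sub, map_mul, hf0] at this
      simp at this
    · exact h
  -- the fibre through the origin is finite
  let Z : Set (Fin a → ℂ) := {x | (∀ f, π f = 0 → eval x f = 0) ∧ y x = y 0 ∧ x ≠ 0}
  have hZ : Z.Finite := by
    apply (Set.Finite.pi' (t := fun i : Fin a => {z : ℂ |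
      ((minpoly (MvPolynomial (Fin s) ℂ) (π (X i))).map (eval (y 0))).IsRoot z})
      fun i => Polynomial.finite_setOfPred_isRoot (hmonic _ _).ne_zero).subset
    intro x hx i
    have := hpoly (X i) x hx.1
    rwa [hx.2.1, eval_X] at this
  -- a function that vanishes at the origin but nowhere else on this fibre
  obtain ⟨t, ht0, ht⟩ : ∃ t : MvPolynomial (Fin a) ℂ, eval 0 t = 0 ∧ ∀ x ∈ Z, eval x t ≠ 0 := by
    have : ∀ x : Fin a → ℂ, ∃ i, x ≠ 0 → x i ≠ 0 := fun x => by
      by_cases hx : x = 0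
      · exact ⟨⟨0, by
          rcases Nat.eq_zero_or_pos a with rfl | h
          · obtain ⟨f, hf0, hf⟩ := h1
            exfalso
            apply hf
            rw [eq_C_of_isEmpty f] at hf0 ⊢
            rw [eval_C] at hf0
            simp [hf0]
          · exact h⟩, fun h => absurd hx h⟩
      · obtain ⟨i, hi⟩ := Function.ne_iff.1 hx
        exact ⟨i, fun _ => hi⟩
    choose i hi using this
    -- Every factor is 1 at the origin, and the factor of `z` vanishes at `z`; so this function is 0
    -- at the origin and 1 on `Z`.
    refine ⟨1 - ∏ z ∈ hZ.toFinset, (1 - C (z (i z))⁻¹ * X (i z)), by simp, fun x hx => ?_⟩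
    have : ∏ z ∈ hZ.toFinset, eval x (1 - C (z (i z))⁻¹ * X (i z)) = 0 :=
      Finset.prod_eq_zero (hZ.mem_toFinset.2 hx) (by simp [hi x hx.2.2])
    rw [map_sub, map_prod, this]
    simp
  let q := minpoly (MvPolynomial (Fin s) ℂ) (π t)
  let z : ℕ → Fin s → ℂ := fun n => y 0 + Pi.single ⟨0, hs⟩ ((1 : ℂ) / ((n : ℂ) + 1))
  have hzne : ∀ n, z n ≠ y 0 := fun n h => by
    have := congrFun h ⟨0, hs⟩
    simp only [z, Pi.add_apply, Pi.single_eq_same, add_eq_left, one_div, inv_eq_zero] at this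
    exact Nat.cast_add_one_ne_zero n this
  have hz : Tendsto z atTop (𝓝 (y 0)) := by
    have h1 : Tendsto (fun n : ℕ => (1 : ℂ) / ((n : ℂ) + 1)) atTop (𝓝 0) :=
      tendsto_one_div_add_atTop_nhds_zero_nat
    have h2 : Continuous fun c : ℂ => y 0 + (Pi.single ⟨0, hs⟩ c : Fin s → ℂ) :=
      continuous_const.add (continuous_single (A := fun _ : Fin s => ℂ) _)
    have := (h2.tendsto 0).comp h1
    simp only [Pi.single_zero, add_zero] at this
    exact this
  have hcoeff : ∀ p : MvPolynomial (Fin s) ℂ,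
      Tendsto (fun n => eval (z n) p) atTop (𝓝 (eval (y 0) p)) := fun p =>
    ((MvPolynomial.continuous_eval p).tendsto _).comp hz
  -- As `t` vanishes at the origin, the constant coefficient of its minimal equation vanishes over
  -- `y 0`. Over `z n` it is therefore small, and so is some root `τ n`.
  have hq0 : eval (y 0) (q.coeff 0) = 0 := by
    have := hpoly t 0 h0
    rw [ht0, Polynomial.IsRoot, ← Polynomial.coeff_zero_eq_eval_zero, Polynomial.coeff_map] at this
    exact this
  have hqd : 0 < q.natDegree := minpoly.natDegree_pos (Algebra.IsIntegral.isIntegral (π t))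
  choose τ hτ hτle using fun n => exists_root_norm_pow_le (hmonic t (z n))
    (by rw [hdeg]; exact hqd)
  have hτ0 : Tendsto τ atTop (𝓝 0) := by
    have h1 : Tendsto (fun n => ‖eval (z n) (q.coeff 0)‖) atTop (𝓝 0) := by
      have := (hcoeff (q.coeff 0)).norm
      rwa [hq0, norm_zero] at this
    rw [tendsto_zero_iff_norm_tendsto_zero, Metric.tendsto_atTop]
    intro δ hδ
    obtain ⟨N, hN⟩ := Metric.tendsto_atTop.1 h1 (δ ^ q.natDegree) (by positivity)
    refine ⟨N, fun n hn => ?_⟩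
    have h2 := hN n hn
    have h3 := hτle n
    rw [hdeg, Polynomial.coeff_map] at h3
    simp only [dist_zero_right, norm_norm] at h2 ⊢
    exact lt_of_pow_lt_pow_left₀ _ hδ.le (h3.trans_lt h2)
  choose x hxP hxy hxt using fun n => exists_point_over π hπ Y hY t (z n) (τ n) (hτ n)
  have hyx : ∀ n, y (x n) = z n := fun n => funext fun i => hxy n i
  -- Integrality of the coordinates bounds the lifted points, so convergence only requires
  -- identifying their cluster points.
  have hbdd : ∀ i, ∃ B : ℝ, ∀ n, ‖x n i‖ ≤ B := by
    intro i
    let p := minpoly (MvPolynomial (Fin s) ℂ) (π (X i))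
    have h1 : Tendsto (fun n => 1 + ∑ k ∈ Finset.range p.natDegree, ‖eval (z n) (p.coeff k)‖) atTop
        (𝓝 (1 + ∑ k ∈ Finset.range p.natDegree, ‖eval (y 0) (p.coeff k)‖)) :=
      tendsto_const_nhds.add (tendsto_finsetSum _ fun k _ => (hcoeff _).norm)
    obtain ⟨B, hB⟩ := h1.bddAbove_range
    refine ⟨B, fun n => le_trans ?_ (hB ⟨n, rfl⟩)⟩
    have h2 := hpoly (X i) (x n) (hxP n)
    have h3 := norm_root_le (hmonic _ _) h2
    rw [eval_X, hdeg, hyx] at h3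
    simpa only [Polynomial.coeff_map] using h3
  choose B hB using hbdd
  refine ⟨x, ?_, fun n => ⟨fun h => hzne n ?_, hxP n⟩⟩
  · have hc : IsCompact (Set.pi Set.univ fun i => Metric.closedBall (0 : ℂ) (B i)) :=
      isCompact_univ_pi fun i => isCompact_closedBall _ _
    refine hc.tendsto_nhds_of_unique_mapClusterPt (Eventually.of_forall fun n i _ => by
      simpa using hB i n) fun c _ hcl => ?_
    -- A cluster point is on the variety, lies over `y 0` and satisfies `t = 0`; by the choice of
    -- `t` it is the origin.
    obtain ⟨U, hU, hUx⟩ := mapClusterPt_iff_ultrafilter.1 hcl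
    have hev : ∀ f : MvPolynomial (Fin a) ℂ, Tendsto (fun n => eval (x n) f) U (𝓝 (eval c f)) :=
      fun f => ((MvPolynomial.continuous_eval f).tendsto c).comp hUx
    have hcP : ∀ f, π f = 0 → eval c f = 0 := fun f hf =>
      tendsto_nhds_unique (hev f) (by simp only [hxP _ f hf]; exact tendsto_const_nhds)
    have hcy : y c = y 0 :=
      tendsto_nhds_unique ((hycont.tendsto c).comp hUx) (by
        have : y ∘ x = z := funext hyx
        rw [this]; exact hz.mono_left hU)
    have hct : eval c t = 0 :=
      tendsto_nhds_unique (hev t) (by simp only [hxt]; exact hτ0.mono_left hU)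
    by_contra hc0
    exact ht c ⟨hcP, hcy, hc0⟩ hct
  · rw [← hyx, h]

/-- Fewer equations than unknowns: the common zeros of complex polynomials are not isolated. -/
theorem exists_seq_common_zeros {a : ℕ} {κ : Type*} [Fintype κ] (h : Fintype.card κ < a)
    (F : κ → MvPolynomial (Fin a) ℂ) (hF : ∀ i, eval 0 (F i) = 0) :
    ∃ x : ℕ → Fin a → ℂ, Tendsto x atTop (𝓝 0) ∧ ∀ n, x n ≠ 0 ∧ ∀ i, eval (x n) (F i) = 0 := by
  obtain ⟨P, hP, hFP, hlt⟩ := exists_prime_lt_vanishingIdeal h F hF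
  have hmem : ∀ f, Ideal.Quotient.mkₐ ℂ P f = 0 ↔ f ∈ P := fun f =>
    Ideal.Quotient.eq_zero_iff_mem
  obtain ⟨f, hf, hfP⟩ := SetLike.exists_of_lt hlt
  obtain ⟨x, hx, hx'⟩ := exists_seq_zeros_of_domain (Ideal.Quotient.mkₐ ℂ P)
    (Ideal.Quotient.mkₐ_surjective ℂ P)
    (fun f hf => (mem_vanishingIdeal_singleton_iff _ _).1 (hlt.le ((hmem f).1 hf)))
    ⟨f, (mem_vanishingIdeal_singleton_iff _ _).1 hf, fun h => hfP ((hmem f).1 h)⟩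
  exact ⟨x, hx, fun n => ⟨(hx' n).1, fun i => (hx' n).2 _ ((hmem _).2 (hFP i))⟩⟩

end IsolatedZeros
end DeligneSimpson

namespace DeligneSimpson

open Matrix
set_option linter.unusedSectionVars false

/-! ### Tuples as modules: intertwiners, extensions, subquotients -/

section Intertwiners

variable {p : ℕ} {ι κ μ : Type} [Fintype ι] [DecidableEq ι] [Fintype κ] [DecidableEq κ]
  [Fintype μ] [DecidableEq μ]

/-- The space of matrices intertwining the tuples `A` and `B`. -/
def homSpace (A : Fin (p + 1) → Matrix ι ι ℂ) (B : Fin (p + 1) → Matrix κ κ ℂ) :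
    Submodule ℂ (Matrix κ ι ℂ) where
  carrier := {X | ∀ j, B j * X = X * A j}
  add_mem' h₁ h₂ j := by rw [Matrix.mul_add, Matrix.add_mul, h₁ j, h₂ j]
  zero_mem' j := by simp
  smul_mem' c X h j := by rw [Matrix.mul_smul, Matrix.smul_mul, h j]

lemma mem_homSpace {A : Fin (p + 1) → Matrix ι ι ℂ} {B : Fin (p + 1) → Matrix κ κ ℂ}
    {X : Matrix κ ι ℂ} : X ∈ homSpace A B ↔ ∀ j, B j * X = X * A j := Iff.rfl

lemma homSpace_comp {A : Fin (p + 1) → Matrix ι ι ℂ} {B : Fin (p + 1) → Matrix κ κ ℂ}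
    {D : Fin (p + 1) → Matrix μ μ ℂ} {X : Matrix κ ι ℂ} {Y : Matrix μ κ ℂ}
    (hY : Y ∈ homSpace B D) (hX : X ∈ homSpace A B) : Y * X ∈ homSpace A D := fun j => by
  rw [← Matrix.mul_assoc, hY j, Matrix.mul_assoc, hX j, Matrix.mul_assoc]

/-- Equivalence of tuples of matrices of possibly different index types. -/
def IsEquivTuple (A : Fin (p + 1) → Matrix ι ι ℂ) (B : Fin (p + 1) → Matrix κ κ ℂ) : Prop :=
  ∃ (X : Matrix κ ι ℂ) (Y : Matrix ι κ ℂ), X * Y = 1 ∧ Y * X = 1 ∧ X ∈ homSpace A B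

lemma IsEquivTuple.refl (A : Fin (p + 1) → Matrix ι ι ℂ) : IsEquivTuple A A :=
  ⟨1, 1, by simp, by simp, fun j => by simp⟩

lemma inverse_mem_homSpace {A : Fin (p + 1) → Matrix ι ι ℂ} {B : Fin (p + 1) → Matrix κ κ ℂ}
    {X : Matrix κ ι ℂ} {Y : Matrix ι κ ℂ} (h₁ : X * Y = 1) (h₂ : Y * X = 1)
    (hX : X ∈ homSpace A B) : Y ∈ homSpace B A := fun j => by
  calc A j * Y = Y * X * (A j * Y) := by rw [h₂, Matrix.one_mul]
    _ = Y * (X * A j) * Y := by simp only [Matrix.mul_assoc]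
    _ = Y * (B j) * (X * Y) := by rw [← hX j]; simp only [Matrix.mul_assoc]
    _ = Y * B j := by rw [h₁, Matrix.mul_one]

lemma IsEquivTuple.symm {A : Fin (p + 1) → Matrix ι ι ℂ} {B : Fin (p + 1) → Matrix κ κ ℂ}
    (h : IsEquivTuple A B) : IsEquivTuple B A := by
  obtain ⟨X, Y, h₁, h₂, hX⟩ := h
  exact ⟨Y, X, h₂, h₁, inverse_mem_homSpace h₁ h₂ hX⟩

lemma IsEquivTuple.trans {A : Fin (p + 1) → Matrix ι ι ℂ} {B : Fin (p + 1) → Matrix κ κ ℂ}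
    {D : Fin (p + 1) → Matrix μ μ ℂ} (h : IsEquivTuple A B) (h' : IsEquivTuple B D) :
    IsEquivTuple A D := by
  obtain ⟨X, Y, h₁, h₂, hX⟩ := h
  obtain ⟨X', Y', h₁', h₂', hX'⟩ := h'
  refine ⟨X' * X, Y * Y', ?_, ?_, homSpace_comp hX' hX⟩
  · rw [Matrix.mul_assoc, ← Matrix.mul_assoc X, h₁, Matrix.one_mul, h₁']
  · rw [Matrix.mul_assoc, ← Matrix.mul_assoc Y', h₂', Matrix.one_mul, h₂]

lemma IsEquivTuple.isConjTo {A B : Fin (p + 1) → Matrix ι ι ℂ} (h : IsEquivTuple A B) :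
    IsConjTo A B := by
  obtain ⟨X, Y, h₁, h₂, hX⟩ := h
  refine ⟨⟨X, Y, h₁, h₂⟩, fun j => ?_⟩
  change B j = X * A j * Y
  rw [← hX j, Matrix.mul_assoc, h₁, Matrix.mul_one]

lemma IsConjTo.isEquivTuple {A B : Fin (p + 1) → Matrix ι ι ℂ} (h : IsConjTo A B) :
    IsEquivTuple A B := by
  obtain ⟨g, hg⟩ := h
  refine ⟨g, ((g⁻¹ : GL ι ℂ) : Matrix ι ι ℂ), g.mul_inv, g.inv_mul, fun j => ?_⟩
  rw [hg j, Matrix.mul_assoc, Matrix.mul_assoc]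
  have : ((g⁻¹ : GL ι ℂ) : Matrix ι ι ℂ) * (g : Matrix ι ι ℂ) = 1 := g.inv_mul
  rw [this, Matrix.mul_one]

lemma isEquivTuple_of_equiv {A : Fin (p + 1) → Matrix ι ι ℂ} {B : Fin (p + 1) → Matrix κ κ ℂ}
    (e : κ ≃ ι) (h : ∀ j a c, B j a c = A j (e a) (e c)) : IsEquivTuple A B := by
  refine ⟨(1 : Matrix ι ι ℂ).submatrix e id, (1 : Matrix ι ι ℂ).submatrix id e, ?_, ?_, ?_⟩
  · rw [← Matrix.submatrix_mul _ _ _ _ _ Function.bijective_id, Matrix.one_mul,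
      Matrix.submatrix_one_equiv]
  · rw [← Matrix.submatrix_mul _ _ _ _ _ e.bijective, Matrix.one_mul, Matrix.submatrix_id_id]
  · intro j
    have hB : B j = (A j).submatrix e e := by ext a c; exact h j a c
    rw [hB, ← Matrix.submatrix_mul _ _ _ _ _ e.bijective, Matrix.mul_one]
    ext a c
    simp [Matrix.mul_apply, Matrix.one_apply]

lemma IsEquivTuple.card_eq {A : Fin (p + 1) → Matrix ι ι ℂ} {B : Fin (p + 1) → Matrix κ κ ℂ}
    (h : IsEquivTuple A B) : Fintype.card ι = Fintype.card κ := by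
  obtain ⟨X, Y, h₁, h₂, -⟩ := h
  have e : (ι → ℂ) ≃ₗ[ℂ] (κ → ℂ) := Matrix.toLin'OfInv h₂ h₁
  simpa using e.finrank_eq

/-- The tuple of block upper-triangular matrices with diagonal blocks `K`, `Q`. -/
def blk (K : Fin (p + 1) → Matrix ι ι ℂ) (N : Fin (p + 1) → Matrix ι κ ℂ)
    (Q : Fin (p + 1) → Matrix κ κ ℂ) : Fin (p + 1) → Matrix (ι ⊕ κ) (ι ⊕ κ) ℂ :=
  fun j => fromBlocks (K j) (N j) 0 (Q j)

lemma toCols₁_mem_homSpace {K : Fin (p + 1) → Matrix ι ι ℂ} {N : Fin (p + 1) → Matrix ι κ ℂ}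
    {Q : Fin (p + 1) → Matrix κ κ ℂ} {M : Fin (p + 1) → Matrix μ μ ℂ} {X : Matrix μ (ι ⊕ κ) ℂ}
    (h : X ∈ homSpace (blk K N Q) M) : X.toCols₁ ∈ homSpace K M := fun j => by
  have := congrArg Matrix.toCols₁ (h j)
  rw [← fromCols_toCols X, blk, fromCols_mul_fromBlocks, mul_fromCols] at this
  simpa using this

lemma toCols₂_mem_homSpace {K : Fin (p + 1) → Matrix ι ι ℂ} {N : Fin (p + 1) → Matrix ι κ ℂ}
    {Q : Fin (p + 1) → Matrix κ κ ℂ} {M : Fin (p + 1) → Matrix μ μ ℂ} {X : Matrix μ (ι ⊕ κ) ℂ}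
    (h : X ∈ homSpace (blk K N Q) M) (h0 : X.toCols₁ = 0) : X.toCols₂ ∈ homSpace Q M := fun j => by
  have := congrArg Matrix.toCols₂ (h j)
  rw [← fromCols_toCols X, blk, fromCols_mul_fromBlocks, mul_fromCols, h0] at this
  simpa using this

/-- Schur's lemma: the kernel of an intertwiner is invariant. The next lemma is its dual, with the
range. -/
lemma mulVec_injective_of_irreducible {S : Fin (p + 1) → Matrix ι ι ℂ}
    {A : Fin (p + 1) → Matrix κ κ ℂ} (hS : IsIrreducibleTuple S) {X : Matrix κ ι ℂ}
    (hX : X ∈ homSpace S A) (h0 : X ≠ 0) : Function.Injective X.mulVec := by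
  have hinv : IsInvariant S (LinearMap.ker X.mulVecLin) := fun j w hw => by
    rw [LinearMap.mem_ker, mulVecLin_apply] at hw ⊢
    rw [mulVec_mulVec, ← hX j, ← mulVec_mulVec, hw, mulVec_zero]
  rcases hS.2 _ hinv with h | h
  · exact LinearMap.ker_eq_bot.1 h
  · exact absurd (Matrix.toLin'.injective ((LinearMap.ker_eq_top.1 h).trans
      (map_zero Matrix.toLin').symm)) h0

lemma mulVec_surjective_of_irreducible {S : Fin (p + 1) → Matrix ι ι ℂ}
    {A : Fin (p + 1) → Matrix κ κ ℂ} (hS : IsIrreducibleTuple S) {X : Matrix ι κ ℂ}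
    (hX : X ∈ homSpace A S) (h0 : X ≠ 0) : Function.Surjective X.mulVec := by
  have hinv : IsInvariant S (LinearMap.range X.mulVecLin) := by
    rintro j _ ⟨w, rfl⟩
    refine ⟨(A j).mulVec w, ?_⟩
    rw [mulVecLin_apply, mulVecLin_apply, mulVec_mulVec, ← hX j, ← mulVec_mulVec]
  rcases hS.2 _ hinv with h | h
  · exact absurd (Matrix.toLin'.injective ((LinearMap.range_eq_bot.1 h).trans
      (map_zero Matrix.toLin').symm)) h0
  · exact LinearMap.range_eq_top.1 h

lemma isEquivTuple_of_bijective {A : Fin (p + 1) → Matrix ι ι ℂ} {B : Fin (p + 1) → Matrix κ κ ℂ}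
    {X : Matrix κ ι ℂ} (hX : X ∈ homSpace A B) (hb : Function.Bijective X.mulVec) :
    IsEquivTuple A B := by
  let e : (ι → ℂ) ≃ₗ[ℂ] (κ → ℂ) := LinearEquiv.ofBijective X.mulVecLin hb
  have he : LinearMap.toMatrix' (e : (ι → ℂ) →ₗ[ℂ] (κ → ℂ)) = X := by
    have : (e : (ι → ℂ) →ₗ[ℂ] (κ → ℂ)) = Matrix.toLin' X := rfl
    rw [this, LinearMap.toMatrix'_toLin']
  refine ⟨X, LinearMap.toMatrix' (e.symm : (κ → ℂ) →ₗ[ℂ] (ι → ℂ)), ?_, ?_, hX⟩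
  · rw [← he, ← LinearMap.toMatrix'_comp]; simp
  · rw [← he, ← LinearMap.toMatrix'_comp]; simp

/-- An embedding of tuples can be brought to block form. -/
lemma exists_blk_of_injective {S : Fin (p + 1) → Matrix κ κ ℂ} {A : Fin (p + 1) → Matrix ι ι ℂ}
    {X : Matrix ι κ ℂ} (hX : X ∈ homSpace S A) (hinj : Function.Injective X.mulVec) :
    ∃ (m : ℕ) (N : Fin (p + 1) → Matrix κ (Fin m) ℂ)
      (Q : Fin (p + 1) → Matrix (Fin m) (Fin m) ℂ), IsEquivTuple A (blk S N Q) := by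
  let f := X.mulVecLin
  obtain ⟨C, hC⟩ := Submodule.exists_isCompl (LinearMap.range f)
  let b := Module.finBasis ℂ C
  let m := Module.finrank ℂ C
  -- Coordinates adapted to the image of `X` and a complement `C`; in them `X` becomes the inclusion
  -- `E` of the first block.
  let e : (κ ⊕ Fin m → ℂ) ≃ₗ[ℂ] (ι → ℂ) :=
    (LinearEquiv.sumArrowLequivProdArrow κ (Fin m) ℂ ℂ).trans
      (((LinearEquiv.ofInjective f hinj).prodCongr b.equivFun.symm).trans
        (Submodule.prodEquivOfIsCompl _ C hC))
  let Z := LinearMap.toMatrix' (e : (κ ⊕ Fin m → ℂ) →ₗ[ℂ] (ι → ℂ))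
  let Z' := LinearMap.toMatrix' (e.symm : (ι → ℂ) →ₗ[ℂ] (κ ⊕ Fin m → ℂ))
  have h₁ : Z * Z' = 1 := by rw [← LinearMap.toMatrix'_comp]; simp
  have h₂ : Z' * Z = 1 := by rw [← LinearMap.toMatrix'_comp]; simp
  let E : Matrix (κ ⊕ Fin m) κ ℂ := fromRows 1 0
  have hE : ∀ (T : Matrix (κ ⊕ Fin m) (κ ⊕ Fin m) ℂ), T * E = fromRows T.toBlocks₁₁ T.toBlocks₂₁ :=
    fun T => by
      conv_lhs => rw [← fromBlocks_toBlocks T]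
      simp [E, fromBlocks_mul_fromRows]
  have hZ : Z * E = X := by
    ext i c
    have h : e (Pi.single (Sum.inl c) 1) = X.mulVec (Pi.single c 1) := by
      have h1 : LinearEquiv.sumArrowLequivProdArrow κ (Fin m) ℂ ℂ (Pi.single (Sum.inl c) 1) =
          (Pi.single c 1, 0) := by
        ext x
        · simp [Pi.single_apply]
        · simp
      simp only [e, LinearEquiv.trans_apply, h1]
      simp only [LinearEquiv.prodCongr_apply, map_zero, Submodule.coe_prodEquivOfIsCompl',
        ZeroMemClass.coe_zero, add_zero]
      rfl
    have h2 : (Z * E) i c = Z i (Sum.inl c) := by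
      simp [E, Matrix.mul_apply, Matrix.one_apply]
    rw [h2]
    have := congrFun h i
    rw [mulVec_single_one] at this
    rw [← col_apply X, ← this]
    simp [Z, LinearMap.toMatrix'_apply]
  have hZ' : Z' * X = E := by
    rw [← hZ, ← Matrix.mul_assoc, h₂, Matrix.one_mul]
  have hcol : ∀ j, Z' * A j * Z * E = fromRows (S j) 0 := fun j => by
    rw [Matrix.mul_assoc, hZ, Matrix.mul_assoc, hX j, ← Matrix.mul_assoc, hZ', fromRows_mul]
    simp
  have hblk : ∀ j, Z' * A j * Z = fromBlocks (S j) (Z' * A j * Z).toBlocks₁₂ 0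
      (Z' * A j * Z).toBlocks₂₂ := fun j => by
    have h := hcol j
    rw [hE] at h
    have h1 := fromRows_inj h
    conv_lhs => rw [← fromBlocks_toBlocks (Z' * A j * Z), h1.1, h1.2]
  refine ⟨m, fun j => (Z' * A j * Z).toBlocks₁₂, fun j => (Z' * A j * Z).toBlocks₂₂,
    Z', Z, h₂, h₁, fun j => ?_⟩
  rw [blk, ← hblk, Matrix.mul_assoc, h₁, Matrix.mul_one]

/-- A non-zero tuple contains an irreducible one. -/
lemma exists_irreducible_sub [Nonempty ι] (A : Fin (p + 1) → Matrix ι ι ℂ) :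
    ∃ (k : ℕ) (S : Fin (p + 1) → Matrix (Fin k) (Fin k) ℂ) (X : Matrix ι (Fin k) ℂ),
      IsIrreducibleTuple S ∧ X ∈ homSpace S A ∧ Function.Injective X.mulVec := by
  classical
  -- A non-zero invariant subspace of least dimension is irreducible.
  have hex : ∃ d, ∃ W : Submodule ℂ (ι → ℂ), IsInvariant A W ∧ W ≠ ⊥ ∧ Module.finrank ℂ W = d :=
    ⟨_, ⊤, fun _ _ _ => Submodule.mem_top, top_ne_bot, rfl⟩
  obtain ⟨W, hW, hW0, hWd⟩ := Nat.find_spec hex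
  have hmin : ∀ U : Submodule ℂ (ι → ℂ), IsInvariant A U → U ≠ ⊥ → U ≤ W → U = W := by
    intro U hU hU0 hUW
    refine Submodule.eq_of_le_of_finrank_le hUW ?_
    rw [hWd]
    exact Nat.find_min' hex ⟨U, hU, hU0, rfl⟩
  let b := Module.finBasis ℂ W
  let e : W ≃ₗ[ℂ] (Fin (Module.finrank ℂ W) → ℂ) := b.equivFun
  let g : (Fin (Module.finrank ℂ W) → ℂ) →ₗ[ℂ] (ι → ℂ) := W.subtype ∘ₗ e.symm.toLinearMap
  have hg : Function.Injective g := W.injective_subtype.comp e.symm.injective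
  let T : Fin (p + 1) → W →ₗ[ℂ] W := fun j => (A j).mulVecLin.restrict (hW j)
  let S : Fin (p + 1) → Matrix (Fin (Module.finrank ℂ W)) (Fin (Module.finrank ℂ W)) ℂ := fun j =>
    LinearMap.toMatrix' (e.toLinearMap ∘ₗ T j ∘ₗ e.symm.toLinearMap)
  have hX : ∀ v, (LinearMap.toMatrix' g).mulVec v = g v := fun v => by
    rw [← Matrix.toLin'_apply, Matrix.toLin'_toMatrix']
  have hS : ∀ j v, (S j).mulVec v = e (T j (e.symm v)) := fun j v => by
    rw [← Matrix.toLin'_apply, Matrix.toLin'_toMatrix']; rfl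
  have hgS : ∀ j v, g ((S j).mulVec v) = (A j).mulVec (g v) := fun j v => by
    rw [hS]
    simp only [g, LinearMap.comp_apply, LinearEquiv.coe_coe, LinearEquiv.symm_apply_apply]
    rfl
  refine ⟨_, S, LinearMap.toMatrix' g, ⟨?_, fun U hU => ?_⟩, fun j => ?_, ?_⟩
  · rw [← Fin.pos_iff_nonempty]
    exact Nat.pos_of_ne_zero fun h => hW0 (Submodule.finrank_eq_zero.1 h)
  · by_cases h : U.map g = ⊥
    · left
      rw [← Submodule.map_bot g] at h
      exact Submodule.map_injective_of_injective hg h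
    · right
      have hle : U.map g ≤ W := by
        rintro _ ⟨v, -, rfl⟩
        exact (e.symm v).2
      have := hmin (U.map g) (by
        rintro j _ ⟨v, hv, rfl⟩
        exact ⟨_, hU j v hv, hgS j v⟩) h hle
      have h2 : U.map g = (⊤ : Submodule ℂ _).map g := by
        rw [this]
        apply le_antisymm
        · intro w hw
          exact ⟨e ⟨w, hw⟩, trivial, by simp [g]⟩
        · rintro _ ⟨v, -, rfl⟩
          exact (e.symm v).2
      exact Submodule.map_injective_of_injective hg h2
  · apply Matrix.toLin'.injective
    apply LinearMap.ext
    intro v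
    rw [Matrix.toLin'_apply, Matrix.toLin'_apply, ← mulVec_mulVec, ← mulVec_mulVec, hX, hX, hgS]
  · intro v w h
    rw [hX, hX] at h
    exact hg h

lemma IsEquivTuple.isSubquotient {A : Fin (p + 1) → Matrix ι ι ℂ}
    {A' : Fin (p + 1) → Matrix κ κ ℂ} {B : Fin (p + 1) → Matrix μ μ ℂ}
    (h : IsEquivTuple A A') (hB : IsSubquotient B A) : IsSubquotient B A' := by
  obtain ⟨X, Y, h₁, h₂, hX⟩ := h
  have hY := inverse_mem_homSpace h₁ h₂ hX
  obtain ⟨W, hW, f, hf, hfB⟩ := hB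
  have key : ∀ j w, Y.mulVec ((A' j).mulVec w) = (A j).mulVec (Y.mulVec w) := fun j w => by
    rw [mulVec_mulVec, mulVec_mulVec, hY j]
  let f' : W.comap Y.mulVecLin →ₗ[ℂ] (μ → ℂ) := f ∘ₗ
    Y.mulVecLin.restrict (p := W.comap Y.mulVecLin) (q := W) (fun _ hw => hw)
  refine ⟨W.comap Y.mulVecLin, fun j w hw => ?_, f', ?_, ?_⟩
  · rw [Submodule.mem_comap, mulVecLin_apply] at hw ⊢
    rw [key]
    exact hW j _ hw
  · intro v
    obtain ⟨w, rfl⟩ := hf v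
    have hw : Y.mulVec (X.mulVec w.1) = w.1 := by rw [mulVec_mulVec, h₂, one_mulVec]
    refine ⟨⟨X.mulVec w.1, ?_⟩, ?_⟩
    · rw [Submodule.mem_comap, mulVecLin_apply, hw]
      exact w.2
    · change f ⟨Y.mulVec (X.mulVec w.1), _⟩ = f w
      congr 1
      exact Subtype.ext hw
  · intro j w
    have := hfB j ⟨Y.mulVec w.1, w.2⟩
    change f ⟨Y.mulVec ((A' j).mulVec w.1), _⟩ = (B j).mulVec (f ⟨Y.mulVec w.1, _⟩)
    rw [← this]
    congr 1
    exact Subtype.ext (key j w.1)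

/-- An irreducible subquotient of an extension is one of the sub or of the quotient. -/
lemma IsSubquotient.of_blk {K : Fin (p + 1) → Matrix ι ι ℂ} {N : Fin (p + 1) → Matrix ι κ ℂ}
    {Q : Fin (p + 1) → Matrix κ κ ℂ} {B : Fin (p + 1) → Matrix μ μ ℂ}
    (hB : IsSubquotient B (blk K N Q)) (hirr : IsIrreducibleTuple B) :
    IsSubquotient B K ∨ IsSubquotient B Q := by
  obtain ⟨W, hW, f, hf, hfB⟩ := hB
  have hblk : ∀ j (u : ι → ℂ) (v : κ → ℂ), (blk K N Q j).mulVec (Sum.elim u v) =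
      Sum.elim ((K j).mulVec u + (N j).mulVec v) ((Q j).mulVec v) := fun j u v => by
    rw [blk, fromBlocks_mulVec]; simp
  let i₁ : (ι → ℂ) →ₗ[ℂ] (ι ⊕ κ → ℂ) :=
    (LinearEquiv.sumArrowLequivProdArrow ι κ ℂ ℂ).symm.toLinearMap ∘ₗ LinearMap.inl ℂ _ _
  have hi₁ : ∀ u, i₁ u = Sum.elim u 0 := fun u => rfl
  have hi₁K : ∀ j u, (blk K N Q j).mulVec (i₁ u) = i₁ ((K j).mulVec u) := fun j u => by
    rw [hi₁, hblk, hi₁]; simp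
  let W₁ := W.comap i₁
  have hW₁ : IsInvariant K W₁ := fun j u hu => by
    rw [Submodule.mem_comap] at hu ⊢
    rw [← hi₁K]
    exact hW j _ hu
  let f₁ : W₁ →ₗ[ℂ] (μ → ℂ) := f ∘ₗ i₁.restrict (p := W₁) (q := W) (fun _ hw => hw)
  have hf₁ : ∀ j (u : W₁), f₁ ⟨(K j).mulVec u, hW₁ j u u.2⟩ = (B j).mulVec (f₁ u) := by
    intro j u
    have := hfB j ⟨i₁ u, u.2⟩
    change f ⟨i₁ ((K j).mulVec u.1), _⟩ = (B j).mulVec (f ⟨i₁ u.1, _⟩)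
    rw [← this]
    congr 1
    exact Subtype.ext (hi₁K j u.1).symm
  have hinv : IsInvariant B (LinearMap.range f₁) := by
    rintro j _ ⟨u, rfl⟩
    exact ⟨_, hf₁ j u⟩
  -- The image under `f` of the part of `W` inside `K` is invariant, hence zero or everything. If it
  -- is zero, `f` factors through the projection `pr` to the coordinates of `Q`.
  rcases hirr.2 _ hinv with h | h
  · right
    let pr : W →ₗ[ℂ] (κ → ℂ) := LinearMap.funLeft ℂ ℂ Sum.inr ∘ₗ W.subtype
    have hpr : ∀ w : W, pr w = w.1 ∘ Sum.inr := fun w => rfl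
    have hker : ∀ w : W, pr w = 0 → f w = 0 := by
      intro w hw
      have h1 : i₁ (w.1 ∘ Sum.inl) = w.1 := by
        rw [hi₁]
        ext (x | x)
        · rfl
        · exact (congrFun hw x).symm
      have h2 : f₁ ⟨w.1 ∘ Sum.inl, by rw [Submodule.mem_comap, h1]; exact w.2⟩ = f w := by
        change f ⟨i₁ (w.1 ∘ Sum.inl), _⟩ = _
        congr 1
        exact Subtype.ext h1
      rw [← h2, LinearMap.range_eq_bot.1 h, LinearMap.zero_apply]
    have hker' : ∀ w w' : W, pr w = pr w' → f w = f w' := fun w w' hw => by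
      rw [← sub_eq_zero, ← map_sub]
      apply hker
      rw [map_sub, hw, sub_self]
    -- The linear section `σ` need not be equivariant; `f ∘ σ` is, because `f` kills the kernel of
    -- `pr`.
    obtain ⟨σ, hσ⟩ := pr.rangeRestrict.exists_rightInverse_of_surjective pr.range_rangeRestrict
    have hσ' : ∀ v : LinearMap.range pr, pr (σ v) = v := fun v =>
      congrArg Subtype.val (LinearMap.congr_fun hσ v)
    have hprQ : ∀ j (w : W), pr ⟨(blk K N Q j).mulVec w, hW j w w.2⟩ = (Q j).mulVec (pr w) := by
      intro j w
      rw [hpr, hpr]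
      change (blk K N Q j).mulVec w.1 ∘ Sum.inr = _
      rw [← Sum.elim_comp_inl_inr w.1, hblk]
      simp
    have hR : IsInvariant Q (LinearMap.range pr) := by
      rintro j _ ⟨w, rfl⟩
      exact ⟨_, hprQ j w⟩
    refine ⟨LinearMap.range pr, hR, f ∘ₗ σ, fun v => ?_, fun j v => ?_⟩
    · obtain ⟨w, rfl⟩ := hf v
      exact ⟨⟨pr w, w, rfl⟩, hker' _ _ (hσ' _)⟩
    · rw [LinearMap.comp_apply, LinearMap.comp_apply, ← hfB]
      apply hker'
      rw [hσ', hprQ, hσ']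
  · exact Or.inl ⟨W₁, hW₁, f₁, LinearMap.range_eq_top.1 h, hf₁⟩

lemma isEquivTuple_of_isSubquotient {S : Fin (p + 1) → Matrix ι ι ℂ}
    {B : Fin (p + 1) → Matrix κ κ ℂ} (hS : IsIrreducibleTuple S) (hB : IsIrreducibleTuple B)
    (h : IsSubquotient B S) : IsEquivTuple S B := by
  obtain ⟨W, hW, f, hf, hfB⟩ := h
  have := hB.1
  rcases hS.2 W hW with rfl | rfl
  · exfalso
    obtain ⟨w, hw⟩ := hf (fun _ => 1)
    rw [Subsingleton.elim w 0, map_zero] at hw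
    simpa using congrFun hw (Classical.arbitrary κ)
  · let g : (ι → ℂ) →ₗ[ℂ] (κ → ℂ) := f ∘ₗ Submodule.topEquiv.symm.toLinearMap
    have hX : ∀ v, (LinearMap.toMatrix' g).mulVec v = g v := fun v => by
      rw [← Matrix.toLin'_apply, Matrix.toLin'_toMatrix']
    have hg : Function.Surjective g := hf.comp (Submodule.topEquiv.symm.surjective)
    have hmem : LinearMap.toMatrix' g ∈ homSpace S B := fun j => by
      apply Matrix.toLin'.injective
      apply LinearMap.ext
      intro v
      rw [Matrix.toLin'_apply, Matrix.toLin'_apply, ← mulVec_mulVec, ← mulVec_mulVec, hX, hX]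
      exact (hfB j ⟨v, trivial⟩).symm
    refine isEquivTuple_of_bijective hmem ⟨mulVec_injective_of_irreducible hS hmem ?_, ?_⟩
    · intro h0
      obtain ⟨w, hw⟩ := hg (fun _ => 1)
      rw [← hX, h0, zero_mulVec] at hw
      simpa using congrFun hw (Classical.arbitrary κ)
    · intro v
      obtain ⟨w, rfl⟩ := hg v
      exact ⟨w, hX w⟩

end Intertwiners
end DeligneSimpson

namespace DeligneSimpson

open Matrix
set_option linter.unusedSectionVars false

/-! ### The Euler form: invariance and subadditivity -/

section EulerForm

variable {p : ℕ} {ι κ μ : Type} [Fintype ι] [DecidableEq ι] [Fintype κ] [DecidableEq κ]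
  [Fintype μ] [DecidableEq μ]

/-- The map `X ↦ b X - X a`. -/
def adMap (a : Matrix ι ι ℂ) (b : Matrix κ κ ℂ) : Matrix κ ι ℂ →ₗ[ℂ] Matrix κ ι ℂ where
  toFun X := b * X - X * a
  map_add' X Y := by rw [Matrix.mul_add, Matrix.add_mul]; abel
  map_smul' c X := by simp [smul_sub]

lemma adMap_apply (a : Matrix ι ι ℂ) (b : Matrix κ κ ℂ) (X : Matrix κ ι ℂ) :
    adMap a b X = b * X - X * a := rfl

lemma mem_ker_adMap {a : Matrix ι ι ℂ} {b : Matrix κ κ ℂ} {X : Matrix κ ι ℂ} :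
    X ∈ LinearMap.ker (adMap a b) ↔ b * X = X * a := by
  rw [LinearMap.mem_ker, adMap_apply, sub_eq_zero]

lemma mem_homSpace_iff_adMap {A : Fin (p + 1) → Matrix ι ι ℂ} {B : Fin (p + 1) → Matrix κ κ ℂ}
    {X : Matrix κ ι ℂ} : X ∈ homSpace A B ↔ ∀ j, adMap (A j) (B j) X = 0 := by
  simp only [mem_homSpace, adMap_apply, sub_eq_zero]

/-- The Euler form `2 n m - ∑ rank (X ↦ B_j X - X A_j)` of two tuples. -/
noncomputable def chi (A : Fin (p + 1) → Matrix ι ι ℂ) (B : Fin (p + 1) → Matrix κ κ ℂ) : ℤ :=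
  2 * (Fintype.card ι * Fintype.card κ) - ∑ j, (Fintype.card ι * Fintype.card κ -
    (Module.finrank ℂ (LinearMap.ker (adMap (A j) (B j))) : ℤ))

lemma chi_eq_sub_rank (A : Fin (p + 1) → Matrix ι ι ℂ) (B : Fin (p + 1) → Matrix κ κ ℂ) :
    chi A B = 2 * (Fintype.card ι * Fintype.card κ) -
      ∑ j, (Module.finrank ℂ (LinearMap.range (adMap (A j) (B j))) : ℤ) := by
  unfold chi
  congr 1
  refine Finset.sum_congr rfl fun j _ => ?_
  have := LinearMap.finrank_range_add_finrank_ker (adMap (A j) (B j))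
  rw [Module.finrank_matrix, Module.finrank_self, mul_one] at this
  have h : (Module.finrank ℂ (LinearMap.range (adMap (A j) (B j))) : ℤ) +
    Module.finrank ℂ (LinearMap.ker (adMap (A j) (B j))) = Fintype.card κ * Fintype.card ι := by
    exact_mod_cast this
  linarith [mul_comm (Fintype.card κ : ℤ) (Fintype.card ι)]

lemma finrank_ker_adMap_le_left {a : Matrix ι ι ℂ} {a' : Matrix κ κ ℂ} (b : Matrix μ μ ℂ)
    {X : Matrix κ ι ℂ} {Y : Matrix ι κ ℂ} (h₂ : Y * X = 1) (hY : a * Y = Y * a') :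
    Module.finrank ℂ (LinearMap.ker (adMap a b)) ≤
      Module.finrank ℂ (LinearMap.ker (adMap a' b)) := by
  let f : LinearMap.ker (adMap a b) →ₗ[ℂ] LinearMap.ker (adMap a' b) :=
    (mulRightLinearMap μ ℂ Y).restrict fun Z hZ => by
      rw [mem_ker_adMap] at hZ ⊢
      rw [mulRightLinearMap_apply, ← Matrix.mul_assoc, hZ, Matrix.mul_assoc, hY, Matrix.mul_assoc]
  refine LinearMap.finrank_le_finrank_of_injective (f := f) fun Z Z' h => Subtype.ext ?_
  have h' : Z.1 * Y = Z'.1 * Y := congrArg Subtype.val h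
  have := congrArg (· * X) h'
  simpa [Matrix.mul_assoc, h₂] using this

lemma finrank_ker_adMap_le_right {a : Matrix ι ι ℂ} {a' : Matrix κ κ ℂ} (b : Matrix μ μ ℂ)
    {X : Matrix κ ι ℂ} {Y : Matrix ι κ ℂ} (h₂ : Y * X = 1) (hX : a' * X = X * a) :
    Module.finrank ℂ (LinearMap.ker (adMap b a)) ≤
      Module.finrank ℂ (LinearMap.ker (adMap b a')) := by
  let f : LinearMap.ker (adMap b a) →ₗ[ℂ] LinearMap.ker (adMap b a') :=
    (mulLeftLinearMap μ ℂ X).restrict fun Z hZ => by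
      rw [mem_ker_adMap] at hZ ⊢
      rw [mulLeftLinearMap_apply, ← Matrix.mul_assoc, hX, Matrix.mul_assoc, hZ, Matrix.mul_assoc]
  refine LinearMap.finrank_le_finrank_of_injective (f := f) fun Z Z' h => Subtype.ext ?_
  have h' : X * Z.1 = X * Z'.1 := congrArg Subtype.val h
  have := congrArg (Y * ·) h'
  simpa [← Matrix.mul_assoc, h₂] using this

lemma chi_congr_left {A : Fin (p + 1) → Matrix ι ι ℂ} {A' : Fin (p + 1) → Matrix κ κ ℂ}
    (B : Fin (p + 1) → Matrix μ μ ℂ) (h : IsEquivTuple A A') : chi A B = chi A' B := by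
  have hc := h.card_eq
  obtain ⟨X, Y, h₁, h₂, hX⟩ := h
  have hY := inverse_mem_homSpace h₁ h₂ hX
  have : ∀ j, Module.finrank ℂ (LinearMap.ker (adMap (A j) (B j))) =
      Module.finrank ℂ (LinearMap.ker (adMap (A' j) (B j))) := fun j =>
    le_antisymm (finrank_ker_adMap_le_left _ h₂ (hY j)) (finrank_ker_adMap_le_left _ h₁ (hX j))
  simp only [chi, hc, this]

lemma chi_congr_right {A : Fin (p + 1) → Matrix ι ι ℂ} {A' : Fin (p + 1) → Matrix κ κ ℂ}
    (B : Fin (p + 1) → Matrix μ μ ℂ) (h : IsEquivTuple A A') : chi B A = chi B A' := by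
  have hc := h.card_eq
  obtain ⟨X, Y, h₁, h₂, hX⟩ := h
  have hY := inverse_mem_homSpace h₁ h₂ hX
  have : ∀ j, Module.finrank ℂ (LinearMap.ker (adMap (B j) (A j))) =
      Module.finrank ℂ (LinearMap.ker (adMap (B j) (A' j))) := fun j =>
    le_antisymm (finrank_ker_adMap_le_right _ h₂ (hX j)) (finrank_ker_adMap_le_right _ h₁ (hY j))
  simp only [chi, hc, this]

lemma chi_self_congr {A : Fin (p + 1) → Matrix ι ι ℂ} {A' : Fin (p + 1) → Matrix κ κ ℂ}
    (h : IsEquivTuple A A') : chi A A = chi A' A' :=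
  (chi_congr_left A h).trans (chi_congr_right A' h)

/-- The dimension count for a left exact sequence `U₂ → U → U₁`; it turns left exactness of Hom into
subadditivity of `chi`. -/
lemma finrank_le_map_add_comap {V V₁ V₂ : Type*} [AddCommGroup V] [Module ℂ V]
    [AddCommGroup V₁] [Module ℂ V₁] [AddCommGroup V₂] [Module ℂ V₂] [FiniteDimensional ℂ V]
    [FiniteDimensional ℂ V₁] [FiniteDimensional ℂ V₂] (U : Submodule ℂ V) (U₁ : Submodule ℂ V₁)
    (U₂ : Submodule ℂ V₂) (f : V →ₗ[ℂ] V₁) (g : V₂ →ₗ[ℂ] V) (hf : ∀ x ∈ U, f x ∈ U₁)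
    (hg : ∀ x ∈ U, f x = 0 → ∃ y ∈ U₂, g y = x) :
    Module.finrank ℂ U ≤ Module.finrank ℂ U₁ + Module.finrank ℂ U₂ := by
  let F : U →ₗ[ℂ] U₁ := f.restrict hf
  rw [← LinearMap.finrank_range_add_finrank_ker F]
  refine add_le_add (Submodule.finrank_le _) ?_
  calc Module.finrank ℂ (LinearMap.ker F)
      = Module.finrank ℂ ((LinearMap.ker F).map U.subtype) :=
        (Submodule.equivMapOfInjective U.subtype U.injective_subtype _).finrank_eq
    _ ≤ Module.finrank ℂ (U₂.map g) := Submodule.finrank_mono (by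
        rintro _ ⟨x, hx, rfl⟩
        have hx' : F x = 0 := hx
        obtain ⟨y, hy, hyx⟩ := hg x x.2 (congrArg Subtype.val hx')
        exact ⟨y, hy, hyx⟩)
    _ ≤ Module.finrank ℂ U₂ := Submodule.finrank_map_le g U₂

/-- The products of sizes are additive, and the kernel dimensions enter `chi` with a positive sign.
Left exactness of Hom bounds the kernel for an extension by the sum of those for its ends. -/
lemma chi_blk_left_le (K : Fin (p + 1) → Matrix ι ι ℂ) (N : Fin (p + 1) → Matrix ι κ ℂ)
    (Q : Fin (p + 1) → Matrix κ κ ℂ) (M : Fin (p + 1) → Matrix μ μ ℂ) :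
    chi (blk K N Q) M ≤ chi K M + chi Q M := by
  have h : ∀ j, Module.finrank ℂ (LinearMap.ker (adMap (blk K N Q j) (M j))) ≤
      Module.finrank ℂ (LinearMap.ker (adMap (K j) (M j))) +
      Module.finrank ℂ (LinearMap.ker (adMap (Q j) (M j))) := fun j => by
    let f : Matrix μ (ι ⊕ κ) ℂ →ₗ[ℂ] Matrix μ ι ℂ :=
      ⟨⟨Matrix.toCols₁, fun _ _ => rfl⟩, fun _ _ => rfl⟩
    let g : Matrix μ κ ℂ →ₗ[ℂ] Matrix μ (ι ⊕ κ) ℂ :=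
      ⟨⟨fun Z => fromCols 0 Z, fun _ _ => by ext _ (_ | _) <;> simp⟩,
        fun _ _ => by ext _ (_ | _) <;> simp⟩
    refine finrank_le_map_add_comap _ _ _ f g (fun X hX => ?_) (fun X hX hX0 => ⟨X.toCols₂, ?_, ?_⟩)
    · rw [mem_ker_adMap] at hX ⊢
      -- A single matrix is a tuple of length one.
      exact toCols₁_mem_homSpace (p := 0) (K := fun _ => K j) (N := fun _ => N j)
        (Q := fun _ => Q j) (M := fun _ => M j) (fun _ => hX) 0
    · rw [mem_ker_adMap] at hX ⊢
      exact toCols₂_mem_homSpace (p := 0) (K := fun _ => K j) (N := fun _ => N j)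
        (Q := fun _ => Q j) (M := fun _ => M j) (fun _ => hX) hX0 0
    · conv_rhs => rw [← fromCols_toCols X]
      rw [show X.toCols₁ = 0 from hX0]; rfl
  have h' := Finset.sum_le_sum fun j (_ : j ∈ Finset.univ) => (Nat.cast_le (α := ℤ)).2 (h j)
  simp only [chi, Fintype.card_sum, Finset.sum_sub_distrib, Finset.sum_const, Finset.card_univ,
    Fintype.card_fin, nsmul_eq_mul] at h' ⊢
  push_cast at h' ⊢
  rw [Finset.sum_add_distrib] at h'
  nlinarith [h']

lemma chi_blk_right_le (K : Fin (p + 1) → Matrix ι ι ℂ) (N : Fin (p + 1) → Matrix ι κ ℂ)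
    (Q : Fin (p + 1) → Matrix κ κ ℂ) (M : Fin (p + 1) → Matrix μ μ ℂ) :
    chi M (blk K N Q) ≤ chi M K + chi M Q := by
  have h : ∀ j, Module.finrank ℂ (LinearMap.ker (adMap (M j) (blk K N Q j))) ≤
      Module.finrank ℂ (LinearMap.ker (adMap (M j) (Q j))) +
      Module.finrank ℂ (LinearMap.ker (adMap (M j) (K j))) := fun j => by
    let f : Matrix (ι ⊕ κ) μ ℂ →ₗ[ℂ] Matrix κ μ ℂ :=
      ⟨⟨Matrix.toRows₂, fun _ _ => rfl⟩, fun _ _ => rfl⟩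
    let g : Matrix ι μ ℂ →ₗ[ℂ] Matrix (ι ⊕ κ) μ ℂ :=
      ⟨⟨fun Z => fromRows Z 0, fun _ _ => by ext (_ | _) _ <;> simp⟩,
        fun _ _ => by ext (_ | _) _ <;> simp⟩
    have key : ∀ X ∈ LinearMap.ker (adMap (M j) (blk K N Q j)),
        K j * X.toRows₁ + N j * X.toRows₂ = X.toRows₁ * M j ∧ Q j * X.toRows₂ = X.toRows₂ * M j := by
      intro X hX
      rw [mem_ker_adMap] at hX
      rw [← fromRows_toRows X, blk, fromBlocks_mul_fromRows, fromRows_mul] at hX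
      simpa [fromRows_ext_iff] using hX
    refine finrank_le_map_add_comap _ _ _ f g (fun X hX => ?_) (fun X hX hX0 => ⟨X.toRows₁, ?_, ?_⟩)
    · rw [mem_ker_adMap]
      exact (key X hX).2
    · have := (key X hX).1
      rw [show X.toRows₂ = 0 from hX0, Matrix.mul_zero, add_zero] at this
      rw [mem_ker_adMap]
      exact this
    · conv_rhs => rw [← fromRows_toRows X]
      rw [show X.toRows₂ = 0 from hX0]; rfl
  have h' := Finset.sum_le_sum fun j (_ : j ∈ Finset.univ) => (Nat.cast_le (α := ℤ)).2 (h j)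
  simp only [chi, Fintype.card_sum, Finset.sum_sub_distrib, Finset.sum_const, Finset.card_univ,
    Fintype.card_fin, nsmul_eq_mul] at h' ⊢
  push_cast at h' ⊢
  rw [Finset.sum_add_distrib] at h'
  nlinarith [h']

lemma chi_of_isEmpty_left [IsEmpty ι] (A : Fin (p + 1) → Matrix ι ι ℂ)
    (B : Fin (p + 1) → Matrix κ κ ℂ) : chi A B = 0 := by
  have : ∀ U : Submodule ℂ (Matrix κ ι ℂ), Module.finrank ℂ U = 0 := fun U =>
    Module.finrank_zero_of_subsingleton
  simp [chi, this]

lemma chi_of_isEmpty_right [IsEmpty κ] (A : Fin (p + 1) → Matrix ι ι ℂ)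
    (B : Fin (p + 1) → Matrix κ κ ℂ) : chi A B = 0 := by
  have : ∀ U : Submodule ℂ (Matrix κ ι ℂ), Module.finrank ℂ U = 0 := fun U =>
    Module.finrank_zero_of_subsingleton
  simp [chi, this]

end EulerForm

/-! ### Iterated self-extensions and the induction over constituents -/

section IteratedExtensions

variable {p : ℕ} {ι κ μ ν : Type} [Fintype ι] [DecidableEq ι] [Fintype κ] [DecidableEq κ]
  [Fintype μ] [DecidableEq μ] [Fintype ν] [DecidableEq ν]

lemma blk_congr_right (K : Fin (p + 1) → Matrix ι ι ℂ) (N : Fin (p + 1) → Matrix ι κ ℂ)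
    {Q : Fin (p + 1) → Matrix κ κ ℂ} {Q' : Fin (p + 1) → Matrix μ μ ℂ} (h : IsEquivTuple Q Q') :
    ∃ N', IsEquivTuple (blk K N Q) (blk K N' Q') := by
  obtain ⟨X, Y, h₁, h₂, hX⟩ := h
  refine ⟨fun j => N j * Y, fromBlocks 1 0 0 X, fromBlocks 1 0 0 Y, ?_, ?_, fun j => ?_⟩
  · simp [fromBlocks_multiply, h₁]
  · simp [fromBlocks_multiply, h₂]
  · simp [blk, fromBlocks_multiply, Matrix.mul_assoc, h₂, hX j]

lemma blk_congr_left {K : Fin (p + 1) → Matrix ι ι ℂ} {K' : Fin (p + 1) → Matrix μ μ ℂ}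
    (N : Fin (p + 1) → Matrix ι κ ℂ) (Q : Fin (p + 1) → Matrix κ κ ℂ) (h : IsEquivTuple K K') :
    ∃ N', IsEquivTuple (blk K N Q) (blk K' N' Q) := by
  obtain ⟨X, Y, h₁, h₂, hX⟩ := h
  refine ⟨fun j => X * N j, fromBlocks X 0 0 1, fromBlocks Y 0 0 1, ?_, ?_, fun j => ?_⟩
  · simp [fromBlocks_multiply, h₁]
  · simp [fromBlocks_multiply, h₂]
  · simp [blk, fromBlocks_multiply, hX j]

/-- Rebracketing a three-step filtration lets the sub `K` absorb a copy of `S` found at the bottom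
of the quotient. -/
lemma blk_assoc (K : Fin (p + 1) → Matrix ι ι ℂ) (N : Fin (p + 1) → Matrix ι (κ ⊕ μ) ℂ)
    (S : Fin (p + 1) → Matrix κ κ ℂ) (N' : Fin (p + 1) → Matrix κ μ ℂ)
    (Q : Fin (p + 1) → Matrix μ μ ℂ) :
    ∃ M N'', IsEquivTuple (blk K N (blk S N' Q)) (blk (blk K M S) N'' Q) := by
  refine ⟨fun j => (N j).toCols₁, fun j => fromRows (N j).toCols₂ (N' j),
    isEquivTuple_of_equiv (Equiv.sumAssoc ι κ μ) ?_⟩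
  rintro j ((a | a) | a) ((c | c) | c) <;> rfl

lemma blk_isEmpty [IsEmpty ι] (K : Fin (p + 1) → Matrix ι ι ℂ) (A : Fin (p + 1) → Matrix κ κ ℂ) :
    IsEquivTuple A (blk K (fun _ => 0) A) := by
  refine isEquivTuple_of_equiv (Equiv.emptySum ι κ) ?_
  rintro j (a | a) (c | c)
  · exact isEmptyElim a
  · exact isEmptyElim a
  · exact isEmptyElim c
  · rfl

lemma exists_fin_isEquivTuple (A : Fin (p + 1) → Matrix ι ι ℂ) :
    ∃ A' : Fin (p + 1) → Matrix (Fin (Fintype.card ι)) (Fin (Fintype.card ι)) ℂ,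
      IsEquivTuple A A' :=
  ⟨fun j => (A j).submatrix (Fintype.equivFin ι).symm (Fintype.equivFin ι).symm,
    isEquivTuple_of_equiv (Fintype.equivFin ι).symm fun _ _ _ => rfl⟩

/-- The iterated extensions of a tuple `S` by itself. -/
inductive IsIteratedExt (S : Fin (p + 1) → Matrix ι ι ℂ) :
    ∀ k : ℕ, (Fin (p + 1) → Matrix (Fin k) (Fin k) ℂ) → Prop
  | zero (K : Fin (p + 1) → Matrix (Fin 0) (Fin 0) ℂ) : IsIteratedExt S 0 K
  | step {k l : ℕ} (K : Fin (p + 1) → Matrix (Fin k) (Fin k) ℂ)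
      (N : Fin (p + 1) → Matrix (Fin k) ι ℂ) (L : Fin (p + 1) → Matrix (Fin l) (Fin l) ℂ)
      (hK : IsIteratedExt S k K) (h : IsEquivTuple L (blk K N S)) : IsIteratedExt S l L

variable {S : Fin (p + 1) → Matrix ι ι ℂ}

lemma IsIteratedExt.homSpace_eq_bot {k : ℕ} {K : Fin (p + 1) → Matrix (Fin k) (Fin k) ℂ}
    (hK : IsIteratedExt S k K) {Q : Fin (p + 1) → Matrix κ κ ℂ} (hQ : homSpace S Q = ⊥) :
    homSpace K Q = ⊥ := by
  induction hK with
  | zero K => exact Subsingleton.elim _ _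
  | step K N L hK h ih =>
    rw [eq_bot_iff]
    intro Z hZ
    obtain ⟨X, Y, h₁, h₂, hX⟩ := h
    have hY := inverse_mem_homSpace h₁ h₂ hX
    have hZY := homSpace_comp hZ hY
    have h1 : (Z * Y).toCols₁ = 0 := by
      have := toCols₁_mem_homSpace hZY
      rwa [ih, Submodule.mem_bot] at this
    have h2 : (Z * Y).toCols₂ = 0 := by
      have := toCols₂_mem_homSpace hZY h1
      rwa [hQ, Submodule.mem_bot] at this
    have h3 : Z * Y = 0 := by
      rw [← fromCols_toCols (Z * Y), h1, h2, fromCols_zero]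
    rw [Submodule.mem_bot]
    calc Z = Z * (Y * X) := by rw [h₂, Matrix.mul_one]
      _ = 0 := by rw [← Matrix.mul_assoc, h3, Matrix.zero_mul]

/-- By subadditivity, non-positivity on the only constituent `S` spreads to `K`. Combined with the
version in the second variable, `chi S S ≤ 0` gives `chi K K ≤ 0`. -/
lemma IsIteratedExt.chi_left_nonpos {k : ℕ} {K : Fin (p + 1) → Matrix (Fin k) (Fin k) ℂ}
    (hK : IsIteratedExt S k K) {M : Fin (p + 1) → Matrix κ κ ℂ} (hM : chi S M ≤ 0) :
    chi K M ≤ 0 := by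
  induction hK with
  | zero K => exact (chi_of_isEmpty_left K M).le
  | step K N L hK h ih =>
    rw [chi_congr_left M h]
    linarith [chi_blk_left_le K N S M]

lemma IsIteratedExt.chi_right_nonpos {k : ℕ} {K : Fin (p + 1) → Matrix (Fin k) (Fin k) ℂ}
    (hK : IsIteratedExt S k K) {M : Fin (p + 1) → Matrix κ κ ℂ} (hM : chi M S ≤ 0) :
    chi M K ≤ 0 := by
  induction hK with
  | zero K => exact (chi_of_isEmpty_right M K).le
  | step K N L hK h ih =>
    rw [chi_congr_right M h]
    linarith [chi_blk_right_le K N S M]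

lemma IsSubquotient.nonempty {A : Fin (p + 1) → Matrix ι ι ℂ} {B : Fin (p + 1) → Matrix κ κ ℂ}
    (h : IsSubquotient B A) [Nonempty κ] : Nonempty ι := by
  by_contra hι
  rw [not_nonempty_iff] at hι
  obtain ⟨W, -, f, hf, -⟩ := h
  obtain ⟨w, hw⟩ := hf (fun _ => 1)
  rw [Subsingleton.elim w 0, map_zero] at hw
  simpa using congrFun hw (Classical.arbitrary κ)

lemma IsIteratedExt.isEquivTuple_of_isSubquotient {k : ℕ}
    {K : Fin (p + 1) → Matrix (Fin k) (Fin k) ℂ} (hK : IsIteratedExt S k K)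
    (hS : IsIrreducibleTuple S) {B : Fin (p + 1) → Matrix κ κ ℂ} (hB : IsIrreducibleTuple B)
    (h : IsSubquotient B K) : IsEquivTuple S B := by
  induction hK with
  | zero K =>
    have := hB.1
    exact isEmptyElim (Classical.choice h.nonempty)
  | step K N L hK hL ih =>
    rcases (hL.isSubquotient h).of_blk hB with h | h
    · exact ih h
    · exact DeligneSimpson.isEquivTuple_of_isSubquotient hS hB h

/-- A property of tuples that passes to the two ends of an extension without homomorphisms from
the sub to the quotient, and which forces the Euler form to be positive, forces the Euler form of
all irreducible subquotients to be positive. -/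
theorem chi_pos_of_isSubquotient (P : ∀ n : ℕ, (Fin (p + 1) → Matrix (Fin n) (Fin n) ℂ) → Prop)
    (hP : ∀ (n k m : ℕ) (A : Fin (p + 1) → Matrix (Fin n) (Fin n) ℂ)
      (K : Fin (p + 1) → Matrix (Fin k) (Fin k) ℂ) (N : Fin (p + 1) → Matrix (Fin k) (Fin m) ℂ)
      (Q : Fin (p + 1) → Matrix (Fin m) (Fin m) ℂ), P n A → IsEquivTuple A (blk K N Q) →
      homSpace K Q = ⊥ → P k K ∧ P m Q)
    (hpos : ∀ (n : ℕ) (A : Fin (p + 1) → Matrix (Fin n) (Fin n) ℂ), 0 < n → P n A → 0 < chi A A)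
    (n : ℕ) (A : Fin (p + 1) → Matrix (Fin n) (Fin n) ℂ) (hA : P n A)
    (B : Fin (p + 1) → Matrix κ κ ℂ) (hB : IsIrreducibleTuple B) (hBA : IsSubquotient B A) :
    0 < chi B B := by
  classical
  induction n using Nat.strong_induction_on with
  | _ n ih =>
    have := hB.1
    have := hBA.nonempty
    obtain ⟨s, S, X, hS, hX, hinj⟩ := exists_irreducible_sub A
    have hs : 0 < s := Fin.pos_iff_nonempty.2 hS.1
    -- The possible sizes of iterated self-extensions of `S` inside `A`; the largest one is used
    -- below.
    let D : ℕ → Prop := fun k => ∃ (K : Fin (p + 1) → Matrix (Fin k) (Fin k) ℂ) (m : ℕ)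
      (N : Fin (p + 1) → Matrix (Fin k) (Fin m) ℂ) (Q : Fin (p + 1) → Matrix (Fin m) (Fin m) ℂ),
      IsIteratedExt S k K ∧ IsEquivTuple A (blk K N Q)
    have hDs : D s := by
      obtain ⟨m, N, Q, h⟩ := exists_blk_of_injective hX hinj
      exact ⟨S, m, N, Q, .step (fun _ => 0) _ S (.zero _) (blk_isEmpty _ _), h⟩
    have hDle : ∀ k, D k → k ≤ n := by
      rintro k ⟨K, m, N, Q, -, h⟩
      have := h.card_eq
      simp at this
      omega
    let k := Nat.findGreatest D n
    have hsk : s ≤ k := Nat.le_findGreatest (hDle s hDs) hDs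
    obtain ⟨K, m, N, Q, hK, hKQ⟩ : D k := Nat.findGreatest_spec (hDle s hDs) hDs
    have hcard : n = k + m := by simpa using hKQ.card_eq
    -- A non-zero intertwiner from `S` to `Q` would be an embedding, and the preimage of its image a
    -- larger iterated self-extension.
    have hSQ : homSpace S Q = ⊥ := by
      by_contra hne
      obtain ⟨Z, hZ, hZ0⟩ := Submodule.exists_mem_ne_zero_of_ne_bot hne
      obtain ⟨m', N', Q', h⟩ := exists_blk_of_injective hZ
        (mulVec_injective_of_irreducible hS hZ hZ0)
      obtain ⟨N₁, h₁⟩ := blk_congr_right K N h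
      obtain ⟨M, N₂, h₂⟩ := blk_assoc K N₁ S N' Q'
      obtain ⟨L, hL⟩ := exists_fin_isEquivTuple (blk K M S)
      obtain ⟨N₃, h₃⟩ := blk_congr_left N₂ Q' hL
      have hD : D (Fintype.card (Fin k ⊕ Fin s)) :=
        ⟨L, m', N₃, Q', .step K M L hK hL.symm, ((hKQ.trans h₁).trans h₂).trans h₃⟩
      have := Nat.le_findGreatest (hDle _ hD) hD
      simp only [Fintype.card_sum, Fintype.card_fin] at this
      omega
    obtain ⟨hPK, hPQ⟩ := hP _ _ _ A K N Q hA hKQ (hK.homSpace_eq_bot hSQ)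
    rcases (hKQ.isSubquotient hBA).of_blk hB with h | h
    -- All constituents of `K` are copies of `S`, so `B` is one; `chi S S ≤ 0` would contradict the
    -- positivity of `chi K K`.
    · have hSB := hK.isEquivTuple_of_isSubquotient hS hB h
      rw [← chi_self_congr hSB]
      by_contra hle
      have := hpos k K (by omega) hPK
      have := hK.chi_right_nonpos (hK.chi_left_nonpos (not_lt.1 hle))
      omega
    · exact ih m (by omega) Q hPQ h

end IteratedExtensions
end DeligneSimpson

namespace DeligneSimpson

open Matrix
set_option linter.unusedSectionVars false

/-! ### The defining relation and its derivative -/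

section Relation

variable {p : ℕ} {ι κ ι' κ' : Type} [Fintype ι] [DecidableEq ι] [Fintype κ] [DecidableEq κ]
  [Fintype ι'] [DecidableEq ι'] [Fintype κ'] [DecidableEq κ']

/-- The upper right block of the product of the matrices `(B_j, Y_j; 0, A_j)`. -/
def derivProd : ∀ n : ℕ, (Fin n → Matrix ι ι ℂ) → (Fin n → Matrix κ κ ℂ) →
    (Fin n → Matrix κ ι ℂ) → Matrix κ ι ℂ
  | 0, _, _, _ => 0
  | n + 1, A, B, Y => Y 0 * (List.ofFn fun i : Fin n => A i.succ).prod +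
      B 0 * derivProd n (fun i => A i.succ) (fun i => B i.succ) fun i => Y i.succ

lemma derivProd_add (n : ℕ) (A : Fin n → Matrix ι ι ℂ) (B : Fin n → Matrix κ κ ℂ)
    (Y Y' : Fin n → Matrix κ ι ℂ) :
    derivProd n A B (Y + Y') = derivProd n A B Y + derivProd n A B Y' := by
  induction n with
  | zero => simp [derivProd]
  | succ n ih =>
    have := ih (fun i => A i.succ) (fun i => B i.succ) (fun i => Y i.succ) (fun i => Y' i.succ)
    simp only [derivProd, Pi.add_apply, Matrix.add_mul]
    rw [show (fun i : Fin n => Y i.succ + Y' i.succ) =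
      (fun i => Y i.succ) + fun i => Y' i.succ from rfl, this, Matrix.mul_add]
    abel

lemma derivProd_smul (n : ℕ) (A : Fin n → Matrix ι ι ℂ) (B : Fin n → Matrix κ κ ℂ) (c : ℂ)
    (Y : Fin n → Matrix κ ι ℂ) : derivProd n A B (c • Y) = c • derivProd n A B Y := by
  induction n with
  | zero => simp [derivProd]
  | succ n ih =>
    have := ih (fun i => A i.succ) (fun i => B i.succ) (fun i => Y i.succ)
    simp only [derivProd, Pi.smul_apply, Matrix.smul_mul, smul_add]
    rw [show (fun i : Fin n => c • Y i.succ) = c • fun i => Y i.succ from rfl, this,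
      Matrix.mul_smul]

lemma prod_fromBlocks (n : ℕ) (A : Fin n → Matrix ι ι ℂ) (B : Fin n → Matrix κ κ ℂ)
    (Y : Fin n → Matrix κ ι ℂ) :
    (List.ofFn fun j => fromBlocks (B j) (Y j) 0 (A j)).prod =
      fromBlocks (List.ofFn B).prod (derivProd n A B Y) 0 (List.ofFn A).prod := by
  induction n with
  | zero => simp [derivProd]
  | succ n ih =>
    rw [List.ofFn_succ, List.prod_cons, ih, List.ofFn_succ, List.prod_cons, List.ofFn_succ,
      List.prod_cons, fromBlocks_multiply]
    simp [derivProd, add_comm]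

/-- Naturality of the derivative under intertwiners. The second conclusion serves the induction: it
moves `W` past the tail of the product. -/
lemma derivProd_mul (n : ℕ) {A : Fin n → Matrix ι ι ℂ} {B : Fin n → Matrix κ κ ℂ}
    {A' : Fin n → Matrix ι' ι' ℂ} {B' : Fin n → Matrix κ' κ' ℂ} {V : Matrix κ' κ ℂ}
    {W : Matrix ι ι' ℂ} (hV : ∀ j, B' j * V = V * B j) (hW : ∀ j, A j * W = W * A' j)
    (Y : Fin n → Matrix κ ι ℂ) :
    derivProd n A' B' (fun j => V * Y j * W) = V * derivProd n A B Y * W ∧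
      (List.ofFn A).prod * W = W * (List.ofFn A').prod := by
  induction n with
  | zero => simp [derivProd]
  | succ n ih =>
    obtain ⟨h₁, h₂⟩ := ih (fun j => hV j.succ) (fun j => hW j.succ) (fun j => Y j.succ)
    constructor
    · simp only [derivProd, h₁, Matrix.mul_add, Matrix.add_mul]
      congr 1
      · rw [Matrix.mul_assoc, ← h₂]; simp only [Matrix.mul_assoc]
      · rw [← Matrix.mul_assoc, ← Matrix.mul_assoc, hV]; simp only [Matrix.mul_assoc]
    · rw [List.ofFn_succ, List.prod_cons, Matrix.mul_assoc, h₂, ← Matrix.mul_assoc, hW,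
        List.ofFn_succ, List.prod_cons, Matrix.mul_assoc]

/-- The product rule telescopes. -/
lemma derivProd_adMap (n : ℕ) (A : Fin n → Matrix ι ι ℂ) (B : Fin n → Matrix κ κ ℂ)
    (X : Matrix κ ι ℂ) : derivProd n A B (fun j => adMap (A j) (B j) X) =
      (List.ofFn B).prod * X - X * (List.ofFn A).prod := by
  induction n with
  | zero => simp [derivProd]
  | succ n ih =>
    have := ih (fun i => A i.succ) (fun i => B i.succ)
    simp only [derivProd, List.ofFn_succ, List.prod_cons]
    rw [this]
    simp only [adMap_apply, Matrix.sub_mul, Matrix.mul_sub, Matrix.mul_assoc]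
    abel

/-- Varying one `X j` at a time and using that the trace pairing is non-degenerate. The product of
the `A j` appears because the induction strips off the first matrix and the remaining product need
not be 1; for a solution it disappears. -/
lemma mul_eq_mul_of_trace_derivProd (n : ℕ) (A : Fin n → Matrix ι ι ℂ) (B : Fin n → Matrix κ κ ℂ)
    (Z : Matrix ι κ ℂ) (h : ∀ X : Fin n → Matrix κ ι ℂ,
      (Z * derivProd n A B fun j => adMap (A j) (B j) (X j)).trace = 0) :
    ∀ j, A j * ((List.ofFn A).prod * Z) = (List.ofFn A).prod * Z * B j := by
  induction n generalizing Z with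
  | zero => exact fun j => j.elim0
  | succ n ih =>
    have h0 : (List.ofFn fun i : Fin n => A i.succ).prod * Z * B 0 =
        A 0 * (List.ofFn fun i : Fin n => A i.succ).prod * Z := by
      rw [← sub_eq_zero]
      refine Matrix.ext_iff_trace_mul_right.2 fun X => ?_
      have := h (Fin.cons X fun _ => 0)
      simp only [derivProd, Fin.cons_zero, Fin.cons_succ, map_zero] at this
      rw [show (fun _ : Fin n => (0 : Matrix κ ι ℂ)) = (0 : ℂ) • (0 : Fin n → Matrix κ ι ℂ) by
        simp only [smul_zero]; rfl, derivProd_smul, zero_smul, Matrix.mul_zero, add_zero,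
        adMap_apply] at this
      rw [Matrix.zero_mul, Matrix.trace_zero, ← this, Matrix.sub_mul, Matrix.sub_mul,
        Matrix.mul_sub, Matrix.trace_sub, Matrix.trace_sub]
      congr 1
      · simp only [Matrix.mul_assoc]
        rw [Matrix.trace_mul_comm]
        simp only [Matrix.mul_assoc]
      · simp only [Matrix.mul_assoc]
        rw [← Matrix.mul_assoc, Matrix.trace_mul_comm]
        simp only [Matrix.mul_assoc]
    have ht := ih (fun j => A j.succ) (fun j => B j.succ) (Z * B 0) fun X => by
      have := h (Fin.cons 0 X)
      simpa only [derivProd, Fin.cons_zero, Fin.cons_succ, map_zero, Matrix.zero_mul, zero_add,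
        Matrix.mul_assoc] using this
    have hE : (List.ofFn A).prod * Z = (List.ofFn fun i : Fin n => A i.succ).prod * (Z * B 0) := by
      rw [List.ofFn_succ, List.prod_cons, ← Matrix.mul_assoc, h0]
    intro j
    rw [hE]
    refine Fin.cases ?_ (fun i => ht i) j
    rw [← Matrix.mul_assoc (List.prod _) Z, ← Matrix.mul_assoc, ← Matrix.mul_assoc, ← h0]

/-- The derivative of the relation that defines solutions. -/
def relDeriv (v : Version) (A : Fin (p + 1) → Matrix ι ι ℂ) (B : Fin (p + 1) → Matrix κ κ ℂ) :
    (Fin (p + 1) → Matrix κ ι ℂ) →ₗ[ℂ] Matrix κ ι ℂ :=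
  match v with
  | .additive => ∑ j, LinearMap.proj j
  | .multiplicative => ⟨⟨derivProd (p + 1) A B, derivProd_add _ A B⟩, derivProd_smul _ A B⟩

lemma relDeriv_additive (A : Fin (p + 1) → Matrix ι ι ℂ) (B : Fin (p + 1) → Matrix κ κ ℂ)
    (Y : Fin (p + 1) → Matrix κ ι ℂ) : relDeriv .additive A B Y = ∑ j, Y j := by
  simp [relDeriv]

lemma relDeriv_multiplicative (A : Fin (p + 1) → Matrix ι ι ℂ) (B : Fin (p + 1) → Matrix κ κ ℂ)
    (Y : Fin (p + 1) → Matrix κ ι ℂ) :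
    relDeriv .multiplicative A B Y = derivProd (p + 1) A B Y := rfl

lemma sum_fromBlocks {J : Type*} (s : Finset J) (a : J → Matrix ι ι' ℂ) (b : J → Matrix ι κ' ℂ)
    (c : J → Matrix κ ι' ℂ) (d : J → Matrix κ κ' ℂ) :
    ∑ j ∈ s, fromBlocks (a j) (b j) (c j) (d j) =
      fromBlocks (∑ j ∈ s, a j) (∑ j ∈ s, b j) (∑ j ∈ s, c j) (∑ j ∈ s, d j) := by
  ext (_ | _) (_ | _) <;> simp [Matrix.sum_apply]

lemma isSolution_blk {v : Version} {K : Fin (p + 1) → Matrix ι ι ℂ}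
    {N : Fin (p + 1) → Matrix ι κ ℂ} {Q : Fin (p + 1) → Matrix κ κ ℂ} :
    IsSolution v (blk K N Q) ↔ IsSolution v K ∧ IsSolution v Q ∧ relDeriv v Q K N = 0 := by
  cases v with
  | additive =>
    simp only [IsSolution, blk, sum_fromBlocks, relDeriv_additive, Finset.sum_const_zero]
    rw [← fromBlocks_zero, fromBlocks_inj]
    tauto
  | multiplicative =>
    have h := prod_fromBlocks (p + 1) Q K N
    simp only [IsSolution, relDeriv_multiplicative]
    rw [show List.ofFn (blk K N Q) = List.ofFn fun j => fromBlocks (K j) (N j) 0 (Q j) from rfl, h,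
      ← fromBlocks_one, fromBlocks_inj]
    tauto

/-- Infinitesimal simultaneous conjugations preserve the relation; this makes the deformation
sequence a complex. -/
lemma relDeriv_adMap_const {v : Version} {A : Fin (p + 1) → Matrix ι ι ℂ}
    {B : Fin (p + 1) → Matrix κ κ ℂ} (hA : IsSolution v A) (hB : IsSolution v B)
    (X : Matrix κ ι ℂ) : relDeriv v A B (fun j => adMap (A j) (B j) X) = 0 := by
  cases v with
  | additive =>
    rw [relDeriv_additive]
    simp only [adMap_apply, Finset.sum_sub_distrib]
    rw [← Matrix.sum_mul, ← Matrix.mul_sum]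
    have hA' : ∑ j, A j = 0 := hA
    have hB' : ∑ j, B j = 0 := hB
    simp [hA', hB']
  | multiplicative =>
    rw [relDeriv_multiplicative, derivProd_adMap]
    have hA' : (List.ofFn A).prod = 1 := hA
    have hB' : (List.ofFn B).prod = 1 := hB
    rw [hA', hB', Matrix.one_mul, Matrix.mul_one, sub_self]

lemma mem_homSpace_of_trace {v : Version} {A : Fin (p + 1) → Matrix ι ι ℂ}
    {B : Fin (p + 1) → Matrix κ κ ℂ} (hA : IsSolution v A) {Z : Matrix ι κ ℂ}
    (h : ∀ X : Fin (p + 1) → Matrix κ ι ℂ,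
      (Z * relDeriv v A B fun j => adMap (A j) (B j) (X j)).trace = 0) : Z ∈ homSpace B A := by
  cases v with
  | additive =>
    intro j
    rw [← sub_eq_zero]
    refine Matrix.ext_iff_trace_mul_right.2 fun X => ?_
    have := h (Pi.single j X)
    rw [relDeriv_additive, Finset.sum_eq_single j (fun i _ hi => by simp [hi]) (by simp),
      Pi.single_eq_same, adMap_apply, Matrix.mul_sub, Matrix.trace_sub, sub_eq_zero] at this
    rw [Matrix.zero_mul, Matrix.trace_zero, Matrix.sub_mul, Matrix.trace_sub, sub_eq_zero,
      Matrix.mul_assoc, Matrix.trace_mul_comm, Matrix.mul_assoc, Matrix.mul_assoc]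
    exact this.symm
  | multiplicative =>
    have := mul_eq_mul_of_trace_derivProd (p + 1) A B Z h
    have hA' : (List.ofFn A).prod = 1 := hA
    rw [hA', Matrix.one_mul] at this
    exact this

lemma relDeriv_mul (v : Version) {A : Fin (p + 1) → Matrix ι ι ℂ} {B : Fin (p + 1) → Matrix κ κ ℂ}
    {A' : Fin (p + 1) → Matrix ι' ι' ℂ} {B' : Fin (p + 1) → Matrix κ' κ' ℂ} {V : Matrix κ' κ ℂ}
    {W : Matrix ι ι' ℂ} (hV : V ∈ homSpace B B') (hW : W ∈ homSpace A' A)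
    (Y : Fin (p + 1) → Matrix κ ι ℂ) :
    relDeriv v A' B' (fun j => V * Y j * W) = V * relDeriv v A B Y * W := by
  cases v with
  | additive => simp [relDeriv_additive, Matrix.mul_sum, Matrix.sum_mul]
  | multiplicative => exact (derivProd_mul (p + 1) hV hW Y).1

lemma IsEquivTuple.isSolution {v : Version} {A : Fin (p + 1) → Matrix ι ι ℂ}
    {B : Fin (p + 1) → Matrix κ κ ℂ} (h : IsEquivTuple A B) (hA : IsSolution v A) :
    IsSolution v B := by
  obtain ⟨X, Y, h₁, h₂, hX⟩ := h
  cases v with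
  | additive =>
    have hA' : ∑ j, A j = 0 := hA
    change ∑ j, B j = 0
    calc ∑ j, B j = (∑ j, B j) * X * Y := by rw [Matrix.mul_assoc, h₁, Matrix.mul_one]
      _ = X * (∑ j, A j) * Y := by
        rw [Matrix.sum_mul, Matrix.mul_sum, Finset.sum_congr rfl fun j _ => hX j]
      _ = 0 := by simp [hA']
  | multiplicative =>
    have hA' : (List.ofFn A).prod = 1 := hA
    change (List.ofFn B).prod = 1
    have h := (derivProd_mul (p + 1) (A := B) (A' := A) (B := B) (B' := B) (V := 1) (W := X)
      (by simp) hX 0).2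
    calc (List.ofFn B).prod = (List.ofFn B).prod * X * Y := by
          rw [Matrix.mul_assoc, h₁, Matrix.mul_one]
      _ = 1 := by rw [h, hA', Matrix.mul_one, h₁]

lemma IsSubquotient.isSolution {v : Version} {A : Fin (p + 1) → Matrix ι ι ℂ}
    {B : Fin (p + 1) → Matrix κ κ ℂ} (h : IsSubquotient B A) (hA : IsSolution v A) :
    IsSolution v B := by
  obtain ⟨W, hW, f, hf, hfB⟩ := h
  cases v with
  | additive =>
    change ∑ j, B j = 0
    apply Matrix.toLin'.injective
    apply LinearMap.ext
    intro x
    obtain ⟨w, rfl⟩ := hf x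
    have h1 : ∑ j, (⟨(A j).mulVec w, hW j w w.2⟩ : W) = 0 := by
      apply Subtype.ext
      rw [AddSubmonoidClass.coe_finsetSum]
      change ∑ j, (A j).mulVec w.1 = 0
      have hA' : ∑ j, A j = 0 := hA
      rw [← Matrix.sum_mulVec, hA', zero_mulVec]
    rw [Matrix.toLin'_apply, Matrix.sum_mulVec, ← Finset.sum_congr rfl fun j _ => hfB j w,
      ← map_sum, h1]
    simp
  | multiplicative =>
    -- Equivariance passes to partial products; the invariance of `W` under them is carried along,
    -- since the equivariance is stated in terms of it.
    have key : ∀ n (a : Fin n → Matrix ι ι ℂ) (b : Fin n → Matrix κ κ ℂ)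
        (ha : ∀ j, ∀ w ∈ W, (a j).mulVec w ∈ W)
        (_ : ∀ j (w : W), f ⟨(a j).mulVec w, ha j w w.2⟩ = (b j).mulVec (f w)),
        ∃ hp : ∀ w ∈ W, (List.ofFn a).prod.mulVec w ∈ W,
          ∀ w : W, f ⟨(List.ofFn a).prod.mulVec w, hp w w.2⟩ = (List.ofFn b).prod.mulVec (f w) := by
      intro n
      induction n with
      | zero =>
        intro a b ha _
        exact ⟨fun w hw => by simpa using hw, fun w => by simp⟩
      | succ n ih =>
        intro a b ha hab
        obtain ⟨hp, h⟩ := ih (fun i => a i.succ) (fun i => b i.succ) (fun j => ha j.succ)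
          (fun j => hab j.succ)
        refine ⟨fun w hw => ?_, fun w => ?_⟩
        · rw [List.ofFn_succ, List.prod_cons, ← mulVec_mulVec]
          exact ha 0 _ (hp w hw)
        · have h0 := hab 0 ⟨_, hp w w.2⟩
          rw [h w] at h0
          have hb : (List.ofFn b).prod = b 0 * (List.ofFn fun i => b i.succ).prod := by
            rw [List.ofFn_succ, List.prod_cons]
          rw [hb, ← mulVec_mulVec, ← h0]
          congr 1
          apply Subtype.ext
          change (List.ofFn a).prod.mulVec w.1 = (a 0).mulVec ((List.ofFn fun i : Fin n => a i.succ).prod.mulVec w.1)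
          rw [List.ofFn_succ, List.prod_cons, mulVec_mulVec]
    obtain ⟨hp, h⟩ := key _ A B hW hfB
    have hA' : (List.ofFn A).prod = 1 := hA
    change (List.ofFn B).prod = 1
    apply Matrix.toLin'.injective
    apply LinearMap.ext
    intro x
    obtain ⟨w, rfl⟩ := hf x
    rw [Matrix.toLin'_apply, ← h, Matrix.toLin'_apply, one_mulVec]
    congr 1
    apply Subtype.ext
    change (List.ofFn A).prod.mulVec w.1 = w.1
    rw [hA', one_mulVec]

end Relation
end DeligneSimpson

namespace DeligneSimpson

open Matrix
set_option linter.unusedSectionVars false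

/-! ### The deformation complex and infinitesimal rigidity -/

section Cohomology

variable {p : ℕ} {ι κ μ : Type} [Fintype ι] [DecidableEq ι] [Fintype κ] [DecidableEq κ]
  [Fintype μ] [DecidableEq μ]

/-- The maps `X ↦ B_j X - X A_j` for all `j` at once. -/
def adPi (A : Fin (p + 1) → Matrix ι ι ℂ) (B : Fin (p + 1) → Matrix κ κ ℂ) :
    (Fin (p + 1) → Matrix κ ι ℂ) →ₗ[ℂ] (Fin (p + 1) → Matrix κ ι ℂ) :=
  LinearMap.pi fun j => adMap (A j) (B j) ∘ₗ LinearMap.proj j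

/-- The diagonal map. -/
def diagPi (p : ℕ) (ι κ : Type) : Matrix κ ι ℂ →ₗ[ℂ] (Fin (p + 1) → Matrix κ ι ℂ) :=
  LinearMap.pi fun _ => LinearMap.id

lemma adPi_apply (A : Fin (p + 1) → Matrix ι ι ℂ) (B : Fin (p + 1) → Matrix κ κ ℂ)
    (X : Fin (p + 1) → Matrix κ ι ℂ) : adPi A B X = fun j => adMap (A j) (B j) (X j) := rfl

lemma finrank_range_adPi (A : Fin (p + 1) → Matrix ι ι ℂ) (B : Fin (p + 1) → Matrix κ κ ℂ) :
    Module.finrank ℂ (LinearMap.range (adPi A B)) =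
      ∑ j, Module.finrank ℂ (LinearMap.range (adMap (A j) (B j))) := by
  let g : (∀ j, LinearMap.range (adMap (A j) (B j))) →ₗ[ℂ] (Fin (p + 1) → Matrix κ ι ℂ) :=
    LinearMap.pi fun j => (LinearMap.range (adMap (A j) (B j))).subtype ∘ₗ LinearMap.proj j
  have hg : Function.Injective g := fun x y h => by
    funext j
    exact Subtype.ext (congrFun h j)
  have hr : LinearMap.range (adPi A B) = LinearMap.range g := by
    apply le_antisymm
    · rintro _ ⟨X, rfl⟩
      exact ⟨fun j => ⟨_, X j, rfl⟩, rfl⟩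
    · rintro _ ⟨y, rfl⟩
      choose X hX using fun j => (y j).2
      exact ⟨X, funext hX⟩
  rw [hr, LinearMap.finrank_range_of_inj hg, Module.finrank_pi_fintype]

lemma ker_adPi_diagPi (A : Fin (p + 1) → Matrix ι ι ℂ) (B : Fin (p + 1) → Matrix κ κ ℂ) :
    LinearMap.ker (adPi A B ∘ₗ diagPi p ι κ) = homSpace A B := by
  ext X
  rw [mem_homSpace_iff_adMap, LinearMap.mem_ker]
  exact funext_iff

lemma finrank_range_adPi_diagPi (A : Fin (p + 1) → Matrix ι ι ℂ) (B : Fin (p + 1) → Matrix κ κ ℂ) :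
    Module.finrank ℂ (LinearMap.range (adPi A B ∘ₗ diagPi p ι κ)) +
      Module.finrank ℂ (homSpace A B) = Fintype.card ι * Fintype.card κ := by
  rw [← ker_adPi_diagPi, LinearMap.finrank_range_add_finrank_ker, Module.finrank_matrix,
    Module.finrank_self, mul_one, mul_comm]

variable {v : Version} {A : Fin (p + 1) → Matrix ι ι ℂ} {B : Fin (p + 1) → Matrix κ κ ℂ}

lemma range_adPi_diagPi_le (hA : IsSolution v A) (hB : IsSolution v B) :
    LinearMap.range (adPi A B ∘ₗ diagPi p ι κ) ≤
      LinearMap.range (adPi A B) ⊓ LinearMap.ker (relDeriv v A B) := by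
  rintro _ ⟨X, rfl⟩
  exact ⟨⟨_, rfl⟩, relDeriv_adMap_const hA hB X⟩

/-- The cokernel of the second map of the deformation complex is dual to the homomorphisms in the
opposite direction. -/
lemma card_mul_card_le_finrank_range (hA : IsSolution v A) :
    Fintype.card ι * Fintype.card κ ≤
      Module.finrank ℂ (LinearMap.range (relDeriv v A B ∘ₗ adPi A B)) +
      Module.finrank ℂ (homSpace B A) := by
  let R := LinearMap.range (relDeriv v A B ∘ₗ adPi A B)
  -- The trace pairing turns functionals into matrices, and those that kill the range into
  -- intertwiners from `B` to `A`.
  let Φ : Module.Dual ℂ (Matrix κ ι ℂ) →ₗ[ℂ] Matrix ι κ ℂ :=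
    ⟨⟨fun φ => Matrix.of fun i k => φ (Matrix.single k i 1), fun _ _ => rfl⟩, fun _ _ => rfl⟩
  have hΦ : ∀ φ (Y : Matrix κ ι ℂ), (Φ φ * Y).trace = φ Y := by
    intro φ Y
    conv_rhs => rw [matrix_eq_sum_single Y]
    simp only [map_sum, Matrix.trace, Matrix.diag, Matrix.mul_apply]
    rw [Finset.sum_comm]
    refine Finset.sum_congr rfl fun k _ => Finset.sum_congr rfl fun i _ => ?_
    have : Matrix.single k i (Y k i) = Y k i • Matrix.single k i (1 : ℂ) := by simp
    rw [this, map_smul, smul_eq_mul, mul_comm]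
    rfl
  have hinj : Function.Injective Φ := fun φ ψ h => by
    ext1 Y
    rw [← hΦ, ← hΦ, h]
  have hmem : ∀ φ ∈ R.dualAnnihilator, Φ φ ∈ homSpace B A := fun φ hφ => by
    refine mem_homSpace_of_trace hA fun X => ?_
    rw [hΦ]
    exact (Submodule.mem_dualAnnihilator φ).1 hφ _ ⟨X, rfl⟩
  have h1 : Module.finrank ℂ R.dualAnnihilator ≤ Module.finrank ℂ (homSpace B A) :=
    LinearMap.finrank_le_finrank_of_injective (f := Φ.restrict hmem) fun φ ψ h =>
      Subtype.ext (hinj (congrArg Subtype.val h))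
  have h2 := Subspace.finrank_add_finrank_dualAnnihilator_eq R
  change _ ≤ Module.finrank ℂ R + _
  rw [Module.finrank_matrix, Module.finrank_self, mul_one, mul_comm] at h2
  omega

lemma finrank_range_comp_add_finrank_inf {E V : Type*} [AddCommGroup E] [Module ℂ E]
    [FiniteDimensional ℂ E] [AddCommGroup V] [Module ℂ V] (c : E →ₗ[ℂ] E) (d : E →ₗ[ℂ] V) :
    Module.finrank ℂ (LinearMap.range (d ∘ₗ c)) +
      Module.finrank ℂ (LinearMap.range c ⊓ LinearMap.ker d : Submodule ℂ E) =
      Module.finrank ℂ (LinearMap.range c) := by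
  rw [← LinearMap.finrank_range_add_finrank_ker (d.domRestrict (LinearMap.range c)),
    LinearMap.range_comp, LinearMap.range_domRestrict]
  congr 1
  rw [LinearMap.ker_domRestrict,
    (Submodule.equivMapOfInjective _ (LinearMap.range c).injective_subtype _).finrank_eq,
    Submodule.map_comap_subtype]

lemma chi_eq_sub_finrank_range_adPi (A : Fin (p + 1) → Matrix ι ι ℂ)
    (B : Fin (p + 1) → Matrix κ κ ℂ) : chi A B = 2 * (Fintype.card ι * Fintype.card κ) -
      (Module.finrank ℂ (LinearMap.range (adPi A B)) : ℤ) := by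
  rw [chi_eq_sub_rank, finrank_range_adPi]
  push_cast
  rfl

/-- Euler characteristic of the complex with middle term `range (adPi A B)`: H⁰ is Hom(A, B), H² is
at most Hom(B, A) in dimension, and H¹ enters negatively. -/
theorem chi_le (hA : IsSolution v A) (hB : IsSolution v B) :
    chi A B ≤ Module.finrank ℂ (homSpace A B) + Module.finrank ℂ (homSpace B A) := by
  have h1 := finrank_range_adPi_diagPi A B
  have h2 := card_mul_card_le_finrank_range (B := B) hA
  have h3 := finrank_range_comp_add_finrank_inf (adPi A B) (relDeriv v A B)
  have h4 := Submodule.finrank_mono (range_adPi_diagPi_le hA hB)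
  rw [chi_eq_sub_finrank_range_adPi]
  zify at h1 h2 h3 h4
  linarith

lemma relDeriv_adPi_surjective (hA : IsSolution v A) (h : homSpace B A = ⊥) :
    Function.Surjective (relDeriv v A B ∘ₗ adPi A B) := by
  rw [← LinearMap.range_eq_top]
  apply Submodule.eq_top_of_finrank_eq
  apply le_antisymm (Submodule.finrank_le _)
  have := card_mul_card_le_finrank_range (B := B) hA
  rw [h, finrank_bot, add_zero] at this
  rwa [Module.finrank_matrix, Module.finrank_self, mul_one, mul_comm]

/-- Solutions all of whose first order deformations in the conjugacy classes are trivial. -/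
def IsInfRigid (v : Version) (A : Fin (p + 1) → Matrix ι ι ℂ) : Prop :=
  IsSolution v A ∧ LinearMap.range (adPi A A) ⊓ LinearMap.ker (relDeriv v A A) ≤
    LinearMap.range (adPi A A ∘ₗ diagPi p ι ι)

lemma IsInfRigid.exists_eq (h : IsInfRigid v A) (X : Fin (p + 1) → Matrix ι ι ℂ)
    (hX : relDeriv v A A (adPi A A X) = 0) :
    ∃ Y, ∀ j, adMap (A j) (A j) (X j) = adMap (A j) (A j) Y := by
  obtain ⟨Y, hY⟩ := h.2 ⟨⟨X, rfl⟩, hX⟩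
  exact ⟨Y, fun j => (congrFun hY j).symm⟩

lemma isInfRigid_of_exists (hA : IsSolution v A) (h : ∀ X : Fin (p + 1) → Matrix ι ι ℂ,
    relDeriv v A A (adPi A A X) = 0 → ∃ Y, ∀ j, adMap (A j) (A j) (X j) = adMap (A j) (A j) Y) :
    IsInfRigid v A := by
  refine ⟨hA, ?_⟩
  rintro _ ⟨⟨X, rfl⟩, hX⟩
  obtain ⟨Y, hY⟩ := h X hX
  exact ⟨Y, funext fun j => (hY j).symm⟩

lemma finrank_homSpace_self_pos [Nonempty ι] (A : Fin (p + 1) → Matrix ι ι ℂ) :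
    0 < Module.finrank ℂ (homSpace A A) := by
  have : Nontrivial (homSpace A A) :=
    ⟨⟨1, fun j => by simp⟩, 0, fun h => one_ne_zero (congrArg Subtype.val h)⟩
  exact Module.finrank_pos

/-- With H¹ = 0 the Euler characteristic is at least the dimension of H⁰, which contains the
identity. -/
lemma IsInfRigid.chi_pos [Nonempty ι] (h : IsInfRigid v A) : 0 < chi A A := by
  have h1 := finrank_range_adPi_diagPi A A
  have h2 := finrank_homSpace_self_pos A
  have h3 := finrank_range_comp_add_finrank_inf (adPi A A) (relDeriv v A A)
  have h4 := Submodule.finrank_mono h.2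
  have h5 := Submodule.finrank_le (LinearMap.range (relDeriv v A A ∘ₗ adPi A A))
  rw [Module.finrank_matrix, Module.finrank_self, mul_one] at h5
  rw [chi_eq_sub_finrank_range_adPi]
  zify at h1 h2 h3 h4 h5
  linarith

lemma finrank_homSpace_le_one (h : HasTrivialCentralizer A) :
    Module.finrank ℂ (homSpace A A) ≤ 1 := by
  refine finrank_le_one ⟨1, fun j => by simp⟩ fun X => ?_
  obtain ⟨c, hc⟩ := h X.1 fun j => (X.2 j).symm
  exact ⟨c, Subtype.ext hc.symm⟩

/-- Both H⁰ and H² have dimension at most 1, so Euler characteristic 2 leaves no room for H¹. -/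
lemma isInfRigid_of_chi_eq_two (hA : IsSolution v A) (h : HasTrivialCentralizer A)
    (hchi : chi A A = 2) : IsInfRigid v A := by
  refine ⟨hA, (Submodule.eq_of_le_of_finrank_le (range_adPi_diagPi_le hA hA) ?_).ge⟩
  have h1 := finrank_range_adPi_diagPi A A
  have h2 := card_mul_card_le_finrank_range (B := A) hA
  have h3 := finrank_range_comp_add_finrank_inf (adPi A A) (relDeriv v A A)
  have h4 := finrank_homSpace_le_one h
  rw [chi_eq_sub_finrank_range_adPi] at hchi
  zify at h1 h2 h3 h4 ⊢
  linarith

lemma IsInfRigid.of_isEquivTuple (h : IsInfRigid v A) (he : IsEquivTuple A B) :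
    IsInfRigid v B := by
  have hB := he.isSolution h.1
  obtain ⟨X, Y, h₁, h₂, hX⟩ := he
  have hY := inverse_mem_homSpace h₁ h₂ hX
  have hconj : ∀ j Z, adMap (A j) (A j) (Y * Z * X) = Y * adMap (B j) (B j) Z * X := fun j Z => by
    rw [adMap_apply, adMap_apply, Matrix.mul_sub, Matrix.sub_mul, ← Matrix.mul_assoc,
      ← Matrix.mul_assoc, hY j, Matrix.mul_assoc _ X, ← hX j]
    simp only [Matrix.mul_assoc]
  have hback : ∀ T : Matrix κ κ ℂ, X * (Y * T * X) * Y = T := fun T => by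
    rw [← Matrix.mul_assoc, ← Matrix.mul_assoc, h₁, Matrix.one_mul, Matrix.mul_assoc, h₁,
      Matrix.mul_one]
  refine isInfRigid_of_exists hB fun Z hZ => ?_
  obtain ⟨T, hT⟩ := h.exists_eq (fun j => Y * Z j * X) (by
    have := relDeriv_mul v hY hX (adPi B B Z)
    rw [hZ, Matrix.mul_zero, Matrix.zero_mul] at this
    rw [← this]
    congr 1
    funext j
    exact hconj j (Z j))
  refine ⟨X * T * Y, fun j => ?_⟩
  have h3 := hT j
  have h4 : T = Y * (X * T * Y) * X := by
    rw [← Matrix.mul_assoc, ← Matrix.mul_assoc, h₂, Matrix.one_mul, Matrix.mul_assoc, h₂,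
      Matrix.mul_one]
  rw [h4, hconj, hconj] at h3
  have h5 := congrArg (fun T => X * T * Y) h3
  simpa only [hback] using h5

variable {K : Fin (p + 1) → Matrix ι ι ℂ} {N : Fin (p + 1) → Matrix ι κ ℂ}
  {Q : Fin (p + 1) → Matrix κ κ ℂ}

lemma fromBlocks_sub_fromBlocks (a a' : Matrix ι ι ℂ) (b b' : Matrix ι κ ℂ) (c c' : Matrix κ ι ℂ)
    (d d' : Matrix κ κ ℂ) : fromBlocks a b c d - fromBlocks a' b' c' d' =
      fromBlocks (a - a') (b - b') (c - c') (d - d') := by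
  ext (_ | _) (_ | _) <;> simp

/-- The corner `U` may stay unspecified: a deformation of the corner will cancel it. -/
lemma derivProd_fromBlocks (n : ℕ) (K : Fin n → Matrix ι ι ℂ) (N : Fin n → Matrix ι κ ℂ)
    (Q : Fin n → Matrix κ κ ℂ) (X : Fin n → Matrix ι ι ℂ) (T : Fin n → Matrix ι κ ℂ)
    (Y : Fin n → Matrix κ κ ℂ) : ∃ U, derivProd n (fun j => fromBlocks (K j) (N j) 0 (Q j))
      (fun j => fromBlocks (K j) (N j) 0 (Q j)) (fun j => fromBlocks (X j) (T j) 0 (Y j)) =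
      fromBlocks (derivProd n K K X) U 0 (derivProd n Q Q Y) := by
  induction n with
  | zero => exact ⟨0, by simp [derivProd]⟩
  | succ n ih =>
    obtain ⟨U, hU⟩ := ih (fun j => K j.succ) (fun j => N j.succ) (fun j => Q j.succ)
      (fun j => X j.succ) (fun j => T j.succ) (fun j => Y j.succ)
    rw [derivProd, hU, prod_fromBlocks, fromBlocks_multiply, fromBlocks_multiply, fromBlocks_add]
    simp only [Matrix.mul_zero, Matrix.zero_mul, add_zero, zero_add]
    exact ⟨_, rfl⟩

lemma derivProd_corner (n : ℕ) (K : Fin n → Matrix ι ι ℂ) (N : Fin n → Matrix ι κ ℂ)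
    (Q : Fin n → Matrix κ κ ℂ) (T : Fin n → Matrix ι κ ℂ) :
    derivProd n (fun j => fromBlocks (K j) (N j) 0 (Q j))
      (fun j => fromBlocks (K j) (N j) 0 (Q j)) (fun j => fromBlocks 0 (T j) 0 0) =
      fromBlocks 0 (derivProd n Q K T) 0 0 := by
  induction n with
  | zero => simp [derivProd]
  | succ n ih =>
    have := ih (fun j => K j.succ) (fun j => N j.succ) (fun j => Q j.succ) (fun j => T j.succ)
    rw [derivProd, this, prod_fromBlocks, fromBlocks_multiply, fromBlocks_multiply, fromBlocks_add]
    simp [derivProd]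

lemma relDeriv_fromBlocks (v : Version) (X : Fin (p + 1) → Matrix ι ι ℂ)
    (T : Fin (p + 1) → Matrix ι κ ℂ) (Y : Fin (p + 1) → Matrix κ κ ℂ) :
    ∃ U, relDeriv v (blk K N Q) (blk K N Q) (fun j => fromBlocks (X j) (T j) 0 (Y j)) =
      fromBlocks (relDeriv v K K X) U 0 (relDeriv v Q Q Y) := by
  cases v with
  | additive => exact ⟨_, by simp only [relDeriv_additive, sum_fromBlocks, Finset.sum_const_zero]; rfl⟩
  | multiplicative => exact derivProd_fromBlocks (p + 1) K N Q X T Y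

lemma relDeriv_corner (v : Version) (T : Fin (p + 1) → Matrix ι κ ℂ) :
    relDeriv v (blk K N Q) (blk K N Q) (fun j => fromBlocks 0 (T j) 0 0) =
      fromBlocks 0 (relDeriv v Q K T) 0 0 := by
  cases v with
  | additive => simp only [relDeriv_additive, sum_fromBlocks, Finset.sum_const_zero]
  | multiplicative => exact derivProd_corner (p + 1) K N Q T

/-- Infinitesimal rigidity passes to the ends of an extension without homomorphisms from the sub to
the quotient. -/
theorem IsInfRigid.of_blk (h : IsInfRigid v (blk K N Q)) (hKQ : homSpace K Q = ⊥) :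
    IsInfRigid v K ∧ IsInfRigid v Q := by
  obtain ⟨hK, hQ, -⟩ := isSolution_blk.1 h.1
  have key : ∀ (X : Fin (p + 1) → Matrix ι ι ℂ) (X' : Fin (p + 1) → Matrix κ κ ℂ),
      relDeriv v K K (adPi K K X) = 0 → relDeriv v Q Q (adPi Q Q X') = 0 →
      (∃ Y, ∀ j, adMap (K j) (K j) (X j) = adMap (K j) (K j) Y) ∧
      ∃ Y, ∀ j, adMap (Q j) (Q j) (X' j) = adMap (Q j) (Q j) Y := by
    intro X X' hX hX'
    have had : ∀ j a b d, adMap (blk K N Q j) (blk K N Q j) (fromBlocks a b 0 d) =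
        fromBlocks (adMap (K j) (K j) a) (adMap (Q j) (K j) b + (N j * d - a * N j)) 0
          (adMap (Q j) (Q j) d) := fun j a b d => by
      simp only [adMap_apply, blk, fromBlocks_multiply, fromBlocks_sub_fromBlocks]
      rw [fromBlocks_inj]
      refine ⟨by simp, by abel, by simp, by simp⟩
    obtain ⟨U, hU⟩ := relDeriv_fromBlocks (K := K) (N := N) (Q := Q) v (adPi K K X)
      (fun j => N j * X' j - X j * N j) (adPi Q Q X')
    rw [hX, hX'] at hU
    -- The obstruction to combining the two deformations lies in a cokernel dual to Hom(K, Q) = 0,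
    -- so some corner `R` removes it.
    obtain ⟨R, hR⟩ := relDeriv_adPi_surjective (B := K) hQ hKQ (-U)
    obtain ⟨Y, hY⟩ := h.exists_eq (fun j => fromBlocks (X j) (R j) 0 (X' j)) (by
      have h1 : adPi (blk K N Q) (blk K N Q) (fun j => fromBlocks (X j) (R j) 0 (X' j)) =
          (fun j => fromBlocks 0 (adPi Q K R j) 0 0) + fun j => fromBlocks (adPi K K X j)
            (N j * X' j - X j * N j) 0 (adPi Q Q X' j) := by
        funext j
        change adMap _ _ (fromBlocks _ _ _ _) = _
        rw [had, Pi.add_apply, fromBlocks_add]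
        simp [adPi_apply]
      rw [h1, map_add, hU, relDeriv_corner]
      have h2 : relDeriv v Q K (adPi Q K R) = -U := hR
      change fromBlocks 0 (relDeriv v Q K (adPi Q K R)) 0 0 + _ = _
      rw [h2, fromBlocks_add]
      simp)
    have hY' : ∀ j, adMap (blk K N Q j) (blk K N Q j) Y =
        fromBlocks (adMap (K j) (K j) Y.toBlocks₁₁ + N j * Y.toBlocks₂₁)
          (K j * Y.toBlocks₁₂ + N j * Y.toBlocks₂₂ - (Y.toBlocks₁₁ * N j + Y.toBlocks₁₂ * Q j))
          (adMap (K j) (Q j) Y.toBlocks₂₁)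
          (adMap (Q j) (Q j) Y.toBlocks₂₂ - Y.toBlocks₂₁ * N j) := fun j => by
      conv_lhs => rw [← fromBlocks_toBlocks Y]
      simp only [adMap_apply, blk, fromBlocks_multiply, fromBlocks_sub_fromBlocks]
      rw [fromBlocks_inj]
      refine ⟨?_, by abel, ?_, ?_⟩ <;> simp <;> abel
    have hall : ∀ j, _ := fun j => fromBlocks_inj.1 (((had j _ _ _).symm.trans (hY j)).trans (hY' j))
    -- The deformation preserves the block form, so the lower left block of `Y` intertwines `K` and
    -- `Q` and vanishes; the diagonal blocks of `Y` then trivialize the deformations of the ends.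
    have hc : Y.toBlocks₂₁ = 0 := by
      have : Y.toBlocks₂₁ ∈ homSpace K Q := mem_homSpace_iff_adMap.2 fun j => (hall j).2.2.1.symm
      rwa [hKQ, Submodule.mem_bot] at this
    refine ⟨⟨Y.toBlocks₁₁, fun j => ?_⟩, Y.toBlocks₂₂, fun j => ?_⟩
    · rw [(hall j).1, hc, Matrix.mul_zero, add_zero]
    · rw [(hall j).2.2.2, hc, Matrix.zero_mul, sub_zero]
  refine ⟨isInfRigid_of_exists hK fun X hX => (key X 0 hX ?_).1,
    isInfRigid_of_exists hQ fun X hX => (key 0 X ?_ hX).2⟩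
  · rw [map_zero, map_zero]
  · rw [map_zero, map_zero]

end Cohomology
end DeligneSimpson

namespace DeligneSimpson

open Matrix
set_option linter.unusedSectionVars false

/-! ### Irreducible tuples: parity, Katz's uniqueness, triangular form -/

section Irreducible

variable {p : ℕ} {ι κ : Type} [Fintype ι] [DecidableEq ι] [Fintype κ] [DecidableEq κ]

lemma trace_adMap_mul (a X Y : Matrix ι ι ℂ) :
    (adMap a a X * Y).trace = -(adMap a a Y * X).trace := by
  simp only [adMap_apply, Matrix.sub_mul, Matrix.trace_sub, neg_sub]
  congr 1
  · rw [Matrix.trace_mul_comm, ← Matrix.mul_assoc]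
  · rw [Matrix.mul_assoc, Matrix.trace_mul_comm]

/-- Conjugacy classes are even-dimensional. -/
lemma even_finrank_range_adMap (a : Matrix ι ι ℂ) :
    Even (Module.finrank ℂ (LinearMap.range (adMap a a))) := by
  obtain ⟨C, hC⟩ := Submodule.exists_isCompl (LinearMap.ker (adMap a a))
  have hr : Module.finrank ℂ (LinearMap.range (adMap a a)) = Module.finrank ℂ C := by
    have h1 := LinearMap.finrank_range_add_finrank_ker (adMap a a)
    have h2 := Submodule.finrank_add_eq_of_isCompl hC
    omega
  rw [hr]
  let b := Module.finBasis ℂ C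
  -- The form `tr([a, X] Y)` is skew with radical the kernel of `adMap a a`, hence non-degenerate on
  -- the complement `C`; a skew matrix of odd size is singular.
  let M : Matrix (Fin (Module.finrank ℂ C)) (Fin (Module.finrank ℂ C)) ℂ :=
    Matrix.of fun i j => (adMap a a (b i).1 * (b j).1).trace
  have hskew : Mᵀ = -M := by
    ext i j
    exact trace_adMap_mul a _ _
  have hdet : M.det ≠ 0 := by
    intro h0
    obtain ⟨x, hx0, hx⟩ := Matrix.exists_vecMul_eq_zero_iff.2 h0
    let X : C := b.equivFun.symm x
    have hXb : ∀ j, (adMap a a X.1 * (b j).1).trace = 0 := fun j => by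
      have h1 := congrFun hx j
      have h2 : X.1 = ∑ i, x i • (b i).1 := by
        simp only [X, Module.Basis.equivFun_symm_apply, AddSubmonoidClass.coe_finsetSum]
        rfl
      rw [h2, map_sum, Matrix.sum_mul, Matrix.trace_sum, ← Pi.zero_apply (M := fun _ => ℂ) j, ← h1]
      refine Finset.sum_congr rfl fun i _ => ?_
      rw [map_smul, Matrix.smul_mul, Matrix.trace_smul]
      rfl
    have hXC : ∀ Y ∈ C, (adMap a a X.1 * Y).trace = 0 := fun Y hY => by
      have h2 : Y = ∑ i, b.repr ⟨Y, hY⟩ i • (b i).1 := by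
        have := congrArg Subtype.val (b.sum_repr ⟨Y, hY⟩)
        rw [AddSubmonoidClass.coe_finsetSum] at this
        exact this.symm
      rw [h2, Matrix.mul_sum, Matrix.trace_sum]
      refine Finset.sum_eq_zero fun i _ => ?_
      rw [Matrix.mul_smul, Matrix.trace_smul, hXb, smul_zero]
    have hX : adMap a a X.1 = 0 := by
      refine Matrix.ext_iff_trace_mul_right.2 fun Y => ?_
      obtain ⟨Y₁, h₁, Y₂, h₂, rfl⟩ := Submodule.mem_sup.1
        (hC.sup_eq_top ▸ Submodule.mem_top : Y ∈ LinearMap.ker (adMap a a) ⊔ C)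
      rw [Matrix.mul_add, Matrix.trace_add, hXC _ h₂, trace_adMap_mul, LinearMap.mem_ker.1 h₁]
      simp
    have hX0 : X.1 = 0 := by
      have : X.1 ∈ LinearMap.ker (adMap a a) ⊓ C := ⟨hX, X.2⟩
      rwa [hC.inf_eq_bot, Submodule.mem_bot] at this
    apply hx0
    have : X = 0 := Subtype.ext hX0
    rw [← b.equivFun.apply_symm_apply x, show b.equivFun.symm x = 0 from this, map_zero]
  have h1 := congrArg Matrix.det hskew
  rw [Matrix.det_transpose, Matrix.det_neg, Fintype.card_fin] at h1
  by_contra hodd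
  rw [Nat.not_even_iff_odd] at hodd
  rw [hodd.neg_one_pow] at h1
  apply hdet
  linear_combination h1 / 2

lemma even_chi (A : Fin (p + 1) → Matrix ι ι ℂ) : Even (chi A A) := by
  rw [chi_eq_sub_rank]
  refine Even.sub (even_two_mul _) (Finset.even_sum _ fun j _ => ?_)
  exact_mod_cast even_finrank_range_adMap (A j)

lemma IsIrreducibleTuple.hasTrivialCentralizer {A : Fin (p + 1) → Matrix ι ι ℂ}
    (hA : IsIrreducibleTuple A) : HasTrivialCentralizer A := by
  intro X hX
  have := hA.1
  obtain ⟨c, hc⟩ := Module.End.exists_eigenvalue (Matrix.toLin' X : Module.End ℂ (ι → ℂ))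
  obtain ⟨w, hw⟩ := hc.exists_hasEigenvector
  refine ⟨c, ?_⟩
  rw [← sub_eq_zero]
  by_contra h0
  have hmem : X - c • (1 : Matrix ι ι ℂ) ∈ homSpace A A := fun j => by
    rw [Matrix.mul_sub, Matrix.sub_mul, hX j]; simp
  have hinj := mulVec_injective_of_irreducible hA hmem h0
  apply hw.2
  apply hinj
  have := hw.apply_eq_smul
  rw [Matrix.toLin'_apply] at this
  rw [Matrix.sub_mulVec, this, mulVec_zero, smul_mulVec, one_mulVec, sub_self]

/-- By Schur's lemma `chi_le` bounds the value by 1 + 1, and it is even. -/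
lemma IsIrreducibleTuple.chi_eq_two {v : Version} {A : Fin (p + 1) → Matrix ι ι ℂ}
    (hA : IsIrreducibleTuple A) (hs : IsSolution v A) (hpos : 0 < chi A A) : chi A A = 2 := by
  have h1 := chi_le hs hs
  have h2 := finrank_homSpace_le_one hA.hasTrivialCentralizer
  obtain ⟨m, hm⟩ := even_chi A
  omega

/-- An irreducible solution with index of rigidity `2` is determined by its conjugacy classes. -/
theorem IsIrreducibleTuple.isConjTo_of_chi_eq_two {v : Version} {A A' : Fin (p + 1) → Matrix ι ι ℂ}
    (hA : IsIrreducibleTuple A) (hs : IsSolution v A) (hchi : chi A A = 2)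
    (hs' : IsSolution v A') (hconj : ∀ j, A' j ∈ conjClass (A j)) : IsConjTo A A' := by
  -- The ranks depend only on the conjugacy classes. By `chi_le`, Hom(A, A') or Hom(A', A) is then
  -- non-zero, and equal sizes make a non-zero intertwiner to or from the irreducible `A`
  -- invertible.
  have h1 : chi A A' = 2 := by
    rw [← hchi]
    have : ∀ j, Module.finrank ℂ (LinearMap.ker (adMap (A j) (A' j))) =
        Module.finrank ℂ (LinearMap.ker (adMap (A j) (A j))) := fun j => by
      obtain ⟨g, hg⟩ := hconj j
      have hX : A' j * (g : Matrix ι ι ℂ) = g * A j := by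
        rw [hg, Matrix.mul_assoc]
        have : ((g⁻¹ : GL ι ℂ) : Matrix ι ι ℂ) * (g : Matrix ι ι ℂ) = 1 := g.inv_mul
        rw [this, Matrix.mul_one]
      have hY : A j * ((g⁻¹ : GL ι ℂ) : Matrix ι ι ℂ) = ((g⁻¹ : GL ι ℂ) : Matrix ι ι ℂ) * A' j := by
        rw [hg, ← Matrix.mul_assoc, ← Matrix.mul_assoc]
        have : ((g⁻¹ : GL ι ℂ) : Matrix ι ι ℂ) * (g : Matrix ι ι ℂ) = 1 := g.inv_mul
        rw [this, Matrix.one_mul]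
      exact le_antisymm (finrank_ker_adMap_le_right _ g.mul_inv hY)
        (finrank_ker_adMap_le_right _ g.inv_mul hX)
    simp only [chi, this]
  have h2 := chi_le hs hs'
  rw [h1] at h2
  by_cases h3 : homSpace A A' = ⊥
  · have h4 : homSpace A' A ≠ ⊥ := fun h4 => by
      rw [h3, h4, finrank_bot] at h2
      norm_num at h2
    obtain ⟨X, hX, hX0⟩ := Submodule.exists_mem_ne_zero_of_ne_bot h4
    have hsurj := mulVec_surjective_of_irreducible hA hX hX0
    have hinj : Function.Injective X.mulVec :=
      (LinearMap.injective_iff_surjective (f := X.mulVecLin)).2 hsurj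
    exact (isEquivTuple_of_bijective hX ⟨hinj, hsurj⟩).symm.isConjTo
  · obtain ⟨X, hX, hX0⟩ := Submodule.exists_mem_ne_zero_of_ne_bot h3
    have hinj := mulVec_injective_of_irreducible hA hX hX0
    have hsurj : Function.Surjective X.mulVec :=
      (LinearMap.injective_iff_surjective (f := X.mulVecLin)).1 hinj
    exact (isEquivTuple_of_bijective hX ⟨hinj, hsurj⟩).isConjTo

lemma IsEquivTuple.isIrreducibleTuple {A : Fin (p + 1) → Matrix ι ι ℂ}
    {B : Fin (p + 1) → Matrix κ κ ℂ} (h : IsEquivTuple A B) (hA : IsIrreducibleTuple A) :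
    IsIrreducibleTuple B := by
  have := hA.1
  refine ⟨Fintype.card_pos_iff.1 (h.card_eq ▸ Fintype.card_pos), fun U hU => ?_⟩
  obtain ⟨X, Y, h₁, h₂, hX⟩ := h
  have hinv : IsInvariant A (U.comap X.mulVecLin) := fun j w hw => by
    rw [Submodule.mem_comap, mulVecLin_apply] at hw ⊢
    rw [mulVec_mulVec, ← hX j, ← mulVec_mulVec]
    exact hU j _ hw
  have hXY : ∀ u, X.mulVec (Y.mulVec u) = u := fun u => by rw [mulVec_mulVec, h₁, one_mulVec]
  rcases hA.2 _ hinv with h | h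
  · left
    rw [eq_bot_iff]
    intro u hu
    have : Y.mulVec u ∈ U.comap X.mulVecLin := by
      rw [Submodule.mem_comap, mulVecLin_apply, hXY]; exact hu
    rw [h, Submodule.mem_bot] at this
    rw [Submodule.mem_bot, ← hXY u, this, mulVec_zero]
  · right
    rw [eq_top_iff]
    intro u _
    have : Y.mulVec u ∈ U.comap X.mulVecLin := by rw [h]; trivial
    rwa [Submodule.mem_comap, mulVecLin_apply, hXY] at this

/-- Every tuple is conjugate to a block triangular one with irreducible diagonal blocks. -/
theorem exists_blockTriangular (n : ℕ) (A : Fin (p + 1) → Matrix (Fin n) (Fin n) ℂ) :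
    ∃ (A' : Fin (p + 1) → Matrix (Fin n) (Fin n) ℂ) (s : ℕ) (b : Fin n → Fin s),
      IsEquivTuple A A' ∧ Monotone b ∧ (∀ j, (A' j).BlockTriangular b) ∧
        ∀ i : Fin s, IsIrreducibleTuple fun j => (A' j).toSquareBlock b i := by
  induction n using Nat.strong_induction_on with
  | _ n ih =>
    rcases Nat.eq_zero_or_pos n with rfl | hn
    · exact ⟨A, 0, Fin.elim0, .refl A, fun i => i.elim0, fun j i => i.elim0, fun i => i.elim0⟩
    have : Nonempty (Fin n) := ⟨⟨0, hn⟩⟩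
    obtain ⟨k, S, X, hS, hX, hinj⟩ := exists_irreducible_sub A
    have hk : 0 < k := Fin.pos_iff_nonempty.2 hS.1
    obtain ⟨m, N, Q, h⟩ := exists_blk_of_injective hX hinj
    have hcard : n = k + m := by simpa using h.card_eq
    subst hcard
    obtain ⟨Q', s, b, hQ, hb, htri, hirr⟩ := ih m (by omega) Q
    obtain ⟨N', hN'⟩ := blk_congr_right S N hQ
    -- The irreducible sub receives the label 0, and the labels of the quotient shift by one.
    let c : Fin k ⊕ Fin m → Fin (s + 1) := Sum.elim (fun _ => 0) fun i => (b i).succ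
    let e : Fin k ⊕ Fin m ≃ Fin (k + m) := finSumFinEquiv
    let A' : Fin (p + 1) → Matrix (Fin (k + m)) (Fin (k + m)) ℂ := fun j =>
      (blk S N' Q' j).submatrix e.symm e.symm
    refine ⟨A', s + 1, c ∘ e.symm, (h.trans hN').trans (isEquivTuple_of_equiv e.symm
      fun _ _ _ => rfl), ?_, ?_, ?_⟩
    · intro x y hxy
      obtain ⟨x, rfl⟩ := e.surjective x
      obtain ⟨y, rfl⟩ := e.surjective y
      simp only [Function.comp_apply, Equiv.symm_apply_apply]
      rcases x with x | x
      · exact Fin.zero_le _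
      · rcases y with y | y
        · exfalso
          simp only [e, finSumFinEquiv_apply_left, finSumFinEquiv_apply_right, Fin.le_def,
            Fin.val_natAdd, Fin.val_castAdd] at hxy
          omega
        · have hxy' : x ≤ y := by
            simp only [e, finSumFinEquiv_apply_right, Fin.le_def, Fin.val_natAdd] at hxy
            exact Fin.le_def.2 (by omega)
          exact Fin.succ_le_succ_iff.2 (hb hxy')
    · intro j x y hxy
      obtain ⟨x, rfl⟩ := e.surjective x
      obtain ⟨y, rfl⟩ := e.surjective y
      simp only [Function.comp_apply, Equiv.symm_apply_apply] at hxy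
      simp only [A', submatrix_apply, Equiv.symm_apply_apply]
      rcases x with x | x
      · exact absurd hxy (Fin.not_lt_zero _)
      · rcases y with y | y
        · rfl
        · exact htri j (Fin.succ_lt_succ_iff.1 hxy)
    · refine Fin.cases ?_ fun i => ?_
      · let φ : {x : Fin (k + m) // (c ∘ e.symm) x = 0} ≃ Fin k :=
          -- The value on the right summand is a dummy: indices there carry a non-zero label. The
          -- same device is used for the other blocks.
          { toFun := fun x => Sum.elim (fun y => y) (fun _ => ⟨0, hk⟩) (e.symm x.1)
            invFun := fun y => ⟨e (Sum.inl y), by simp [c]⟩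
            left_inv := fun ⟨x, hx⟩ => by
              obtain ⟨x, rfl⟩ := e.surjective x
              rcases x with x | x
              · simp
              · simp [c] at hx
            right_inv := fun y => by simp }
        refine (isEquivTuple_of_equiv φ ?_).isIrreducibleTuple hS
        rintro j ⟨x, hx⟩ ⟨y, hy⟩
        obtain ⟨x, rfl⟩ := e.surjective x
        obtain ⟨y, rfl⟩ := e.surjective y
        rcases x with x | x
        · rcases y with y | y
          · simp [φ, A', toSquareBlock_def, blk]
          · simp [c] at hy
        · simp [c] at hx
      · have hm : 0 < m := by
          obtain ⟨x, -⟩ := (hirr i).1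
          exact x.pos
        let φ : {x : Fin (k + m) // (c ∘ e.symm) x = i.succ} ≃ {x : Fin m // b x = i} :=
          Equiv.ofBijective (fun x => ⟨Sum.elim (fun _ => ⟨0, hm⟩) (fun y => y) (e.symm x.1), by
              obtain ⟨x, hx⟩ := x
              obtain ⟨x, rfl⟩ := e.surjective x
              rcases x with x | x
              · simp only [c, Function.comp_apply, Equiv.symm_apply_apply, Sum.elim_inl] at hx
                exact absurd hx.symm (Fin.succ_ne_zero i)
              · simpa [c] using hx⟩) ⟨by
            rintro ⟨x, hx⟩ ⟨y, hy⟩ hxy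
            obtain ⟨x, rfl⟩ := e.surjective x
            obtain ⟨y, rfl⟩ := e.surjective y
            rcases x with x | x
            · simp only [c, Function.comp_apply, Equiv.symm_apply_apply, Sum.elim_inl] at hx
              exact absurd hx.symm (Fin.succ_ne_zero i)
            · rcases y with y | y
              · simp only [c, Function.comp_apply, Equiv.symm_apply_apply, Sum.elim_inl] at hy
                exact absurd hy.symm (Fin.succ_ne_zero i)
              · simpa using hxy, by
            rintro ⟨x, hx⟩
            exact ⟨⟨e (Sum.inr x), by simp [c, hx]⟩, by simp⟩⟩
        refine (isEquivTuple_of_equiv φ ?_).isIrreducibleTuple (hirr i)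
        rintro j ⟨x, hx⟩ ⟨y, hy⟩
        obtain ⟨x, rfl⟩ := e.surjective x
        obtain ⟨y, rfl⟩ := e.surjective y
        rcases x with x | x
        · simp only [c, Function.comp_apply, Equiv.symm_apply_apply, Sum.elim_inl] at hx
          exact absurd hx.symm (Fin.succ_ne_zero i)
        · rcases y with y | y
          · simp only [c, Function.comp_apply, Equiv.symm_apply_apply, Sum.elim_inl] at hy
            exact absurd hy.symm (Fin.succ_ne_zero i)
          · simp [φ, A', toSquareBlock_def, blk]

/-- The diagonal blocks of a block triangular tuple are subquotients. -/
lemma isSubquotient_toSquareBlock {n s : ℕ} {A : Fin (p + 1) → Matrix (Fin n) (Fin n) ℂ}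
    {b : Fin n → Fin s} (h : ∀ j, (A j).BlockTriangular b) (i : Fin s) :
    IsSubquotient (fun j => (A j).toSquareBlock b i) A := by
  -- Vectors supported on the blocks up to `i`; projecting to the coordinates of block `i` kills the
  -- earlier blocks.
  let W : Submodule ℂ (Fin n → ℂ) :=
    { carrier := {w | ∀ x, i < b x → w x = 0}
      add_mem' := fun hw hw' x hx => by simp [hw x hx, hw' x hx]
      zero_mem' := fun _ _ => rfl
      smul_mem' := fun c w hw x hx => by simp [hw x hx] }
  have hW : IsInvariant A W := fun j w hw x hx => by
    change ∑ y, A j x y * w y = 0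
    refine Finset.sum_eq_zero fun y _ => ?_
    rcases lt_or_ge i (b y) with hy | hy
    · rw [hw y hy, mul_zero]
    · rw [h j (hy.trans_lt hx), zero_mul]
  refine ⟨W, hW, LinearMap.funLeft ℂ ℂ Subtype.val ∘ₗ W.subtype, fun u => ?_, fun j w => ?_⟩
  · refine ⟨⟨fun x => if hx : b x = i then u ⟨x, hx⟩ else 0, fun x hx => ?_⟩, ?_⟩
    · exact dif_neg hx.ne'
    · funext x
      exact dif_pos x.2
  · funext x
    change ∑ y, A j x y * w.1 y = ∑ y : {y // b y = i}, A j x y * w.1 y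
    rw [← Finset.sum_subtype (Finset.univ.filter fun y => b y = i) (by simp)
      (fun y => A j x y * w.1 y)]
    refine (Finset.sum_subset (Finset.filter_subset _ _) fun y _ hy => ?_).symm
    rw [Finset.mem_filter, not_and] at hy
    rcases lt_or_gt_of_ne (hy (Finset.mem_univ y)) with hlt | hgt
    · rw [h j (hlt.trans_eq x.2.symm), zero_mul]
    · rw [w.2 y hgt, mul_zero]

end Irreducible
end DeligneSimpson

namespace DeligneSimpson

open Matrix Filter Topology
set_option linter.unusedSectionVars false

/-! ### Perturbation of linear systems and tangent spaces of conjugacy classes -/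

section Perturbation

/-- Linear equations depending continuously on a parameter that are uniquely solvable at one value
of the parameter are so nearby, and the solution depends continuously on the parameter. -/
lemma exists_tendsto_solution {T C : Type*} [TopologicalSpace T] [AddCommGroup C] [Module ℂ C]
    [FiniteDimensional ℂ C] [TopologicalSpace C] [IsTopologicalAddGroup C] [ContinuousSMul ℂ C]
    [T2Space C] {t₀ : T} (L : T → C →ₗ[ℂ] C) (hL : ∀ c, ContinuousAt (fun t => L t c) t₀)
    (h0 : L t₀ = LinearMap.id) (w : T → C) (hw : ContinuousAt w t₀) (hw0 : w t₀ = 0) :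
    (∀ᶠ t in 𝓝 t₀, Function.Injective (L t)) ∧
      ∃ y : T → C, Tendsto y (𝓝 t₀) (𝓝 0) ∧ ∀ᶠ t in 𝓝 t₀, L t (y t) = w t := by
  let b := Module.finBasis ℂ C
  let M : T → Matrix (Fin (Module.finrank ℂ C)) (Fin (Module.finrank ℂ C)) ℂ := fun t =>
    LinearMap.toMatrix b b (L t)
  have hrepr : Continuous fun c : C => b.equivFun c :=
    LinearMap.continuous_of_finiteDimensional b.equivFun.toLinearMap
  have hM : ContinuousAt M t₀ := by
    refine continuousAt_pi.2 fun i => continuousAt_pi.2 fun k => ?_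
    have : (fun t => M t i k) = fun t => b.equivFun (L t (b k)) i := by
      funext t
      simp [M, LinearMap.toMatrix_apply]
    rw [this]
    exact ((continuous_apply i).comp hrepr).continuousAt.comp (hL (b k))
  have hM0 : M t₀ = 1 := by simp only [M, h0, LinearMap.toMatrix_id]
  have hdet : ContinuousAt (fun t => (M t).det) t₀ :=
    (continuous_id.matrix_det).continuousAt.comp hM
  have hdet0 : (M t₀).det ≠ 0 := by rw [hM0, Matrix.det_one]; exact one_ne_zero
  have hev : ∀ᶠ t in 𝓝 t₀, (M t).det ≠ 0 := hdet.eventually_ne hdet0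
  have hML : ∀ t c, b.equivFun (L t c) = (M t).mulVec (b.equivFun c) := fun t c => by
    rw [Module.Basis.equivFun_apply, Module.Basis.equivFun_apply, LinearMap.toMatrix_mulVec_repr]
  constructor
  · filter_upwards [hev] with t ht
    rw [← LinearMap.ker_eq_bot, eq_bot_iff]
    intro c hc
    have := hML t c
    rw [LinearMap.mem_ker.1 hc, map_zero] at this
    have := Matrix.eq_zero_of_mulVec_eq_zero ht this.symm
    simpa using this
  -- Cramer's rule gives a candidate for every `t`; it solves the system wherever the determinant is
  -- non-zero.
  · let u : T → Fin (Module.finrank ℂ C) → ℂ := fun t =>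
      ((M t).det)⁻¹ • (M t).adjugate.mulVec (b.equivFun (w t))
    have hu : ContinuousAt u t₀ := by
      refine (hdet.inv₀ hdet0).smul ?_
      have h1 : ContinuousAt (fun t => (M t).adjugate) t₀ :=
        (continuous_id.matrix_adjugate).continuousAt.comp hM
      have h2 : ContinuousAt (fun t => b.equivFun (w t)) t₀ := hrepr.continuousAt.comp hw
      have h3 : Continuous fun q : Matrix (Fin (Module.finrank ℂ C)) (Fin (Module.finrank ℂ C)) ℂ ×
          (Fin (Module.finrank ℂ C) → ℂ) => q.1.mulVec q.2 :=
        continuous_fst.matrix_mulVec continuous_snd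
      have h4 : ∀ P : T → Matrix (Fin (Module.finrank ℂ C)) (Fin (Module.finrank ℂ C)) ℂ,
          ∀ q : T → Fin (Module.finrank ℂ C) → ℂ, ContinuousAt P t₀ → ContinuousAt q t₀ →
          ContinuousAt (fun t => (P t).mulVec (q t)) t₀ := fun P q hP hq =>
        h3.continuousAt.comp (x := t₀) (f := fun t => (P t, q t)) (hP.prodMk hq)
      exact h4 _ _ h1 h2
    have hb : Continuous fun x : Fin (Module.finrank ℂ C) → ℂ => b.equivFun.symm x :=
      LinearMap.continuous_of_finiteDimensional b.equivFun.symm.toLinearMap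
    refine ⟨fun t => b.equivFun.symm (u t), ?_, ?_⟩
    · have hu0 : u t₀ = 0 := by
        simp only [u, hw0, map_zero, mulVec_zero, smul_zero]
      have hu' : Tendsto u (𝓝 t₀) (𝓝 0) := by
        rw [← hu0]
        exact hu
      have hb' := hb.tendsto 0
      rw [map_zero] at hb'
      exact hb'.comp hu'
    · filter_upwards [hev] with t ht
      apply b.equivFun.injective
      rw [hML, LinearEquiv.apply_symm_apply, mulVec_smul, mulVec_mulVec, Matrix.mul_adjugate,
        smul_mulVec, one_mulVec, smul_smul, inv_mul_cancel₀ ht, one_smul]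

variable {p : ℕ} {ι κ : Type} [Fintype ι] [DecidableEq ι] [Fintype κ] [DecidableEq κ]

/-- A tuple close to `A` and equivalent to it is conjugate to it by a matrix close to `1`. -/
lemma exists_conj_near_one (A : Fin (p + 1) → Matrix ι ι ℂ) :
    ∃ y : (Fin (p + 1) → Matrix ι ι ℂ) → Matrix ι ι ℂ, Tendsto y (𝓝 A) (𝓝 0) ∧
      ∀ᶠ A' in 𝓝 A, IsEquivTuple A A' → 1 + y A' ∈ homSpace A' A := by
  let Λ : (Fin (p + 1) → Matrix ι ι ℂ) → Matrix ι ι ℂ →ₗ[ℂ] (Fin (p + 1) → Matrix ι ι ℂ) :=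
    fun A' => adPi A' A ∘ₗ diagPi p ι ι
  have hΛ : ∀ X, Continuous fun A' => Λ A' X := fun X => continuous_pi fun j =>
    (continuous_const.sub (continuous_const.mul (continuous_apply j)) :
      Continuous fun A' : Fin (p + 1) → Matrix ι ι ℂ => A j * X - X * A' j)
  have hker : ∀ A', LinearMap.ker (Λ A') = homSpace A' A := fun A' => ker_adPi_diagPi A' A
  obtain ⟨C, hC⟩ := Submodule.exists_isCompl (homSpace A A)
  have hinj : LinearMap.ker (Λ A ∘ₗ C.subtype) = ⊥ := by
    rw [eq_bot_iff]
    intro c hc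
    have : c.1 ∈ homSpace A A ⊓ C := ⟨by rw [← hker]; exact hc, c.2⟩
    rw [hC.inf_eq_bot, Submodule.mem_bot] at this
    rw [Submodule.mem_bot]
    exact Subtype.ext this
  -- Composition with `P` makes the overdetermined system for `y ∈ C` square, and the identity at
  -- `A' = A`.
  obtain ⟨P, hP⟩ := LinearMap.exists_leftInverse_of_injective _ hinj
  have hPc : Continuous P := LinearMap.continuous_of_finiteDimensional P
  have hone : (1 : Matrix ι ι ℂ) ∈ homSpace A A := fun j => by simp
  obtain ⟨hev, y, hy, hys⟩ := exists_tendsto_solution (t₀ := A)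
    (fun A' => P ∘ₗ Λ A' ∘ₗ C.subtype)
    (fun c => (hPc.comp (hΛ c)).continuousAt) hP (fun A' => -P (Λ A' 1))
    ((hPc.comp (hΛ 1)).neg.continuousAt) (by
      have : Λ A 1 = 0 := by rw [← LinearMap.mem_ker, hker]; exact hone
      rw [this, map_zero, neg_zero])
  refine ⟨fun A' => (y A').1, ?_, ?_⟩
  · have := (continuous_subtype_val.tendsto (0 : C)).comp hy
    exact this
  · filter_upwards [hev, hys] with A' hinj' hyA hequiv
    have hsurj : Function.Surjective (P ∘ₗ Λ A') := by
      have h1 : Function.Surjective (P ∘ₗ Λ A' ∘ₗ C.subtype) :=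
        LinearMap.injective_iff_surjective.1 hinj'
      intro c
      obtain ⟨x, hx⟩ := h1 c
      exact ⟨x, hx⟩
    have hdim : Module.finrank ℂ (homSpace A' A) = Module.finrank ℂ (homSpace A A) := by
      obtain ⟨X, Y, h₁, h₂, hX⟩ := hequiv
      have hY := inverse_mem_homSpace h₁ h₂ hX
      let f : homSpace A' A →ₗ[ℂ] homSpace A A :=
        (mulRightLinearMap ι ℂ X).restrict fun Z hZ => homSpace_comp hZ hX
      let g : homSpace A A →ₗ[ℂ] homSpace A' A :=
        (mulRightLinearMap ι ℂ Y).restrict fun Z hZ => homSpace_comp hZ hY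
      refine (LinearEquiv.ofLinearMap f g ?_ ?_).finrank_eq
      · ext1 Z
        apply Subtype.ext
        change Z.1 * Y * X = Z.1
        rw [Matrix.mul_assoc, h₂, Matrix.mul_one]
      · ext1 Z
        apply Subtype.ext
        change Z.1 * X * Y = Z.1
        rw [Matrix.mul_assoc, h₁, Matrix.mul_one]
    have hle : homSpace A' A ≤ LinearMap.ker (P ∘ₗ Λ A') := by
      rw [← hker]
      exact LinearMap.ker_le_ker_comp _ _
    -- A priori `1 + y` solves only the equations weakened by `P`. Equivalence gives Hom(A', A) the
    -- dimension of Hom(A, A), so the weakened equations have no further solutions.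
    have heq : homSpace A' A = LinearMap.ker (P ∘ₗ Λ A') := by
      refine Submodule.eq_of_le_of_finrank_le hle ?_
      have h1 := LinearMap.finrank_range_add_finrank_ker (P ∘ₗ Λ A')
      rw [LinearMap.range_eq_top.2 hsurj, finrank_top] at h1
      have h2 := Submodule.finrank_add_eq_of_isCompl hC
      omega
    rw [heq, LinearMap.mem_ker, map_add]
    have : (P ∘ₗ Λ A') (y A').1 = -P (Λ A' 1) := hyA
    rw [this]
    exact add_neg_cancel _

lemma isUnit_det_eventually : ∀ᶠ g in 𝓝 (1 : Matrix ι ι ℂ), IsUnit g.det := by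
  have : ContinuousAt (fun g : Matrix ι ι ℂ => g.det) 1 := continuous_id.matrix_det.continuousAt
  filter_upwards [this.eventually_ne (by rw [Matrix.det_one]; exact one_ne_zero)] with g hg
  exact isUnit_iff_ne_zero.2 hg

lemma continuousAt_matrix_inv : ContinuousAt (fun g : Matrix ι ι ℂ => g⁻¹) 1 := by
  have h1 : ContinuousAt (fun g : Matrix ι ι ℂ => g.det) 1 := continuous_id.matrix_det.continuousAt
  have h2 : ContinuousAt (fun g : Matrix ι ι ℂ => (g.det)⁻¹ • g.adjugate) 1 :=
    (h1.inv₀ (by rw [Matrix.det_one]; exact one_ne_zero)).smul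
      continuous_id.matrix_adjugate.continuousAt
  have h3 : (fun g : Matrix ι ι ℂ => g⁻¹) = fun g => (g.det)⁻¹ • g.adjugate := by
    funext g
    rw [Matrix.inv_def, Ring.inverse_eq_inv']
  rwa [h3]

lemma mem_conjClass_of_isUnit {g Y : Matrix ι ι ℂ} (hg : IsUnit g.det) :
    g * Y * g⁻¹ ∈ conjClass Y :=
  ⟨⟨g, g⁻¹, Matrix.mul_nonsing_inv g hg, Matrix.nonsing_inv_mul g hg⟩, rfl⟩

/-- The tangent space to a conjugacy class is the image of the adjoint map. -/
lemma span_tangentConeAt_conjClass (Y : Matrix ι ι ℂ) :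
    Submodule.span ℂ (tangentConeAt ℂ (conjClass Y) Y) = LinearMap.range (adMap Y Y) := by
  apply le_antisymm
  · rw [Submodule.span_le]
    intro w hw
    obtain ⟨α, l, hl, c, d, hd, hds, hcd⟩ := exists_fun_of_mem_tangentConeAt hw
    obtain ⟨y, hy, hev⟩ := exists_conj_near_one (p := 0) (fun _ => Y)
    have hYd : Tendsto (fun n => (fun _ : Fin 1 => Y + d n)) l (𝓝 fun _ => Y) := by
      refine tendsto_pi_nhds.2 fun _ => ?_
      simpa using tendsto_const_nhds.add hd
    have hy' := hy.comp hYd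
    have hlim : Tendsto (fun n => (1 + y fun _ => Y + d n) * (c n • d n)) l (𝓝 w) := by
      have h1 : Tendsto (fun n => 1 + y fun _ => Y + d n) l (𝓝 1) := by
        simpa using tendsto_const_nhds.add hy'
      simpa using h1.mul hcd
    have hcl : IsClosed (LinearMap.range (adMap Y Y) : Set (Matrix ι ι ℂ)) :=
      Submodule.closed_of_finiteDimensional _
    refine hcl.mem_of_tendsto hlim ?_
    filter_upwards [hYd.eventually hev, hds] with n hn hdn
    have hequiv : IsEquivTuple (fun _ : Fin 1 => Y) (fun _ => Y + d n) := by
      obtain ⟨g, hg⟩ := hdn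
      exact IsConjTo.isEquivTuple ⟨g, fun _ => hg⟩
    -- The intertwining relation says that `(1 + y) d` is the image of `y` under `adMap Y Y`;
    -- rescaling and passing to the limit stays in the closed range.
    have h2 := hn hequiv 0
    refine ⟨c n • y fun _ => Y + d n, ?_⟩
    rw [map_smul, Matrix.mul_smul]
    congr 1
    rw [adMap_apply, sub_eq_iff_eq_add]
    simp only [Matrix.mul_add, Matrix.add_mul, Matrix.mul_one, Matrix.one_mul] at h2 ⊢
    have h3 := sub_eq_zero.2 h2
    rw [← sub_eq_zero, ← h3]
    abel
  · rintro _ ⟨X, rfl⟩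
    apply Submodule.subset_span
    -- The tangent vector comes from conjugating by `1 - ε X`; the sign matches `adMap Y Y X = Y X -
    -- X Y`.
    have hg : Tendsto (fun ε : ℂ => (1 : Matrix ι ι ℂ) - ε • X) (𝓝[≠] 0) (𝓝 1) := by
      have : Continuous fun ε : ℂ => (1 : Matrix ι ι ℂ) - ε • X := by fun_prop
      have := (this.tendsto 0).mono_left (nhdsWithin_le_nhds (s := {0}ᶜ))
      simpa using this
    have hginv : Tendsto (fun ε : ℂ => ((1 : Matrix ι ι ℂ) - ε • X)⁻¹) (𝓝[≠] 0) (𝓝 1) := by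
      have := continuousAt_matrix_inv.tendsto.comp hg
      rwa [inv_one] at this
    have hunit := hg.eventually isUnit_det_eventually
    refine mem_tangentConeAt_of_seq (𝓝[≠] (0 : ℂ)) (fun ε => ε⁻¹)
      (fun ε => (1 - ε • X) * Y * (1 - ε • X)⁻¹ - Y) ?_ ?_ ?_
    · have := ((hg.mul tendsto_const_nhds (b := Y)).mul hginv).sub_const Y
      simpa using this
    · filter_upwards [hunit] with ε hε
      rw [add_sub_cancel]
      exact mem_conjClass_of_isUnit hε
    · have hlim : Tendsto (fun ε : ℂ => adMap Y Y X * ((1 : Matrix ι ι ℂ) - ε • X)⁻¹) (𝓝[≠] 0)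
          (𝓝 (adMap Y Y X)) := by
        simpa using tendsto_const_nhds.mul hginv
      refine hlim.congr' ?_
      filter_upwards [hunit, self_mem_nhdsWithin] with ε hε hε0
      have h1 : Y = Y * (1 - ε • X) * (1 - ε • X)⁻¹ := by
        rw [Matrix.mul_assoc, Matrix.mul_nonsing_inv _ hε, Matrix.mul_one]
      have h2 : (1 - ε • X) * Y - Y * (1 - ε • X) = ε • adMap Y Y X := by
        simp only [adMap_apply, Matrix.sub_mul, Matrix.mul_sub, Matrix.one_mul, Matrix.mul_one,
          Matrix.smul_mul, Matrix.mul_smul, smul_sub]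
        abel
      have h3 : (1 - ε • X) * Y * (1 - ε • X)⁻¹ - Y =
          ((1 - ε • X) * Y - Y * (1 - ε • X)) * (1 - ε • X)⁻¹ := by
        rw [Matrix.sub_mul ((1 - ε • X) * Y) (Y * (1 - ε • X)), ← h1]
      rw [h3, h2, Matrix.smul_mul, smul_smul, inv_mul_cancel₀ hε0, one_smul]

lemma classDim_eq (Y : Matrix ι ι ℂ) :
    classDim Y = Module.finrank ℂ (LinearMap.range (adMap Y Y)) := by
  rw [classDim, span_tangentConeAt_conjClass]

lemma rigidityIndex_eq_chi (A : Fin (p + 1) → Matrix ι ι ℂ) : rigidityIndex A = chi A A := by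
  rw [rigidityIndex, chi_eq_sub_rank, pow_two]
  simp only [classDim_eq]

end Perturbation
end DeligneSimpson

namespace DeligneSimpson

open Matrix Filter Topology
set_option linter.unusedSectionVars false

/-! ### Rigidity under small conjugations passes to the ends of extensions -/

section ConjugationRigidity

variable {p : ℕ} {ι κ : Type} [Fintype ι] [DecidableEq ι] [Fintype κ] [DecidableEq κ]

lemma continuous_derivProd {T : Type*} [TopologicalSpace T] (n : ℕ) {a : T → Fin n → Matrix ι ι ℂ}
    {b : T → Fin n → Matrix κ κ ℂ} {Y : T → Fin n → Matrix κ ι ℂ} (ha : Continuous a)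
    (hb : Continuous b) (hY : Continuous Y) :
    Continuous (fun t => derivProd n (a t) (b t) (Y t)) ∧
      Continuous fun t => (List.ofFn (a t)).prod := by
  induction n with
  | zero => simpa [derivProd] using ⟨continuous_const, continuous_const⟩
  | succ n ih =>
    obtain ⟨h₁, h₂⟩ := ih (a := fun t i => a t i.succ) (b := fun t i => b t i.succ)
      (Y := fun t i => Y t i.succ) (continuous_pi fun i => (continuous_apply _).comp ha)
      (continuous_pi fun i => (continuous_apply _).comp hb)
      (continuous_pi fun i => (continuous_apply _).comp hY)
    have ha0 : Continuous fun t => a t 0 := (continuous_apply _).comp ha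
    have hb0 : Continuous fun t => b t 0 := (continuous_apply _).comp hb
    have hY0 : Continuous fun t => Y t 0 := (continuous_apply _).comp hY
    refine ⟨?_, ?_⟩
    · simp only [derivProd]
      exact (hY0.matrix_mul h₂).add (hb0.matrix_mul h₁)
    · simp only [List.ofFn_succ, List.prod_cons]
      exact ha0.matrix_mul h₂

lemma continuousAt_relDeriv {T : Type*} [TopologicalSpace T] (v : Version) {t₀ : T}
    {a : T → Fin (p + 1) → Matrix ι ι ℂ} {b : T → Fin (p + 1) → Matrix κ κ ℂ}
    {Y : T → Fin (p + 1) → Matrix κ ι ℂ} (ha : ContinuousAt a t₀) (hb : ContinuousAt b t₀)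
    (hY : ContinuousAt Y t₀) : ContinuousAt (fun t => relDeriv v (a t) (b t) (Y t)) t₀ := by
  have h : Continuous fun x : (Fin (p + 1) → Matrix ι ι ℂ) × (Fin (p + 1) → Matrix κ κ ℂ) ×
      (Fin (p + 1) → Matrix κ ι ℂ) => relDeriv v x.1 x.2.1 x.2.2 := by
    cases v with
    | additive =>
      simp only [relDeriv_additive]
      exact continuous_finsetSum _ fun j _ =>
        (continuous_apply j).comp (continuous_snd.comp continuous_snd)
    | multiplicative =>
      exact (continuous_derivProd (p + 1) continuous_fst (continuous_fst.comp continuous_snd)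
        (continuous_snd.comp continuous_snd)).1
  exact h.continuousAt.comp (x := t₀) (f := fun t => (a t, b t, Y t)) (ha.prodMk (hb.prodMk hY))

/-- The conjugate of a tuple by a tuple of matrices. -/
noncomputable def conjTuple (g A : Fin (p + 1) → Matrix ι ι ℂ) : Fin (p + 1) → Matrix ι ι ℂ :=
  fun j => g j * A j * (g j)⁻¹

lemma conjTuple_one (A : Fin (p + 1) → Matrix ι ι ℂ) : conjTuple 1 A = A := by
  funext j
  simp [conjTuple]

lemma continuousAt_inv_apply (j : Fin (p + 1)) :
    ContinuousAt (fun g : Fin (p + 1) → Matrix ι ι ℂ => (g j)⁻¹) 1 :=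
  Tendsto.comp (f := fun g : Fin (p + 1) → Matrix ι ι ℂ => g j) (g := fun m => m⁻¹)
    continuousAt_matrix_inv.tendsto ((continuous_apply j).tendsto 1)

lemma continuousAt_conjTuple (A : Fin (p + 1) → Matrix ι ι ℂ) :
    ContinuousAt (fun g => conjTuple g A) 1 := by
  refine continuousAt_pi.2 fun j => ?_
  exact ((continuous_apply j).continuousAt.mul continuousAt_const).mul (continuousAt_inv_apply j)

lemma isUnit_det_eventually_pi :
    ∀ᶠ g in 𝓝 (1 : Fin (p + 1) → Matrix ι ι ℂ), ∀ j, IsUnit (g j).det :=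
  eventually_all.2 fun j =>
    ((continuous_apply j).tendsto (1 : Fin (p + 1) → Matrix ι ι ℂ)).eventually isUnit_det_eventually

/-- Rigidity with respect to conjugations of the matrices of the tuple by matrices close to `1`. -/
def IsConjRigid (v : Version) (A : Fin (p + 1) → Matrix ι ι ℂ) : Prop :=
  IsSolution v A ∧ ∀ᶠ g in 𝓝 (1 : Fin (p + 1) → Matrix ι ι ℂ),
    IsSolution v (conjTuple g A) → IsEquivTuple A (conjTuple g A)

variable {v : Version} {A : Fin (p + 1) → Matrix ι ι ℂ} {B : Fin (p + 1) → Matrix κ κ ℂ}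

lemma IsRigid.isConjRigid (h : IsRigid v A) : IsConjRigid v A := by
  obtain ⟨hA, U, hU, hUA⟩ := h
  refine ⟨hA, ?_⟩
  have hc : Tendsto (fun g => conjTuple g A) (𝓝 1) (𝓝 A) := by
    have := (continuousAt_conjTuple A).tendsto
    rwa [conjTuple_one] at this
  filter_upwards [hc hU, isUnit_det_eventually_pi] with g hg hdet hsol
  exact (hUA _ hg hsol fun j => mem_conjClass_of_isUnit (hdet j)).isEquivTuple

lemma IsConjRigid.of_isEquivTuple (h : IsConjRigid v A) (he : IsEquivTuple A B) :
    IsConjRigid v B := by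
  refine ⟨he.isSolution h.1, ?_⟩
  have he' := he
  obtain ⟨X, Y, h₁, h₂, hX⟩ := he'
  have hY := inverse_mem_homSpace h₁ h₂ hX
  have hc : Tendsto (fun (g : Fin (p + 1) → Matrix κ κ ℂ) j => Y * g j * X) (𝓝 1) (𝓝 1) := by
    have : Continuous fun (g : Fin (p + 1) → Matrix κ κ ℂ) j => Y * g j * X :=
      continuous_pi fun j =>
        (continuous_const.matrix_mul (continuous_apply j)).matrix_mul continuous_const
    have := this.tendsto 1
    have h1 : (fun j => Y * (1 : Fin (p + 1) → Matrix κ κ ℂ) j * X) = 1 := by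
      funext j
      simp [h₂]
    rwa [h1] at this
  filter_upwards [hc.eventually h.2, isUnit_det_eventually_pi] with g hg hdet hsol
  have hinv : ∀ j, (Y * g j * X)⁻¹ = Y * (g j)⁻¹ * X := fun j => by
    refine Matrix.inv_eq_right_inv ?_
    calc Y * g j * X * (Y * (g j)⁻¹ * X) = Y * (g j * (X * Y) * (g j)⁻¹) * X := by
          simp only [Matrix.mul_assoc]
      _ = 1 := by rw [h₁, Matrix.mul_one, Matrix.mul_nonsing_inv _ (hdet j), Matrix.mul_one, h₂]
  have hequiv : IsEquivTuple (conjTuple g B) (conjTuple (fun j => Y * g j * X) A) := by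
    refine ⟨Y, X, h₂, h₁, fun j => ?_⟩
    change (Y * g j * X) * A j * (Y * g j * X)⁻¹ * Y = Y * (g j * B j * (g j)⁻¹)
    rw [hinv]
    calc Y * g j * X * A j * (Y * (g j)⁻¹ * X) * Y =
        Y * g j * ((X * A j) * Y) * (g j)⁻¹ * (X * Y) := by simp only [Matrix.mul_assoc]
      _ = Y * (g j * B j * (g j)⁻¹) := by
        rw [← hX j, Matrix.mul_assoc _ X, h₁, Matrix.mul_one, Matrix.mul_one]
        simp only [Matrix.mul_assoc]
  exact (he.symm.trans (hg (hequiv.isSolution hsol))).trans hequiv.symm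

variable {K K' : Fin (p + 1) → Matrix ι ι ℂ} {N N' : Fin (p + 1) → Matrix ι κ ℂ}
  {Q Q' : Fin (p + 1) → Matrix κ κ ℂ}

/-- The lower left block of an equivalence lies in Hom(K, Q') = 0, so its diagonal blocks are
invertible intertwiners. -/
lemma IsEquivTuple.of_blk (h : IsEquivTuple (blk K N Q) (blk K' N' Q'))
    (hKQ : homSpace K Q' = ⊥) : IsEquivTuple K K' ∧ IsEquivTuple Q Q' := by
  obtain ⟨X, Y, h₁, h₂, hX⟩ := h
  rw [← fromBlocks_toBlocks X] at h₁ h₂ hX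
  rw [← fromBlocks_toBlocks Y] at h₁ h₂
  have hX' := fun j => hX j
  simp only [blk, fromBlocks_multiply] at hX'
  have hc : X.toBlocks₂₁ = 0 := by
    have : X.toBlocks₂₁ ∈ homSpace K Q' := fun j => by
      have := (fromBlocks_inj.1 (hX' j)).2.2.1
      simpa using this
    rwa [hKQ, Submodule.mem_bot] at this
  rw [fromBlocks_multiply, ← fromBlocks_one, fromBlocks_inj, hc] at h₁ h₂
  simp only [hc, Matrix.zero_mul, Matrix.mul_zero, zero_add, add_zero] at h₁ h₂ hX'
  refine ⟨⟨X.toBlocks₁₁, Y.toBlocks₁₁, mul_eq_one_comm.1 h₂.1, h₂.1, fun j => ?_⟩,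
    X.toBlocks₂₂, Y.toBlocks₂₂, h₁.2.2.2, mul_eq_one_comm.1 h₁.2.2.2, fun j => ?_⟩
  · exact (fromBlocks_inj.1 (hX' j)).1
  · exact (fromBlocks_inj.1 (hX' j)).2.2.2

/-- An extension of two tuples without homomorphisms from the sub to the quotient deforms along with
small deformations of its ends. -/
lemma exists_conjTuple_blk (hsol : IsSolution v (blk K N Q)) (hKQ : homSpace K Q = ⊥) :
    ∃ G : (Fin (p + 1) → Matrix ι ι ℂ) × (Fin (p + 1) → Matrix κ κ ℂ) →
        Fin (p + 1) → Matrix (ι ⊕ κ) (ι ⊕ κ) ℂ, Tendsto G (𝓝 1) (𝓝 1) ∧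
      ∀ᶠ t in 𝓝 1, IsSolution v (conjTuple t.1 K) → IsSolution v (conjTuple t.2 Q) →
        ∃ N', conjTuple (G t) (blk K N Q) = blk (conjTuple t.1 K) N' (conjTuple t.2 Q) ∧
          IsSolution v (conjTuple (G t) (blk K N Q)) := by
  obtain ⟨hK, hQ, hN⟩ := isSolution_blk.1 hsol
  -- Corners are sought in the image of a fixed right inverse `S`, which makes the system for the
  -- relation square and the identity at `t = 1`.
  obtain ⟨S, hS⟩ := LinearMap.exists_rightInverse_of_surjective _
    (LinearMap.range_eq_top.2 (relDeriv_adPi_surjective (B := K) hQ hKQ))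
  have hSc : Continuous S := LinearMap.continuous_of_finiteDimensional S
  have hfst : ContinuousAt (fun t : (Fin (p + 1) → Matrix ι ι ℂ) × (Fin (p + 1) → Matrix κ κ ℂ) =>
      conjTuple t.1 K) 1 :=
    Tendsto.comp (f := Prod.fst) (g := fun g => conjTuple g K)
      (continuousAt_conjTuple K).tendsto (continuous_fst.tendsto 1)
  have hsnd : ContinuousAt (fun t : (Fin (p + 1) → Matrix ι ι ℂ) × (Fin (p + 1) → Matrix κ κ ℂ) =>
      conjTuple t.2 Q) 1 :=
    Tendsto.comp (f := Prod.snd) (g := fun g => conjTuple g Q)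
      (continuousAt_conjTuple Q).tendsto (continuous_snd.tendsto 1)
  have hN' : ContinuousAt (fun (t : (Fin (p + 1) → Matrix ι ι ℂ) × (Fin (p + 1) → Matrix κ κ ℂ)) j =>
      t.1 j * N j * (t.2 j)⁻¹) 1 := by
    refine continuousAt_pi.2 fun j => ?_
    have h1 : ContinuousAt (fun t : (Fin (p + 1) → Matrix ι ι ℂ) ×
        (Fin (p + 1) → Matrix κ κ ℂ) => t.1 j * N j) 1 :=
      (((continuous_apply j).comp continuous_fst).matrix_mul continuous_const).continuousAt
    have h2 : ContinuousAt (fun t : (Fin (p + 1) → Matrix ι ι ℂ) ×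
        (Fin (p + 1) → Matrix κ κ ℂ) => (t.2 j)⁻¹) 1 :=
      Tendsto.comp (f := Prod.snd) (g := fun g : Fin (p + 1) → Matrix κ κ ℂ => (g j)⁻¹)
        (continuousAt_inv_apply j).tendsto (continuous_snd.tendsto 1)
    have h3 : Continuous fun q : Matrix ι κ ℂ × Matrix κ κ ℂ => q.1 * q.2 :=
      continuous_fst.matrix_mul continuous_snd
    exact h3.continuousAt.comp (x := 1) (f := fun t : (Fin (p + 1) → Matrix ι ι ℂ) ×
        (Fin (p + 1) → Matrix κ κ ℂ) => (t.1 j * N j, (t.2 j)⁻¹)) (h1.prodMk h2)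
  have had : ∀ X : Fin (p + 1) → Matrix ι κ ℂ, ContinuousAt (fun t : (Fin (p + 1) →
      Matrix ι ι ℂ) × (Fin (p + 1) → Matrix κ κ ℂ) =>
        adPi (conjTuple t.2 Q) (conjTuple t.1 K) X) 1 := fun X => by
    have h3 : Continuous fun q : (Fin (p + 1) → Matrix ι ι ℂ) × (Fin (p + 1) → Matrix κ κ ℂ) =>
        adPi q.2 q.1 X := continuous_pi fun j =>
      ((((continuous_apply j).comp continuous_fst).matrix_mul continuous_const).sub
        (continuous_const.matrix_mul ((continuous_apply j).comp continuous_snd)) :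
        Continuous fun q : (Fin (p + 1) → Matrix ι ι ℂ) × (Fin (p + 1) → Matrix κ κ ℂ) =>
          q.1 j * X j - X j * q.2 j)
    exact h3.continuousAt.comp (x := 1) (f := fun t : (Fin (p + 1) → Matrix ι ι ℂ) ×
        (Fin (p + 1) → Matrix κ κ ℂ) => (conjTuple t.1 K, conjTuple t.2 Q)) (hfst.prodMk hsnd)
  obtain ⟨-, y, hy, hys⟩ := exists_tendsto_solution (T := (Fin (p + 1) → Matrix ι ι ℂ) ×
      (Fin (p + 1) → Matrix κ κ ℂ)) (t₀ := 1)
    (fun t => relDeriv v (conjTuple t.2 Q) (conjTuple t.1 K) ∘ₗ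
      adPi (conjTuple t.2 Q) (conjTuple t.1 K) ∘ₗ S)
    (fun c => continuousAt_relDeriv v hsnd hfst (had (S c)))
    (by
      simp only [Prod.fst_one, Prod.snd_one, conjTuple_one]
      exact hS)
    (fun t => -relDeriv v (conjTuple t.2 Q) (conjTuple t.1 K) fun j => t.1 j * N j * (t.2 j)⁻¹)
    (continuousAt_relDeriv v hsnd hfst hN').neg
    (by
      simp only [Prod.fst_one, Prod.snd_one, conjTuple_one, Pi.one_apply, inv_one, Matrix.one_mul,
        Matrix.mul_one]
      rw [hN, neg_zero])
  -- This is `diag(t.1, t.2)` followed by the unipotent matrix with corner `-S (y t)`, which adds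
  -- `adPi … (S (y t))` to the upper right block of the conjugate.
  refine ⟨fun t j => fromBlocks (t.1 j) (-(S (y t) j * t.2 j)) 0 (t.2 j), ?_, ?_⟩
  · refine tendsto_pi_nhds.2 fun j => ?_
    have h1 : Tendsto (fun t => S (y t) j) (𝓝 1) (𝓝 0) := by
      have h := ((continuous_apply j).comp hSc).tendsto 0
      have h0 : ((fun f : Fin (p + 1) → Matrix ι κ ℂ => f j) ∘ S) 0 = 0 := by simp
      rw [h0] at h
      exact h.comp hy
    have h2 : Continuous fun q : Matrix ι ι ℂ × Matrix κ κ ℂ × Matrix ι κ ℂ =>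
        fromBlocks q.1 (-(q.2.2 * q.2.1)) 0 q.2.1 :=
      continuous_fst.matrix_fromBlocks
        ((continuous_snd.comp continuous_snd).matrix_mul (continuous_fst.comp continuous_snd)).neg
        continuous_const (continuous_fst.comp continuous_snd)
    have h3 := h2.tendsto (1, 1, 0)
    simp only [Matrix.zero_mul, neg_zero, fromBlocks_one] at h3
    refine h3.comp (Tendsto.prodMk_nhds ?_ (Tendsto.prodMk_nhds ?_ h1))
    · exact ((continuous_apply j).comp continuous_fst).tendsto (1 : (Fin (p + 1) →
        Matrix ι ι ℂ) × (Fin (p + 1) → Matrix κ κ ℂ))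
    · exact ((continuous_apply j).comp continuous_snd).tendsto (1 : (Fin (p + 1) →
        Matrix ι ι ℂ) × (Fin (p + 1) → Matrix κ κ ℂ))
  · have hu1 := (continuous_fst.tendsto (1 : (Fin (p + 1) → Matrix ι ι ℂ) ×
      (Fin (p + 1) → Matrix κ κ ℂ))).eventually isUnit_det_eventually_pi
    have hu2 := (continuous_snd.tendsto (1 : (Fin (p + 1) → Matrix ι ι ℂ) ×
      (Fin (p + 1) → Matrix κ κ ℂ))).eventually isUnit_det_eventually_pi
    filter_upwards [hys, hu1, hu2] with t ht ht1 ht2 hsK hsQ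
    have hG : conjTuple (fun j => fromBlocks (t.1 j) (-(S (y t) j * t.2 j)) 0 (t.2 j))
        (blk K N Q) = blk (conjTuple t.1 K) (adPi (conjTuple t.2 Q) (conjTuple t.1 K) (S (y t)) +
          fun j => t.1 j * N j * (t.2 j)⁻¹) (conjTuple t.2 Q) := by
      funext j
      have e1 := Matrix.mul_nonsing_inv _ (ht1 j)
      have e2 := Matrix.mul_nonsing_inv _ (ht2 j)
      have hinv : (fromBlocks (t.1 j) (-(S (y t) j * t.2 j)) 0 (t.2 j))⁻¹ =
          fromBlocks (t.1 j)⁻¹ ((t.1 j)⁻¹ * S (y t) j) 0 (t.2 j)⁻¹ := by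
        refine Matrix.inv_eq_right_inv ?_
        rw [fromBlocks_multiply, ← fromBlocks_one, fromBlocks_inj]
        refine ⟨by simp [e1], ?_, by simp, by simp [e2]⟩
        rw [← Matrix.mul_assoc, e1, Matrix.one_mul, Matrix.neg_mul, Matrix.mul_assoc, e2,
          Matrix.mul_one, add_neg_cancel]
      simp only [conjTuple, blk, hinv, fromBlocks_multiply]
      rw [fromBlocks_inj]
      refine ⟨by simp, ?_, by simp, by simp⟩
      rw [Pi.add_apply, adPi_apply]
      simp only [adMap_apply, Matrix.mul_zero, Matrix.add_mul, Matrix.neg_mul, Matrix.mul_assoc, conjTuple,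
        add_zero]
      abel
    refine ⟨_, hG, ?_⟩
    rw [hG, isSolution_blk]
    refine ⟨hsK, hsQ, ?_⟩
    rw [map_add]
    have h : relDeriv v (conjTuple t.2 Q) (conjTuple t.1 K)
      (adPi (conjTuple t.2 Q) (conjTuple t.1 K) (S (y t))) = _ := ht
    rw [h]
    exact neg_add_cancel _

/-- Rigidity passes to the ends of an extension without homomorphisms from the sub to the
quotient. -/
theorem IsConjRigid.of_blk (h : IsConjRigid v (blk K N Q)) (hKQ : homSpace K Q = ⊥) :
    IsConjRigid v K ∧ IsConjRigid v Q := by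
  obtain ⟨hK, hQ, -⟩ := isSolution_blk.1 h.1
  obtain ⟨G, hG, hGs⟩ := exists_conjTuple_blk h.1 hKQ
  have hev := hGs.and (hG.eventually h.2)
  refine ⟨⟨hK, ?_⟩, hQ, ?_⟩
  · have h1 : Tendsto (fun g : Fin (p + 1) → Matrix ι ι ℂ =>
        (g, (1 : Fin (p + 1) → Matrix κ κ ℂ))) (𝓝 1) (𝓝 1) :=
      (Continuous.prodMk continuous_id continuous_const).tendsto 1
    filter_upwards [h1.eventually hev] with g hg hsol
    obtain ⟨N', hN', hs⟩ := hg.1 hsol (by rwa [conjTuple_one])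
    have h2 := hg.2 hs
    rw [hN'] at h2
    exact (h2.of_blk (by rwa [conjTuple_one])).1
  · have h1 : Tendsto (fun g : Fin (p + 1) → Matrix κ κ ℂ =>
        ((1 : Fin (p + 1) → Matrix ι ι ℂ), g)) (𝓝 1) (𝓝 1) :=
      (Continuous.prodMk continuous_const continuous_id).tendsto 1
    filter_upwards [h1.eventually hev] with g hg hsol
    obtain ⟨N', hN', hs⟩ := hg.1 (by rwa [conjTuple_one]) hsol
    have h2 := hg.2 hs
    rw [hN'] at h2
    -- Reversing the equivalence makes the undeformed `Q` the target, so that Hom(K, Q) = 0 applies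
    -- directly.
    exact (h2.symm.of_blk (by rwa [conjTuple_one])).2.symm

end ConjugationRigidity
end DeligneSimpson

namespace DeligneSimpson

open Matrix Filter Topology
set_option linter.unusedSectionVars false

/-! ### Rigidity under small conjugations forces a positive Euler form -/

section RelationNumerator

variable {p : ℕ} {ι : Type} [Fintype ι] [DecidableEq ι]

/-- The relation imposed on the conjugates of the matrices `A_j` by `G_j`, with denominators
cleared. -/
def relNumerator {S : Type*} [CommRing S] (v : Version) (G A : Fin (p + 1) → Matrix ι ι S) :
    Matrix ι ι S :=
  match v with
  | .additive => ∑ j, (∏ i ∈ Finset.univ.erase j, (G i).det) • (G j * A j * (G j).adjugate)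
  | .multiplicative => (List.ofFn fun j => G j * A j * (G j).adjugate).prod -
      (∏ j, (G j).det) • (1 : Matrix ι ι S)

lemma map_relNumerator {S S' : Type*} [CommRing S] [CommRing S'] (f : S →+* S') (v : Version)
    (G A : Fin (p + 1) → Matrix ι ι S) : f.mapMatrix (relNumerator v G A) =
      relNumerator v (fun j => f.mapMatrix (G j)) fun j => f.mapMatrix (A j) := by
  have hs : ∀ (c : S) (M : Matrix ι ι S), f.mapMatrix (c • M) = f c • f.mapMatrix M := fun c M => by
    ext i k
    simp
  cases v with
  | additive =>
    simp only [relNumerator, map_sum, hs, map_mul, map_prod, RingHom.map_det, RingHom.map_adjugate]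
  | multiplicative =>
    simp only [relNumerator, map_sub, hs, map_list_prod, map_prod, RingHom.map_det, map_one,
      List.map_ofFn, Function.comp_def, map_mul, RingHom.map_adjugate]

lemma prod_ofFn_smul (n : ℕ) (c : Fin n → ℂ) (M : Fin n → Matrix ι ι ℂ) :
    (List.ofFn fun j => c j • M j).prod = (∏ j, c j) • (List.ofFn M).prod := by
  induction n with
  | zero => simp
  | succ n ih =>
    rw [List.ofFn_succ, List.prod_cons, ih, Fin.prod_univ_succ, List.ofFn_succ, List.prod_cons,
      Matrix.smul_mul, Matrix.mul_smul, smul_smul]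

lemma relNumerator_eq_zero_iff {v : Version} {G A : Fin (p + 1) → Matrix ι ι ℂ}
    (hG : ∀ j, IsUnit (G j).det) : relNumerator v G A = 0 ↔ IsSolution v (conjTuple G A) := by
  have hadj : ∀ j, G j * A j * (G j).adjugate = (G j).det • conjTuple G A j := fun j => by
    rw [conjTuple, Matrix.inv_def, Matrix.mul_smul, smul_smul, Ring.mul_inverse_cancel _ (hG j),
      one_smul]
  have hprod : (∏ j, (G j).det) ≠ 0 := Finset.prod_ne_zero_iff.2 fun j _ => (hG j).ne_zero
  cases v with
  | additive =>
    have : relNumerator .additive G A = (∏ j, (G j).det) • ∑ j, conjTuple G A j := by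
      simp only [relNumerator, hadj, smul_smul, Finset.smul_sum]
      refine Finset.sum_congr rfl fun j _ => ?_
      rw [Finset.prod_erase_mul _ _ (Finset.mem_univ j)]
    rw [this, smul_eq_zero_iff_right hprod]
    rfl
  | multiplicative =>
    have : relNumerator .multiplicative G A =
        (∏ j, (G j).det) • ((List.ofFn (conjTuple G A)).prod - 1) := by
      simp only [relNumerator, hadj, prod_ofFn_smul, smul_sub]
    rw [this, smul_eq_zero_iff_right hprod, sub_eq_zero]
    rfl

/-- A linear system of conjugating tuples of dimension greater than the number of equations
contains solutions arbitrarily close to the trivial one. -/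
lemma exists_seq_conjTuple_isSolution {v : Version} {A : Fin (p + 1) → Matrix ι ι ℂ}
    (hA : IsSolution v A) (V : Submodule ℂ (Fin (p + 1) → Matrix ι ι ℂ))
    (hV : Fintype.card ι * Fintype.card ι < Module.finrank ℂ V) :
    ∃ l : ℕ → V, Tendsto l atTop (𝓝 0) ∧ ∀ n, l n ≠ 0 ∧
      ((∀ j, IsUnit ((1 + (l n : Fin (p + 1) → Matrix ι ι ℂ)) j).det) →
        IsSolution v (conjTuple (1 + (l n : Fin (p + 1) → Matrix ι ι ℂ)) A)) := by
  let e := Module.finBasis ℂ V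
  -- The generic point `1 + ∑ x_i e_i` of the affine space `1 + V`; the entries of the relation
  -- become `n²` polynomials in `dim V` unknowns.
  let G : Fin (p + 1) → Matrix ι ι (MvPolynomial (Fin (Module.finrank ℂ V)) ℂ) := fun j =>
    Matrix.of fun r s => MvPolynomial.C ((1 : Matrix ι ι ℂ) r s) +
      ∑ i, MvPolynomial.X i * MvPolynomial.C ((e i).1 j r s)
  let F := relNumerator v G fun j => (A j).map MvPolynomial.C
  have hG : ∀ x j, (MvPolynomial.eval x).mapMatrix (G j) =
      (1 + (e.equivFun.symm x : V).1) j := fun x j => by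
    ext r s
    simp only [G, RingHom.mapMatrix_apply, map_apply, of_apply, map_add, MvPolynomial.eval_C,
      map_sum, map_mul, MvPolynomial.eval_X, Module.Basis.equivFun_symm_apply,
      AddSubmonoidClass.coe_finsetSum, Submodule.coe_smul, Pi.add_apply, Finset.sum_apply,
      Pi.one_apply, Matrix.add_apply, Matrix.sum_apply, Pi.smul_apply, Matrix.smul_apply,
      smul_eq_mul]
  have hF : ∀ x, (MvPolynomial.eval x).mapMatrix F =
      relNumerator v (1 + (e.equivFun.symm x : V).1) A := fun x => by
    rw [map_relNumerator]
    simp only [hG]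
    congr 1
    funext j
    ext r s
    simp
  obtain ⟨x, hx, hxn⟩ := exists_seq_common_zeros (κ := ι × ι)
    (a := Module.finrank ℂ V) (by rwa [Fintype.card_prod]) (fun k => F k.1 k.2) (by
      rintro ⟨r, s⟩
      have h := congrFun (congrFun (hF 0) r) s
      rw [map_zero, Submodule.coe_zero, add_zero, (relNumerator_eq_zero_iff (by simp)).2
        (by rwa [conjTuple_one])] at h
      exact h)
  refine ⟨fun n => e.equivFun.symm (x n), ?_, fun n => ⟨?_, fun hu => ?_⟩⟩
  · have hc : Continuous fun x : Fin (Module.finrank ℂ V) → ℂ => e.equivFun.symm x :=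
      LinearMap.continuous_of_finiteDimensional e.equivFun.symm.toLinearMap
    have := hc.tendsto 0
    rw [map_zero] at this
    exact this.comp hx
  · rw [Ne, LinearEquiv.map_eq_zero_iff]
    exact (hxn n).1
  · rw [← relNumerator_eq_zero_iff hu, ← hF]
    ext r s
    exact (hxn n).2 (r, s)

/-- If the Euler form is not positive at `A`, there are more than `n²` dimensions of conjugating
tuples modulo those that act as a simultaneous conjugation to first order. -/
lemma card_lt_finrank_of_isCompl [Nonempty ι] {A : Fin (p + 1) → Matrix ι ι ℂ} (h : chi A A ≤ 0)
    {V : Submodule ℂ (Fin (p + 1) → Matrix ι ι ℂ)}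
    (hV : IsCompl V (LinearMap.range (diagPi p ι ι) ⊔ LinearMap.ker (adPi A A))) :
    Fintype.card ι * Fintype.card ι < Module.finrank ℂ V := by
  have h1 := Submodule.finrank_sup_add_finrank_inf_eq (LinearMap.range (diagPi p ι ι))
    (LinearMap.ker (adPi A A))
  have h2 := LinearMap.finrank_range_le (diagPi p ι ι)
  rw [Module.finrank_matrix, Module.finrank_self, mul_one] at h2
  -- Scalars act trivially by conjugation; this one dimension makes the final inequality strict.
  have h3 : 1 ≤ Module.finrank ℂ
      (LinearMap.range (diagPi p ι ι) ⊓ LinearMap.ker (adPi A A) : Submodule ℂ _) := by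
    rw [Submodule.one_le_finrank_iff]
    refine (Submodule.ne_bot_iff _).2 ⟨diagPi p ι ι 1, ⟨⟨1, rfl⟩, ?_⟩, fun h => ?_⟩
    · refine LinearMap.mem_ker.2 (funext fun j => ?_)
      change adMap (A j) (A j) 1 = 0
      simp [adMap_apply]
    · exact one_ne_zero (congrFun h 0 : (1 : Matrix ι ι ℂ) = 0)
  have h4 := LinearMap.finrank_range_add_finrank_ker (adPi A A)
  have h5 := Submodule.finrank_add_eq_of_isCompl hV
  rw [chi_eq_sub_finrank_range_adPi] at h
  zify at h1 h2 h3 h4 h5 ⊢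
  linarith

/-- If `chi A A ≤ 0`, the relation has non-trivial solutions `1 + l` near 1 with `l` in a complement
`V` of the trivial directions. Rigidity makes the resulting tuple conjugate to `A` by some `1 + Y`
near 1, which forces `(1 + Y) l` into the trivial directions; transversality survives multiplication
by `1 + Y`, so `l = 0`. -/
theorem IsConjRigid.chi_pos [Nonempty ι] {v : Version} {A : Fin (p + 1) → Matrix ι ι ℂ}
    (h : IsConjRigid v A) : 0 < chi A A := by
  by_contra hchi
  obtain ⟨V, hV⟩ := Submodule.exists_isCompl
    (LinearMap.range (diagPi p ι ι) ⊔ LinearMap.ker (adPi A A))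
  have hV' := hV.symm
  obtain ⟨l, hl, hln⟩ := exists_seq_conjTuple_isSolution h.1 V
    (card_lt_finrank_of_isCompl (not_lt.1 hchi) hV')
  obtain ⟨y, hy, hyA⟩ := exists_conj_near_one A
  have hg : Tendsto (fun n => 1 + (l n : Fin (p + 1) → Matrix ι ι ℂ)) atTop (𝓝 1) := by
    have h1 := (continuous_subtype_val.tendsto (0 : V)).comp hl
    have h2 := (tendsto_const_nhds (x := (1 : Fin (p + 1) → Matrix ι ι ℂ))).add h1
    rwa [Submodule.coe_zero, add_zero] at h2
  have hA' : Tendsto (fun n => conjTuple (1 + (l n : Fin (p + 1) → Matrix ι ι ℂ)) A) atTop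
      (𝓝 A) := by
    have := (continuousAt_conjTuple A).tendsto.comp hg
    rwa [conjTuple_one] at this
  let π := V.projectionOnto _ hV'
  have hπ : Continuous π := LinearMap.continuous_of_finiteDimensional π
  let Λ : Matrix ι ι ℂ → V →ₗ[ℂ] V := fun Y =>
    π ∘ₗ (LinearMap.pi fun j => mulLeftLinearMap ι ℂ (1 + Y) ∘ₗ LinearMap.proj j) ∘ₗ V.subtype
  have hΛ : ∀ Y c, Λ Y c = π fun j => (1 + Y) * c.1 j := fun Y c => rfl
  -- Only the injectivity for small `Y` is needed, so the right-hand side is taken to be zero.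
  obtain ⟨hinj, -⟩ := exists_tendsto_solution (t₀ := (0 : Matrix ι ι ℂ)) Λ
    (fun c => by
      simp only [hΛ]
      refine (hπ.comp (continuous_pi fun j => ?_)).continuousAt
      exact (continuous_const.add continuous_id).matrix_mul continuous_const)
    (by
      ext1 c
      rw [hΛ]
      simp only [add_zero, Matrix.one_mul]
      exact Submodule.projectionOnto_apply_left hV' c)
    (fun _ => 0) continuousAt_const rfl
  obtain ⟨n, hn1, hn2, hn3, hn4⟩ := ((hg.eventually isUnit_det_eventually_pi).and
    ((hg.eventually h.2).and ((hA'.eventually hyA).and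
      ((hy.comp hA').eventually hinj)))).exists
  have hmem := hn3 (hn2 ((hln n).2 hn1))
  refine (hln n).1 (hn4 ?_)
  simp only [Function.comp_apply]
  set g := 1 + (l n : Fin (p + 1) → Matrix ι ι ℂ) with hgdef
  set Y := y (conjTuple g A)
  rw [map_zero, hΛ, ← LinearMap.mem_ker, Submodule.ker_projectionOnto]
  -- Undoing the conjugation by `g` with `1 + Y` fixes `A`, so each `(1 + Y) g_j` commutes with
  -- `A_j`.
  have hζ : (fun j => (1 + Y) * g j - 1) ∈ LinearMap.ker (adPi A A) := by
    rw [LinearMap.mem_ker]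
    funext j
    change adMap (A j) (A j) ((1 + Y) * g j - 1) = 0
    rw [adMap_apply, Matrix.mul_sub, Matrix.sub_mul, ← Matrix.mul_assoc, hmem j]
    simp only [conjTuple]
    rw [Matrix.mul_assoc (1 + Y), Matrix.mul_assoc _ (g j)⁻¹, Matrix.nonsing_inv_mul _ (hn1 j),
      Matrix.mul_one, ← Matrix.mul_assoc]
    simp
  have : (fun j => (1 + Y) * (l n).1 j) =
      diagPi p ι ι (-Y) + fun j => (1 + Y) * g j - 1 := by
    funext j
    change _ = -Y + ((1 + Y) * (1 + (l n).1 j) - 1)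
    rw [Matrix.mul_add, Matrix.mul_one]
    abel
  rw [this]
  exact Submodule.add_mem_sup ⟨_, rfl⟩ hζ

end RelationNumerator
end DeligneSimpson

namespace DeligneSimpson

open Matrix Filter Topology
set_option linter.unusedSectionVars false

/-! ### Irreducible subquotients of rigid solutions -/

section Subquotients

variable {p : ℕ} {ι κ : Type} [Fintype ι] [DecidableEq ι] [Fintype κ] [DecidableEq κ]
  {v : Version}

theorem IsInfRigid.chi_pos_of_isSubquotient {n : ℕ} {A : Fin (p + 1) → Matrix (Fin n) (Fin n) ℂ}
    (hA : IsInfRigid v A) {B : Fin (p + 1) → Matrix κ κ ℂ} (hB : IsIrreducibleTuple B)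
    (hBA : IsSubquotient B A) : 0 < chi B B :=
  DeligneSimpson.chi_pos_of_isSubquotient (fun _ => IsInfRigid v)
    (fun _ _ _ _ _ _ _ h he h0 => (h.of_isEquivTuple he).of_blk h0)
    (fun _ _ hn h => have := Fin.pos_iff_nonempty.1 hn; h.chi_pos) n A hA B hB hBA

theorem IsConjRigid.chi_pos_of_isSubquotient {n : ℕ} {A : Fin (p + 1) → Matrix (Fin n) (Fin n) ℂ}
    (hA : IsConjRigid v A) {B : Fin (p + 1) → Matrix κ κ ℂ} (hB : IsIrreducibleTuple B)
    (hBA : IsSubquotient B A) : 0 < chi B B :=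
  DeligneSimpson.chi_pos_of_isSubquotient (fun _ => IsConjRigid v)
    (fun _ _ _ _ _ _ _ h he h0 => (h.of_isEquivTuple he).of_blk h0)
    (fun _ _ hn h => have := Fin.pos_iff_nonempty.1 hn; h.chi_pos) n A hA B hB hBA

lemma IsReducibleTuple.not_isIrreducibleTuple {A : Fin (p + 1) → Matrix ι ι ℂ}
    (h : IsReducibleTuple A) : ¬ IsIrreducibleTuple A := by
  obtain ⟨W, hW, h₁, h₂⟩ := h
  exact fun hA => (hA.2 W hW).elim h₁ h₂

lemma IsReducibleTuple.nonempty {A : Fin (p + 1) → Matrix ι ι ℂ} (h : IsReducibleTuple A) :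
    Nonempty ι := by
  obtain ⟨W, -, h₁, -⟩ := h
  by_contra hι
  rw [not_nonempty_iff] at hι
  exact h₁ (Subsingleton.elim _ _)

/-- A block triangular form of a reducible tuple with irreducible diagonal blocks has at least two
blocks. -/
lemma IsReducibleTuple.two_le {n s : ℕ} {A A' : Fin (p + 1) → Matrix (Fin n) (Fin n) ℂ}
    {b : Fin n → Fin s} (h : IsReducibleTuple A) (he : IsEquivTuple A A')
    (hirr : ∀ i, IsIrreducibleTuple fun j => (A' j).toSquareBlock b i) : 2 ≤ s := by
  obtain ⟨a⟩ := h.nonempty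
  by_contra hs
  have hsub : ∀ i k : Fin s, i = k := fun i k => Fin.ext (by omega)
  refine h.not_isIrreducibleTuple (he.symm.isIrreducibleTuple (IsEquivTuple.isIrreducibleTuple
    (isEquivTuple_of_equiv (Equiv.subtypeUnivEquiv fun c => hsub (b c) (b a)).symm ?_)
    (hirr (b a))))
  intro j c d
  rfl

theorem exists_blockTriangular_of_rigidityIndex_eq_two {n : ℕ}
    {A : Fin (p + 1) → Matrix (Fin n) (Fin n) ℂ} (hsol : IsSolution v A)
    (hred : IsReducibleTuple A) (hcent : HasTrivialCentralizer A) (hA : rigidityIndex A = 2) :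
    ∃ (A' : Fin (p + 1) → Matrix (Fin n) (Fin n) ℂ) (s : ℕ) (b : Fin n → Fin s),
      IsConjTo A A' ∧ 2 ≤ s ∧ Monotone b ∧ (∀ j, (A' j).BlockTriangular b) ∧
      ∀ i : Fin s, IsIrreducibleTuple (fun j => (A' j).toSquareBlock b i) ∧
        rigidityIndex (fun j => (A' j).toSquareBlock b i) = 2 := by
  rw [rigidityIndex_eq_chi] at hA
  have hrig := isInfRigid_of_chi_eq_two hsol hcent hA
  obtain ⟨A', s, b, he, hb, htri, hirr⟩ := exists_blockTriangular n A
  refine ⟨A', s, b, he.isConjTo, hred.two_le he hirr, hb, htri, fun i => ⟨hirr i, ?_⟩⟩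
  have hsub := he.symm.isSubquotient (isSubquotient_toSquareBlock htri i)
  rw [rigidityIndex_eq_chi]
  exact (hirr i).chi_eq_two (hsub.isSolution hsol) (hrig.chi_pos_of_isSubquotient (hirr i) hsub)

/-- Irreducible subquotients of rigid solutions are determined by their conjugacy classes. -/
theorem IsRigid.isRigidOn_of_isSubquotient {n : ℕ} {A : Fin (p + 1) → Matrix (Fin n) (Fin n) ℂ}
    (hA : IsRigid v A) {B : Fin (p + 1) → Matrix κ κ ℂ} (hBA : IsSubquotient B A)
    (hB : IsIrreducibleTuple B) (U : Set (Fin (p + 1) → Matrix κ κ ℂ)) : IsRigidOn v B U :=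
  have hs := hBA.isSolution hA.1
  fun _ _ hs' hconj => hB.isConjTo_of_chi_eq_two hs
    (hB.chi_eq_two hs (hA.isConjRigid.chi_pos_of_isSubquotient hB hBA)) hs' hconj

lemma IsZariskiRigid.isRigid {A : Fin (p + 1) → Matrix ι ι ℂ} (hA : IsZariskiRigid v A) :
    IsRigid v A := by
  obtain ⟨hs, f, hf, h⟩ := hA
  refine ⟨hs, _, IsOpen.mem_nhds ?_ hf, h⟩
  have hc : Continuous fun A' : Fin (p + 1) → Matrix ι ι ℂ =>
      MvPolynomial.eval (fun k : Fin (p + 1) × ι × ι => A' k.1 k.2.1 k.2.2) f :=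
    (MvPolynomial.continuous_eval f).comp (continuous_pi fun k =>
      (continuous_apply k.2.2).comp ((continuous_apply k.2.1).comp (continuous_apply k.1)))
  exact isOpen_ne_fun hc continuous_const

end Subquotients
end DeligneSimpson

open DeligneSimpson
theorem proposition1p19 (v : Version) (p n : ℕ) :
    (∀ A : Fin (p + 1) → Matrix (Fin n) (Fin n) ℂ,
      IsSolution v A → IsReducibleTuple A → HasTrivialCentralizer A → rigidityIndex A = 2 →
        ∃ (A' : Fin (p + 1) → Matrix (Fin n) (Fin n) ℂ) (s : ℕ) (b : Fin n → Fin s),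
          IsConjTo A A' ∧ 2 ≤ s ∧ Monotone b ∧ (∀ j, (A' j).BlockTriangular b) ∧
          ∀ i : Fin s, IsIrreducibleTuple (fun j => (A' j).toSquareBlock b i) ∧
            rigidityIndex (fun j => (A' j).toSquareBlock b i) = 2) ∧
    (∀ A : Fin (p + 1) → Matrix (Fin n) (Fin n) ℂ, IsRigid v A →
      ∀ (m : ℕ) (B : Fin (p + 1) → Matrix (Fin m) (Fin m) ℂ),
        IsSubquotient B A → IsIrreducibleTuple B → IsRigid v B) ∧
    (∀ A : Fin (p + 1) → Matrix (Fin n) (Fin n) ℂ, IsZariskiRigid v A →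
      ∀ (m : ℕ) (B : Fin (p + 1) → Matrix (Fin m) (Fin m) ℂ),
        IsSubquotient B A → IsIrreducibleTuple B → IsZariskiRigid v B) := by
  refine ⟨fun A h₁ h₂ h₃ h₄ => exists_blockTriangular_of_rigidityIndex_eq_two h₁ h₂ h₃ h₄,
    -- Irreducible subquotients are determined by their classes globally, so the neighbourhood can
    -- be the whole space, cut out in the Zariski case by the constant polynomial 1.
    fun A hA m B hBA hB => ⟨hBA.isSolution hA.1, Set.univ, Filter.univ_mem,
      hA.isRigidOn_of_isSubquotient hBA hB _⟩,
    fun A hA m B hBA hB => ⟨hBA.isSolution hA.1, 1, ?_,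
      hA.isRigid.isRigidOn_of_isSubquotient hBA hB _⟩⟩
  rw [map_one]
  exact one_ne_zero
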